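/- Let $G$ be a compact, simply connected, semisimple Lie group with Lie algebra $LG$, and let $\rho$ be a smooth unitary representation of $G$ on a finite-dimensional complex Hilbert space $V$. Let $h$ be a smooth Riemannian metric on $S^3$, and let $p\colon S^3\to S^3$ be a parity transformation of $(S^3,h)$, i.e. an orientation-reversing, involutive isometry with exactly two fixed points. Let $\mathcal C$ be a charge conjugation of $LG$ (a Chevalley inversion), i.e. an automorphism of $LG$ whose restriction to the Lie algebra of some maximal torus is $-\mathrm{id}$. A gauge potential is a smooth, globally defined $LG$-valued one-form on $S^3$. A smooth map $W\colon S^3\to G$ acts on gauge potentials by $A\mapsto \mathrm{Ad}(W^{-1})A+W^{-1}dW$, two potentials related in this way are gauge equivalent, and a pure gauge is a potential of the form $W^{-1}dW$. Put $A^{\mathrm{CP}}:=\mathcal C\circ p^*A$, and call $A$ CP-symmetric if $A^{\mathrm{CP}}$ is gauge equivalent to $A$. For a gauge potential $A$ let $\mathcal D(A)$ be the Dirac operator of $(S^3,h)$ twisted by $A$, acting on smooth spinor fields with values in $V$: in a global smooth $h$-orthonormal frame $(e_k)$, which trivializes the spinor bundle, spinor fields are functions $S^3\to\mathbb C^2\otimes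 V$ and $$\mathcal D(A)\psi=\sum_k\gamma_k\Bigl(e_k\psi+\tfrac14\sum_{i,j}h(\nabla_{e_k}e_i,e_j)\,\gamma_i\gamma_j\psi+L\rho(A(e_k))\psi\Bigr),\qquad \gamma_k=-\mathrm i\sigma_k,$$ where $\nabla$ is the Levi-Civita connection and $\sigma_k$ are the Pauli matrices. Then, for every such frame, every CP-symmetric gauge potential $A$ on $(S^3,h)$ satisfies assumption (A2): there is a family $A_{(\tau)}$, $\tau\in[-1,1]$, of gauge potentials, smooth in $(\tau,x)\in[-1,1]\times S^3$, with $A_{(0)}=A$, such that 1. $A_{(-1)}$ and $A_{(+1)}$ are pure gauges; 2. the family of Dirac operators is reflection antisymmetric: for every $\tau\in[-1,1]$ the operator $\mathcal D(A_{(\tau)})$ is conjugate to $-\mathcal D(A_{(-\tau)})$, that is, there is an antilinear bijection $U$ of spinor fields, preserving smoothness in both directions and satisfying $|U\psi|(x)=|\psi|(p(x))$ for all $x$ (so $U$ is antiunitary on $L^2$), with $U\,\mathcal D(A_{(\tau)})\psi=-\mathcal D(A_{(-\tau)})\,U\psi$ for all smooth $\psi$. Moreover the family can be chosen compatible with CP: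 for every $\tau\in[0,1]$, the potential $A_{(-\tau)}$ is gauge equivalent to $A_{(\tau)}^{\mathrm{CP}}$. -/

import Mathlib

open scoped Manifold ContDiff
open Set

noncomputable section

/-! ### The three-sphere, its metric and orthonormal frames -/

/-- The unit sphere of `ℝ⁴`, with Mathlib's smooth structure. -/
abbrev S3 : Type := Metric.sphere (0 : EuclideanSpace ℝ (Fin (3 + 1))) 1

/-- A (not necessarily smooth) vector field on `S³`. -/
abbrev VField : Type := (x : S3) → TangentSpace (𝓡 3) x

/-- Smoothness of a vector field. -/
def VField.Smooth (X : VField) : Prop :=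
  ContMDiff (𝓡 3) (𝓡 3).tangent ∞ (fun x => (⟨x, X x⟩ : TangentBundle (𝓡 3) S3))

/-- A smooth Riemannian metric on `S³`. -/
abbrev S3Metric : Type :=
  Bundle.ContMDiffRiemannianMetric (𝓡 3) ∞ (EuclideanSpace ℝ (Fin 3))
    (fun x : S3 => TangentSpace (𝓡 3) x)

/-- A global smooth orthonormal frame of `(S³, h)`. Such frames exist because `S³` is
parallelizable; a frame trivializes the (unique) spin structure, and both orientations of the
frame are allowed, which accounts for the two inequivalent representations of the
three-dimensional Clifford algebra. -/
structure IsOrthonormalFrame (h : S3Metric) (E : Fin 3 → VField) : Prop where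
  smooth : ∀ k, (E k).Smooth
  orthonormal : ∀ x i j, h.inner x (E i x) (E j x) = if i = j then 1 else 0

/-- The connection coefficients `ω k i j = h(∇_{E k} E i, E j)` of the Levi-Civita connection in an
orthonormal frame, given by the Koszul formula. -/
def leviCivitaCoeff (h : S3Metric) (E : Fin 3 → VField) (k i j : Fin 3) (x : S3) : ℝ :=
  (1 / 2) * (h.inner x (VectorField.mlieBracket (𝓡 3) (E k) (E i) x) (E j x)
    - h.inner x (VectorField.mlieBracket (𝓡 3) (E i) (E j) x) (E k x)
    + h.inner x (VectorField.mlieBracket (𝓡 3) (E j) (E k) x) (E i x))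

/-- The matrix of the differential of `p : S³ → S³` at `x` with respect to the frame `E`. -/
def frameMatrix (h : S3Metric) (E : Fin 3 → VField) (p : S3 → S3) (x : S3) :
    Matrix (Fin 3) (Fin 3) ℝ :=
  Matrix.of fun j k => h.inner (p x) (E j (p x)) (mfderiv (𝓡 3) (𝓡 3) p x (E k x))

/-- A parity transformation of `(S³, h)`: an orientation reversing, involutive isometry with
exactly two fixed points. The orientation is the one defined by the global frame `E`. -/
structure IsParity (h : S3Metric) (E : Fin 3 → VField) (p : S3 → S3) : Prop where
  smooth : ContMDiff (𝓡 3) (𝓡 3) ∞ p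
  involutive : Function.Involutive p
  isometry : ∀ (x : S3) (v w : TangentSpace (𝓡 3) x),
    h.inner (p x) (mfderiv (𝓡 3) (𝓡 3) p x v) (mfderiv (𝓡 3) (𝓡 3) p x w) = h.inner x v w
  orientation_reversing : ∀ x, (frameMatrix h E p x).det < 0
  two_fixed_points : {x | p x = x}.ncard = 2

/-! ### Gauge group, gauge potentials and gauge transformations -/

instance : ENat.LEInfty (minSmoothness ℝ 3) := by
  rw [minSmoothness_of_isRCLikeNormedField]; infer_instance

section Gauge

variable {n : ℕ} (G : Type*) [TopologicalSpace G] [ChartedSpace (EuclideanSpace ℝ (Fin n)) G]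
  [Group G]

/-- The Lie algebra `LG` of `G`. -/
abbrev LG : Type _ := GroupLieAlgebra (𝓡 n) G

/-- An `LG`-valued one-form on `S³` (no smoothness required). -/
abbrev GaugePotential : Type _ := (x : S3) → TangentSpace (𝓡 3) x →ₗ[ℝ] LG (n := n) G

variable {G}

/-- The adjoint action of `g` on `LG`: the differential at `1` of `a ↦ g a g⁻¹`. -/
def adjointMap (g : G) (X : LG (n := n) G) : LG (n := n) G :=
  mfderiv (M := G) (M' := G) (𝓡 n) (𝓡 n) (fun a => g * a * g⁻¹) 1 X

/-- `V⁻¹ dV` at `x`, evaluated on `v`: the differential at `x` of `y ↦ V(x)⁻¹ V(y)`. -/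
def pureGauge (V : S3 → G) (x : S3) (v : TangentSpace (𝓡 3) x) : LG (n := n) G :=
  mfderiv (M := S3) (M' := G) (𝓡 3) (𝓡 n) (fun y => (V x)⁻¹ * V y) x v

/-- Smoothness of an `LG`-valued one-form: it maps smooth vector fields to smooth functions. -/
def GaugePotential.Smooth (A : GaugePotential (n := n) G) : Prop :=
  ∀ X : VField, X.Smooth →
    ContMDiff (M' := EuclideanSpace ℝ (Fin n)) (𝓡 3) 𝓘(ℝ, EuclideanSpace ℝ (Fin n)) ∞
      (fun x => A x (X x))

/-- A family of gauge potentials which is smooth, jointly in `τ ∈ [-1, 1]` and `x ∈ S³`. -/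
def SmoothFamily (A : ℝ → GaugePotential (n := n) G) : Prop :=
  ∀ X : VField, X.Smooth →
    ContMDiffOn (M := ℝ × S3) (M' := EuclideanSpace ℝ (Fin n))
      (𝓘(ℝ, ℝ).prod (𝓡 3)) 𝓘(ℝ, EuclideanSpace ℝ (Fin n)) ∞
      (fun q => A q.1 q.2 (X q.2)) (Icc (-1) 1 ×ˢ univ)

/-- `B = Ad(V⁻¹) A + V⁻¹ dV` for some smooth `V : S³ → G`. -/
def GaugeEquivalent (A B : GaugePotential (n := n) G) : Prop :=
  ∃ V : S3 → G, ContMDiff (𝓡 3) (𝓡 n) ∞ V ∧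
    ∀ (x : S3) (v : TangentSpace (𝓡 3) x),
      B x v = adjointMap (V x)⁻¹ (A x v) + pureGauge V x v

/-- `A = U⁻¹ dU` for some smooth `U : S³ → G`. -/
def IsPureGauge (A : GaugePotential (n := n) G) : Prop :=
  ∃ U : S3 → G, ContMDiff (𝓡 3) (𝓡 n) ∞ U ∧
    ∀ (x : S3) (v : TangentSpace (𝓡 3) x), A x v = pureGauge U x v

/-- Charge conjugation on `LG`: a Lie algebra automorphism which is `-id` on the Lie algebra of a
maximal torus, that is, on a maximal abelian subalgebra `t` of `LG`. These are precisely the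
Chevalley inversions with respect to the Chevalley-Weyl bases adapted to `t`. -/
def IsChargeConjugation [LieGroup (𝓡 n) ∞ G] (C : LG (n := n) G ≃ₗ⁅ℝ⁆ LG (n := n) G) : Prop :=
  ∃ t : LieSubalgebra ℝ (LG (n := n) G),
    Maximal (fun s : LieSubalgebra ℝ (LG (n := n) G) => IsLieAbelian s) t ∧ ∀ H ∈ t, C H = -H

/-- The CP-transform `C ∘ p^* A` of a gauge potential. -/
def cpTransform [LieGroup (𝓡 n) ∞ G] (C : LG (n := n) G ≃ₗ⁅ℝ⁆ LG (n := n) G) (p : S3 → S3)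
    (A : GaugePotential (n := n) G) : GaugePotential (n := n) G :=
  fun x => (C.toLinearEquiv.toLinearMap ∘ₗ A (p x)) ∘ₗ (mfderiv (𝓡 3) (𝓡 3) p x).toLinearMap

/-- `A` is CP-symmetric: `C ∘ p^* A` agrees with `A` up to a global gauge transformation. -/
def IsCPSymmetric [LieGroup (𝓡 n) ∞ G] (C : LG (n := n) G ≃ₗ⁅ℝ⁆ LG (n := n) G) (p : S3 → S3)
    (A : GaugePotential (n := n) G) : Prop :=
  GaugeEquivalent A (cpTransform C p A)

end Gauge

/-! ### The twisted Dirac operator -/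

/-- Spinors with values in the representation space `V`: the Hilbert space `ℂ² ⊗ V`. -/
abbrev Spinor (V : Type*) : Type _ := PiLp 2 (fun _ : Fin 2 => V)

/-- Spinor fields on `S³`, in the trivialization of the spinor bundle given by a frame. -/
abbrev SpinorField (V : Type*) : Type _ := S3 → Spinor V

/-- The Clifford matrices `γ k = -i σ k`, with `σ k` the Pauli matrices; they satisfy
`γ i γ j + γ j γ i = -2 δ i j`. -/
def cliffordGamma : Fin 3 → Matrix (Fin 2) (Fin 2) ℂ :=
  ![(-Complex.I) • !![0, 1; 1, 0],
    (-Complex.I) • !![0, -Complex.I; Complex.I, 0],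
    (-Complex.I) • !![1, 0; 0, -1]]

section Dirac

variable {n : ℕ} {G : Type*} [TopologicalSpace G] [ChartedSpace (EuclideanSpace ℝ (Fin n)) G]
  [Group G] {V : Type*} [NormedAddCommGroup V] [InnerProductSpace ℂ V]

/-- A matrix acting on the first factor of `ℂ² ⊗ V`. -/
def spinMul (M : Matrix (Fin 2) (Fin 2) ℂ) (s : Spinor V) : Spinor V :=
  WithLp.toLp 2 fun a => ∑ b, M a b • s b

/-- The unitary representation `ρ` is smooth. -/
def SmoothRep (ρ : G →* (V ≃ₗᵢ[ℂ] V)) : Prop :=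
  ContMDiff (𝓡 n) 𝓘(ℝ, V →L[ℂ] V) ∞ (fun g => ((ρ g).toContinuousLinearEquiv : V →L[ℂ] V))

/-- The derived representation `Lρ` of `LG` on `V`. -/
def derivedRep (ρ : G →* (V ≃ₗᵢ[ℂ] V)) (X : LG (n := n) G) : V →L[ℂ] V :=
  mfderiv (𝓡 n) 𝓘(ℝ, V →L[ℂ] V)
    (fun g => ((ρ g).toContinuousLinearEquiv : V →L[ℂ] V)) 1 X

/-- A smooth spinor field. -/
def SpinorField.Smooth (ψ : SpinorField V) : Prop :=
  ContMDiff (𝓡 3) 𝓘(ℝ, Spinor V) ∞ ψ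

/-- The covariant derivative in the direction `E k` on spinor fields twisted by `A`:
`∇ k ψ = E k ψ + (1/4) ∑ i j, ω k i j γ i γ j ψ + Lρ(A(E k)) ψ`. -/
def twistedCovDeriv (h : S3Metric) (E : Fin 3 → VField) (ρ : G →* (V ≃ₗᵢ[ℂ] V))
    (A : GaugePotential (n := n) G) (k : Fin 3) (ψ : SpinorField V) : SpinorField V := fun x =>
  (show Spinor V from mfderiv (𝓡 3) 𝓘(ℝ, Spinor V) ψ x (E k x))
    + (1 / 4 : ℝ) • ∑ i, ∑ j, leviCivitaCoeff h E k i j x •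
        spinMul (cliffordGamma i * cliffordGamma j) (ψ x)
    + WithLp.toLp 2 fun a => derivedRep ρ (A x (E k x)) (ψ x a)

/-- The Dirac operator `∑ k, γ k ∇ k` of `(S³, h)` twisted by the gauge potential `A`. -/
def diracOp (h : S3Metric) (E : Fin 3 → VField) (ρ : G →* (V ≃ₗᵢ[ℂ] V))
    (A : GaugePotential (n := n) G) (ψ : SpinorField V) : SpinorField V := fun x =>
  ∑ k, spinMul (cliffordGamma k) (twistedCovDeriv h E ρ A k ψ x)

/-- Two operators `D`, `D'` on smooth spinor fields are conjugate by an antiunitary transformation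
`U` covering `p`: `U` is an antilinear bijection which preserves smooth spinor fields in both
directions, satisfies `|U ψ|(x) = |ψ|(p x)` (so that it preserves the `L²` norm if `p` is an
isometry), and `U D = D' U`. -/
def AntiunitarilyConjugate (p : S3 → S3) (D D' : SpinorField V → SpinorField V) : Prop :=
  ∃ U : SpinorField V ≃ₛₗ[starRingEnd ℂ] SpinorField V,
    (∀ ψ : SpinorField V, (U ψ).Smooth ↔ ψ.Smooth) ∧
    (∀ (ψ : SpinorField V) (x : S3), ‖U ψ x‖ = ‖ψ (p x)‖) ∧
    ∀ ψ : SpinorField V, ψ.Smooth → U (D ψ) = D' (U ψ)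

/-- The one-parameter family `𝒜 τ`, `τ ∈ [-1, 1]`, is smooth, passes through `A` at `τ = 0`,
connects two pure gauges, and the family of its Dirac operators is reflection antisymmetric:
`D(𝒜 τ)` is conjugate to `-D(𝒜 (-τ))`, by an antiunitary transformation covering `p`. -/
structure IsReflectionAntisymmetricFamily (h : S3Metric) (E : Fin 3 → VField)
    (ρ : G →* (V ≃ₗᵢ[ℂ] V)) (p : S3 → S3) (A : GaugePotential (n := n) G)
    (𝒜 : ℝ → GaugePotential (n := n) G) : Prop where
  smooth : SmoothFamily 𝒜
  embeds : 𝒜 0 = A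
  pureGauge_left : IsPureGauge (𝒜 (-1))
  pureGauge_right : IsPureGauge (𝒜 1)
  antisymmetric : ∀ τ ∈ Icc (-1 : ℝ) 1,
    AntiunitarilyConjugate p (diracOp h E ρ (𝒜 τ)) (fun ψ => -diracOp h E ρ (𝒜 (-τ)) ψ)

end Dirac

end

/-!
# Reflection antisymmetric families through CP-symmetric gauge potentials

Let `A^CP = Ad(W⁻¹) A + W⁻¹ dW`. The family scales `A` down to `0` as `τ` runs from `0` to `1`, and
it is continued to negative `τ` by `𝒜 (-τ) = Ad(W) (𝒜 τ)^CP + W d(W⁻¹)`. As the gauge transformation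
`W⁻¹` undoes the CP-transformation of `A` itself, this continuation is the interpolation
`a A + (1 - a) W d(W⁻¹)`, which is smooth at `τ = 0` since the cutoff function `a` is constant there
(`pureGaugeFamily`, `gaugeEquivalent_pureGaugeFamily`). Dirac operators of gauge equivalent
potentials are conjugate (`diracOp_gauge`), so everything reduces to an antiunitary operator
covering `p` which conjugates the Dirac operator of any potential `B` to minus that of `B^CP`
(`diracOp_cpTransform`). It is `(U ψ)(x) = q(x) (J ⊗ K) ψ(p x)`, with the following ingredients.

* `K` is an antiunitary operator on `V` with `K Lρ(X) = Lρ(C X) K`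
  (`exists_antiunitary_of_chevalley`); that is, the representation `Lρ ∘ C` is the complex conjugate
  of `Lρ`. Skew-adjoint families of operators are unitarily equivalent as soon as the traces of all
  words agree (`exists_unitary_of_trace_eq`). Words in a Lie algebra of operators are linear
  combinations of powers (`list_prod_mem_powerSpan`), so that it suffices to compare the traces of
  powers of `Lρ(C X)` and of `-Lρ(X)`. These agree on the maximal abelian subalgebra on which `C` is
  `-id`, and a compactness argument moves every element there: among the elements with the same
  trace invariants, the one closest to a regular element `H` commutes with `H`
  (`opTrace_pow_eq_of_centralizer`).
* `J` is the quaternionic structure of `ℂ²`, which commutes with the action of the quaternions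
  generated by the Clifford matrices (`spinConj_quatAct`).
* `q` is a smooth field of unit quaternions lifting minus the differential of `p`, a rotation in the
  frame `E` because `p` reverses the orientation (`exists_spin_lift`). Locally `q` is obtained by
  averaging over the quaternion group, which determines it up to sign; the signs are chosen
  continuously on the complement of each of two points; these sets are simply connected and have a
  connected intersection (`exists_continuous_sign_lift_sphere`). The spin connection is respected because the
  Koszul coefficients transform under an isometry as a connection (`leviCivitaCoeff_eq`).
-/

/-! ### Words and powers in a Lie algebra of operators -/

theorem Submodule.hasDerivAt_mem {A : Type*} [NormedAddCommGroup A] [NormedSpace ℝ A]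
    [FiniteDimensional ℝ A] (S : Submodule ℝ A) {f : ℝ → A} {f' : A} {t : ℝ}
    (hf : HasDerivAt f f' t) (hS : ∀ s, f s ∈ S) : f' ∈ S := by
  have h := hasDerivAt_iff_tendsto_slope_zero.1 hf
  refine S.closed_of_finiteDimensional.mem_of_tendsto h (Filter.Eventually.of_forall fun s => ?_)
  exact S.smul_mem _ (S.sub_mem (hS _) (hS _))

section Powers

variable {A : Type*} [NormedRing A] [NormedAlgebra ℝ A] [FiniteDimensional ℝ A]

/-- The span of all powers of elements of a subspace `𝔤`. -/
noncomputable def powerSpan (𝔤 : Submodule ℝ A) : Submodule ℝ A :=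
  Submodule.span ℝ {a | ∃ x ∈ 𝔤, ∃ k : ℕ, a = x ^ k}

omit [FiniteDimensional ℝ A] in
theorem pow_mem_powerSpan {𝔤 : Submodule ℝ A} {x : A} (hx : x ∈ 𝔤) (k : ℕ) :
    x ^ k ∈ powerSpan 𝔤 := Submodule.subset_span ⟨x, hx, k, rfl⟩

theorem sum_pow_mul_mul_pow_mem_powerSpan {𝔤 : Submodule ℝ A} {x z : A} (hx : x ∈ 𝔤)
    (hz : z ∈ 𝔤) (k : ℕ) :
    ∑ i ∈ Finset.range (k + 1), x ^ (k - i) * z * x ^ i ∈ powerSpan 𝔤 := by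
  have h1 : HasDerivAt (fun t : ℝ => x + t • z) z 0 := by
    simpa using ((hasDerivAt_id (0 : ℝ)).smul_const z).const_add x
  have h2 := h1.fun_pow' (k + 1)
  simp only [zero_smul, add_zero, Nat.pred_eq_sub_one, Nat.add_sub_cancel] at h2
  exact Submodule.hasDerivAt_mem _ h2
    fun t => pow_mem_powerSpan (𝔤.add_mem hx (𝔤.smul_mem t hz)) _

/-- The word `x ^ a * z * x ^ b` lies in the span of the powers: all words with `a + b = k` agree
modulo commutators, which are words of smaller length, and their sum is the derivative of
`(x + t z) ^ (k + 1)` at `t = 0`. -/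
theorem pow_mul_mul_pow_mem_powerSpan {𝔤 : Submodule ℝ A}
    (h𝔤 : ∀ x ∈ 𝔤, ∀ y ∈ 𝔤, x * y - y * x ∈ 𝔤) (k : ℕ) :
    ∀ x ∈ 𝔤, ∀ z ∈ 𝔤, ∀ a b : ℕ, a + b = k → x ^ a * z * x ^ b ∈ powerSpan 𝔤 := by
  induction k with
  | zero =>
    intro x hx z hz a b hab
    obtain ⟨rfl, rfl⟩ : a = 0 ∧ b = 0 := by omega
    simpa using pow_mem_powerSpan hz 1
  | succ k ih =>
    intro x hx z hz
    have step : ∀ i, i ≤ k + 1 →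
        x ^ (k + 1 - i) * z * x ^ i - x ^ (k + 1) * z ∈ powerSpan 𝔤 := by
      intro i
      induction i with
      | zero => intro _; simp
      | succ i ihi =>
        intro hi
        have h1 := ihi (by omega)
        have h2 := ih x hx _ (h𝔤 x hx z hz) (k - i) i (by omega)
        have e1 : k + 1 - i = k - i + 1 := by omega
        have e2 : k + 1 - (i + 1) = k - i := by omega
        rw [e1] at h1
        rw [e2]
        have := (powerSpan 𝔤).sub_mem h1 h2
        convert this using 1
        rw [pow_succ x (k - i), pow_succ' x i]
        noncomm_ring
    have hsum := sum_pow_mul_mul_pow_mem_powerSpan hx hz (k + 1)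
    have h3 : ∑ i ∈ Finset.range (k + 1 + 1), (x ^ (k + 1 - i) * z * x ^ i - x ^ (k + 1) * z)
        ∈ powerSpan 𝔤 :=
      Submodule.sum_mem _ fun i hi => step i (by have := Finset.mem_range.1 hi; omega)
    rw [Finset.sum_sub_distrib, Finset.sum_const, Finset.card_range] at h3
    have h4 := (powerSpan 𝔤).sub_mem hsum h3
    rw [sub_sub_cancel, ← Nat.cast_smul_eq_nsmul ℝ] at h4
    have h5 : x ^ (k + 1) * z ∈ powerSpan 𝔤 :=
      ((powerSpan 𝔤).smul_mem_iff (by positivity)).1 h4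
    intro a b hab
    have h6 := (powerSpan 𝔤).add_mem (step b (by omega)) h5
    have e : k + 1 - b = a := by omega
    simpa [e] using h6

/-- The symmetrization half of the Poincaré-Birkhoff-Witt theorem: every word in a Lie algebra of
operators is a linear combination of powers. -/
theorem list_prod_mem_powerSpan {𝔤 : Submodule ℝ A}
    (h𝔤 : ∀ x ∈ 𝔤, ∀ y ∈ 𝔤, x * y - y * x ∈ 𝔤) (l : List A) (hl : ∀ x ∈ l, x ∈ 𝔤) :
    l.prod ∈ powerSpan 𝔤 := by
  induction l with
  | nil => simpa using pow_mem_powerSpan 𝔤.zero_mem 0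
  | cons y l ih =>
    rw [List.prod_cons]
    have h1 : l.prod ∈ powerSpan 𝔤 := ih fun x hx => hl x (List.mem_cons_of_mem _ hx)
    have hy := hl y List.mem_cons_self
    have : powerSpan 𝔤 ≤ (powerSpan 𝔤).comap (LinearMap.mulLeft ℝ y) := by
      refine Submodule.span_le.2 ?_
      rintro _ ⟨x, hx, k, rfl⟩
      simpa using pow_mul_mul_pow_mem_powerSpan h𝔤 k x hx y hy 0 k (by omega)
    exact this h1

end Powers

/-! ### Intertwiners from traces of words -/

section Intertwiner

open ContinuousLinearMap

variable {V V' : Type*} [NormedAddCommGroup V] [InnerProductSpace ℂ V] [FiniteDimensional ℂ V]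
  [NormedAddCommGroup V'] [InnerProductSpace ℂ V'] [FiniteDimensional ℂ V']

theorem Submodule.starProjection_comm_of_skew (K : Submodule ℂ V) {D : V → V}
    (hD : ∀ x y, inner ℂ (D x) y = -inner ℂ x (D y)) (hsub : ∀ x y, D (x - y) = D x - D y)
    (hK : ∀ x ∈ K, D x ∈ K) (x : V) :
    K.starProjection (D x) = D (K.starProjection x) := by
  refine Submodule.eq_starProjection_of_mem_orthogonal
    (hK _ (Submodule.starProjection_apply_mem K x)) ?_
  rw [← hsub]
  intro u hu
  have h1 := Submodule.sub_starProjection_mem_orthogonal (K := K) x (D u) (hK u hu)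
  rw [hD] at h1
  simpa using h1

/-- The module `Vⁿ × V'ⁿ'`, `n = dim V`, `n' = dim V'`, in which pairs of operators on `V` and `V'`
are recorded by their values on orthonormal bases. -/
abbrev WordModule (V V' : Type*) [NormedAddCommGroup V] [InnerProductSpace ℂ V]
    [NormedAddCommGroup V'] [InnerProductSpace ℂ V'] : Type _ :=
  WithLp 2 ((PiLp 2 fun _ : Fin (Module.finrank ℂ V) => V) ×
    (PiLp 2 fun _ : Fin (Module.finrank ℂ V') => V'))

/-- If the traces of all words agree on the ranges of two projections `Q`, `Q'`, and the range of
`Q` is nonzero, then there is an intertwiner which does not vanish between these ranges.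
The words span a left module inside `V ^ κ × V' ^ κ'`, for orthonormal bases indexed by `κ` and
`κ'`. The orthogonal projection onto this span is a module map, it takes the same nonzero value at
`Q` and at `Q'`, and its matrix entries are intertwiners. -/
theorem exists_intertwiner_of_trace_eq {ι : Type*} (a : ι → V →L[ℂ] V) (a' : ι → V' →L[ℂ] V')
    (ha : ∀ i x y, inner ℂ (a i x) y = -inner ℂ x (a i y))
    (ha' : ∀ i x y, inner ℂ (a' i x) y = -inner ℂ x (a' i y))
    (Q : V →L[ℂ] V) (Q' : V' →L[ℂ] V')
    (hQ : ∀ x y, inner ℂ (Q x) y = inner ℂ x (Q y)) (hQQ : ∀ x, Q (Q x) = Q x)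
    (hQ' : ∀ x y, inner ℂ (Q' x) y = inner ℂ x (Q' y)) (hQ0 : Q ≠ 0)
    (htr : ∀ l : List ι, LinearMap.trace ℂ V ((Q * (l.map a).prod : V →L[ℂ] V) : V →ₗ[ℂ] V) =
      LinearMap.trace ℂ V' ((Q' * (l.map a').prod : V' →L[ℂ] V') : V' →ₗ[ℂ] V')) :
    ∃ S : V →L[ℂ] V', (∀ i x, S (a i x) = a' i (S x)) ∧ ∃ x, Q' (S (Q x)) ≠ 0 := by
  let b := stdOrthonormalBasis ℂ V
  let b' := stdOrthonormalBasis ℂ V'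
  let vec : (V →L[ℂ] V) → (V' →L[ℂ] V') → WordModule V V' := fun w w' =>
    WithLp.toLp 2 (WithLp.toLp 2 fun i => w (b i), WithLp.toLp 2 fun j => w' (b' j))
  let 𝒜 : Submodule ℂ (WordModule V V') :=
    Submodule.span ℂ (range fun l : List ι => vec (l.map a).prod (l.map a').prod)
  let D : ι → WordModule V V' →ₗ[ℂ] WordModule V V' := fun i =>
    { toFun := fun m => WithLp.toLp 2 (WithLp.toLp 2 fun k => a i (m.fst k),
        WithLp.toLp 2 fun k => a' i (m.snd k))
      map_add' := fun m m' => by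
        apply WithLp.ofLp_injective; ext k <;> simp
      map_smul' := fun c m => by
        apply WithLp.ofLp_injective; ext k <;> simp }
  have hD : ∀ i x y, inner ℂ (D i x) y = -inner ℂ x (D i y) := by
    intro i x y
    simp [D, WithLp.prod_inner_apply, PiLp.inner_apply, ha, ha', Finset.sum_neg_distrib]
    ring
  have hD𝒜 : ∀ i, ∀ x ∈ 𝒜, D i x ∈ 𝒜 := by
    intro i
    have : 𝒜 ≤ 𝒜.comap (D i) := by
      refine Submodule.span_le.2 ?_
      rintro _ ⟨l, rfl⟩
      refine Submodule.subset_span ⟨i :: l, ?_⟩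
      simp [vec, D]
    exact this
  let E : WordModule V V' →L[ℂ] WordModule V V' := 𝒜.starProjection
  have hE : ∀ i x, E (D i x) = D i (E x) := fun i x =>
    Submodule.starProjection_comm_of_skew 𝒜 (hD i) (map_sub (D i)) (hD𝒜 i) x
  -- both projections define the same functional on the words
  have hEq : E (vec Q 0) = E (vec 0 Q') := by
    refine (Submodule.eq_starProjection_of_mem_orthogonal
      (Submodule.starProjection_apply_mem 𝒜 _) ?_).symm
    have h1 : vec 0 Q' - vec Q 0 ∈ 𝒜ᗮ := by
      rw [Submodule.mem_orthogonal']
      intro u hu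
      induction hu using Submodule.span_induction with
      | mem u hu =>
        obtain ⟨l, rfl⟩ := hu
        have := htr l
        rw [LinearMap.trace_eq_sum_inner _ b, LinearMap.trace_eq_sum_inner _ b'] at this
        rw [inner_sub_left]
        simp [vec, WithLp.prod_inner_apply, PiLp.inner_apply, hQ, hQ']
        simpa [sub_eq_zero] using this.symm
      | zero => simp
      | add x y _ _ hx hy => rw [inner_add_right, hx, hy, add_zero]
      | smul c x _ hx => rw [inner_smul_right, hx, mul_zero]
    have h2 := Submodule.sub_starProjection_mem_orthogonal (K := 𝒜) (vec Q 0)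
    have := 𝒜ᗮ.add_mem h1 h2
    simpa using this
  have h1mem : vec 1 1 ∈ 𝒜 := Submodule.subset_span ⟨[], by simp⟩
  have hne : E (vec Q 0) ≠ 0 := by
    intro h0
    have h1 : inner ℂ (vec 1 1) (E (vec Q 0)) = inner ℂ (vec 1 1) (vec Q 0) := by
      rw [← Submodule.inner_starProjection_left_eq_right,
        (Submodule.starProjection_eq_self_iff).2 h1mem]
    rw [h0, inner_zero_right] at h1
    have h2 : ∑ i, inner ℂ (b i) (Q (b i)) = 0 := by
      simpa [vec, WithLp.prod_inner_apply, PiLp.inner_apply] using h1.symm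
    have h3 : ∀ i, inner ℂ (b i) (Q (b i)) = ((‖Q (b i)‖ ^ 2 : ℝ) : ℂ) := by
      intro i
      rw [← hQQ (b i), ← hQ, inner_self_eq_norm_sq_to_K, hQQ]
      simp
    simp only [h3, ← Complex.ofReal_sum, Complex.ofReal_eq_zero] at h2
    rw [Finset.sum_eq_zero_iff_of_nonneg (fun _ _ => by positivity)] at h2
    apply hQ0
    ext x
    have : (Q : V →ₗ[ℂ] V) = 0 := by
      refine b.toBasis.ext fun i => ?_
      have := h2 i (Finset.mem_univ i)
      simpa using this
    exact congrArg (fun f => f x) this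
  -- the matrix entries of the projection
  let inc : Fin (Module.finrank ℂ V) → V →L[ℂ] WordModule V V' := fun i =>
    LinearMap.toContinuousLinearMap
    { toFun := fun v => WithLp.toLp 2 (WithLp.toLp 2 (Pi.single i v), 0)
      map_add' := fun v w => by
        apply WithLp.ofLp_injective; ext k
        · simp [Pi.single_add]
          simp [Pi.single_apply]
        · simp
      map_smul' := fun c v => by
        apply WithLp.ofLp_injective; ext k <;> simp [Pi.single_apply] }
  let pr : Fin (Module.finrank ℂ V') → WordModule V V' →L[ℂ] V' := fun j =>
    LinearMap.toContinuousLinearMap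
    { toFun := fun m => m.snd j
      map_add' := fun _ _ => by simp
      map_smul' := fun _ _ => by simp }
  let S : Fin (Module.finrank ℂ V) → Fin (Module.finrank ℂ V') → V →L[ℂ] V' := fun i j =>
    pr j ∘L E ∘L inc i
  have hS : ∀ i j k x, S i j (a k x) = a' k (S i j x) := by
    intro i j k x
    have h1 : inc i (a k x) = D k (inc i x) := by
      apply WithLp.ofLp_injective
      ext m
      · simp only [inc, D, LinearMap.coe_toContinuousLinearMap', LinearMap.coe_mk, AddHom.coe_mk]
        by_cases h : m = i
        · subst h; simp
        · simp [h]
      · simp [inc, D]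
    simp only [S, ContinuousLinearMap.comp_apply, h1, hE]
    rfl
  by_contra hcon
  push Not at hcon
  have hz : ∀ i j x, Q' (S i j (Q x)) = 0 := fun i j x => hcon (S i j) (hS i j) x
  apply hne
  rw [← norm_eq_zero, ← sq_eq_zero_iff, ← Complex.ofReal_eq_zero]
  have h1 : ((‖E (vec Q 0)‖ ^ 2 : ℝ) : ℂ) = inner ℂ (vec 0 Q') (E (vec Q 0)) := by
    have h2 : E (E (vec Q 0)) = E (vec Q 0) :=
      (Submodule.starProjection_eq_self_iff).2 (Submodule.starProjection_apply_mem 𝒜 _)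
    have h3 : inner ℂ (vec 0 Q') (E (vec Q 0)) = inner ℂ (E (vec 0 Q')) (E (vec Q 0)) := by
      conv_lhs => rw [← h2]
      exact (Submodule.inner_starProjection_left_eq_right 𝒜 _ _).symm
    rw [h3, ← hEq, inner_self_eq_norm_sq_to_K]
    simp
  rw [h1]
  have h4 : vec Q 0 = ∑ i, inc i (Q (b i)) := by
    apply WithLp.ofLp_injective
    ext m
    · simp [inc, vec, Prod.fst_sum, Pi.single_apply]
    · simp [inc, vec, Prod.snd_sum]
  have h5 : inner ℂ (vec 0 Q') (E (vec Q 0)) =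
      ∑ j, inner ℂ (Q' (b' j)) (pr j (E (vec Q 0))) := by
    rw [WithLp.prod_inner_apply, PiLp.inner_apply, PiLp.inner_apply]
    simp only [vec, zero_apply, inner_zero_left, Finset.sum_const_zero,
      zero_add]
    rfl
  rw [h5]
  refine Finset.sum_eq_zero fun j _ => ?_
  rw [h4, map_sum, map_sum, inner_sum]
  refine Finset.sum_eq_zero fun i _ => ?_
  rw [hQ']
  have : pr j (E (inc i (Q (b i)))) = S i j (Q (b i)) := rfl
  rw [this, hz, inner_zero_right]

end Intertwiner

/-! ### Unitary equivalence of skew-adjoint families -/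

section UnitaryIntertwiner

open ContinuousLinearMap

variable {V V' : Type*} [NormedAddCommGroup V] [InnerProductSpace ℂ V] [FiniteDimensional ℂ V]
  [NormedAddCommGroup V'] [InnerProductSpace ℂ V'] [FiniteDimensional ℂ V']

theorem adjoint_comm_of_skew {ι : Type*} {a : ι → V →L[ℂ] V} {a' : ι → V' →L[ℂ] V'}
    (ha : ∀ i x y, inner ℂ (a i x) y = -inner ℂ x (a i y))
    (ha' : ∀ i x y, inner ℂ (a' i x) y = -inner ℂ x (a' i y))
    {S : V →L[ℂ] V'} (hS : ∀ i x, S (a i x) = a' i (S x)) (i : ι) (y : V') :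
    adjoint S (a' i y) = a i (adjoint S y) := by
  refine ext_inner_right ℂ fun v => ?_
  rw [adjoint_inner_left, ha', ha, adjoint_inner_left, hS]

/-- A self-adjoint positive operator `S† S ≠ 0` has a nonzero eigenvalue. -/
theorem exists_adjoint_comp_self_eigenvector {S : V →L[ℂ] V'} (hS : S ≠ 0) :
    ∃ (μ : ℝ) (v : V), 0 < μ ∧ v ≠ 0 ∧ adjoint S (S v) = (μ : ℂ) • v := by
  have hsym : ((adjoint S ∘L S : V →L[ℂ] V) : V →ₗ[ℂ] V).IsSymmetric := by
    intro x y
    simp [adjoint_inner_left, adjoint_inner_right]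
  by_contra hcon
  push Not at hcon
  apply hS
  ext v
  have hb : ∀ i, S (hsym.eigenvectorBasis rfl i) = 0 := by
    intro i
    set w := hsym.eigenvectorBasis rfl i with hw
    set μ := hsym.eigenvalues rfl i with hμ
    have h1 : adjoint S (S w) = (μ : ℂ) • w := by
      exact hsym.apply_eigenvectorBasis rfl i
    have hw0 : w ≠ 0 := (hsym.eigenvectorBasis rfl).orthonormal.ne_zero i
    have h2 : (inner ℂ (S w) (S w) : ℂ) = μ * inner ℂ w w := by
      rw [← adjoint_inner_right, h1, inner_smul_right]
    rw [inner_self_eq_norm_sq_to_K, inner_self_eq_norm_sq_to_K] at h2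
    have h3 : ‖S w‖ ^ 2 = μ * ‖w‖ ^ 2 := Complex.ofReal_injective (by simpa using h2)
    by_cases hp : 0 < μ
    · exact absurd h1 (hcon μ w hp hw0)
    · have : ‖S w‖ ^ 2 ≤ 0 := by
        rw [h3]; exact mul_nonpos_of_nonpos_of_nonneg (not_lt.1 hp) (by positivity)
      have : ‖S w‖ = 0 := by nlinarith [norm_nonneg (S w)]
      exact norm_eq_zero.1 this
  have : (S : V →ₗ[ℂ] V') = 0 := (hsym.eigenvectorBasis rfl).toBasis.ext fun i => by
    simpa using hb i
  exact congrArg (fun f => f v) this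

/-- An intertwining partial isometry extends to a larger one as long as it is not injective. -/
theorem exists_larger_partialIsometry {ι : Type*} (a : ι → V →L[ℂ] V) (a' : ι → V' →L[ℂ] V')
    (ha : ∀ i x y, inner ℂ (a i x) y = -inner ℂ x (a i y))
    (ha' : ∀ i x y, inner ℂ (a' i x) y = -inner ℂ x (a' i y))
    (htr : ∀ l : List ι, LinearMap.trace ℂ V (((l.map a).prod : V →L[ℂ] V) : V →ₗ[ℂ] V) =
      LinearMap.trace ℂ V' (((l.map a').prod : V' →L[ℂ] V') : V' →ₗ[ℂ] V'))
    (T : V →L[ℂ] V') (hT : ∀ i x, T (a i x) = a' i (T x))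
    (hTT : ∀ x, T (adjoint T (T x)) = T x) (hker : LinearMap.ker T.toLinearMap ≠ ⊥) :
    ∃ T' : V →L[ℂ] V', (∀ i x, T' (a i x) = a' i (T' x)) ∧
      (∀ x, T' (adjoint T' (T' x)) = T' x) ∧
      Module.finrank ℂ (LinearMap.ker T'.toLinearMap)
        < Module.finrank ℂ (LinearMap.ker T.toLinearMap) := by
  have hTadj := adjoint_comm_of_skew ha ha' hT
  have hTTa : ∀ y, adjoint T (T (adjoint T y)) = adjoint T y := fun y =>
    ext_inner_right ℂ fun v => by
      rw [adjoint_inner_left, ← adjoint_inner_right, adjoint_inner_left, hTT, adjoint_inner_left]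
  -- the projections onto the kernels of `T` and of its adjoint
  set Q : V →L[ℂ] V := 1 - adjoint T ∘L T with hQdef
  set Q' : V' →L[ℂ] V' := 1 - T ∘L adjoint T with hQ'def
  have hQa : ∀ x, Q x = x - adjoint T (T x) := fun x => rfl
  have hQ'a : ∀ x, Q' x = x - T (adjoint T x) := fun x => rfl
  have hTQ : ∀ x, T (Q x) = 0 := fun x => by rw [hQa, map_sub, hTT, sub_self]
  have hTQ' : ∀ x, adjoint T (Q' x) = 0 := fun x => by rw [hQ'a, map_sub, hTTa, sub_self]
  have hQsym : ∀ x y, inner ℂ (Q x) y = inner ℂ x (Q y) := fun x y => by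
    simp [hQa, adjoint_inner_left, adjoint_inner_right]
  have hQ'sym : ∀ x y, inner ℂ (Q' x) y = inner ℂ x (Q' y) := fun x y => by
    simp only [hQ'a, inner_sub_left, inner_sub_right]
    rw [← adjoint_inner_right, adjoint_inner_left]
  have hQQ : ∀ x, Q (Q x) = Q x := fun x => by rw [hQa (Q x), hTQ, map_zero, sub_zero]
  have hQcomm : ∀ i x, Q (a i x) = a i (Q x) := fun i x => by
    rw [hQa, hQa, hT, hTadj, map_sub]
  have hQ'comm : ∀ i x, Q' (a' i x) = a' i (Q' x) := fun i x => by
    rw [hQ'a, hQ'a, hTadj, hT, map_sub]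
  have hQ0 : Q ≠ 0 := by
    intro h0
    apply hker
    rw [LinearMap.ker_eq_bot']
    intro v hv
    have : Q v = 0 := by rw [h0]; rfl
    rw [hQa] at this
    have hv' : T v = 0 := hv
    simpa [hv'] using this
  have hword : ∀ l : List ι, ∀ x, T ((l.map a).prod x) = (l.map a').prod (T x) := by
    intro l
    induction l with
    | nil => intro x; simp
    | cons i l ih => intro x; simp [hT, ih]
  have htrQ : ∀ l : List ι,
      LinearMap.trace ℂ V ((Q * (l.map a).prod : V →L[ℂ] V) : V →ₗ[ℂ] V) =
      LinearMap.trace ℂ V' ((Q' * (l.map a').prod : V' →L[ℂ] V') : V' →ₗ[ℂ] V') := by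
    intro l
    have e1 : ((Q * (l.map a).prod : V →L[ℂ] V) : V →ₗ[ℂ] V) =
        ((l.map a).prod : V →L[ℂ] V) -
        ((adjoint T : V' →L[ℂ] V) : V' →ₗ[ℂ] V) ∘ₗ
          (((l.map a').prod : V' →L[ℂ] V') ∘ₗ (T : V →ₗ[ℂ] V')) := by
      ext x
      simp [hQa, hword]
    have e2 : ((Q' * (l.map a').prod : V' →L[ℂ] V') : V' →ₗ[ℂ] V') =
        ((l.map a').prod : V' →L[ℂ] V') -
        (T : V →ₗ[ℂ] V') ∘ₗ (((adjoint T : V' →L[ℂ] V) : V' →ₗ[ℂ] V) ∘ₗ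
          (((l.map a').prod : V' →L[ℂ] V') : V' →ₗ[ℂ] V')) := by
      ext x
      simp [hQ'a]
    rw [e1, e2, map_sub, map_sub, htr, ← LinearMap.comp_assoc, LinearMap.trace_comp_comm']
  obtain ⟨S₀, hS₀, x₀, hx₀⟩ := exists_intertwiner_of_trace_eq a a' ha ha' Q Q' hQsym hQQ hQ'sym
    hQ0 htrQ
  set S : V →L[ℂ] V' := Q' ∘L S₀ ∘L Q with hSdef
  have hSa : ∀ x, S x = Q' (S₀ (Q x)) := fun x => rfl
  have hS : ∀ i x, S (a i x) = a' i (S x) := fun i x => by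
    rw [hSa, hSa, hQcomm, hS₀, hQ'comm]
  have hSadj := adjoint_comm_of_skew ha ha' hS
  have hS0 : S ≠ 0 := fun h => hx₀ (by rw [← hSa, h]; rfl)
  obtain ⟨μ, v, hμ, hv, hSv⟩ := exists_adjoint_comp_self_eigenvector hS0
  -- rescaling `S` on an eigenspace of `S† S` yields a partial isometry
  set K : Submodule ℂ V := LinearMap.ker
    ((adjoint S ∘L S - (μ : ℂ) • (1 : V →L[ℂ] V) : V →L[ℂ] V) : V →ₗ[ℂ] V) with hK
  have hKmem : ∀ x, x ∈ K ↔ adjoint S (S x) = (μ : ℂ) • x := fun x => by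
    simp [hK, sub_eq_zero]
  have hKinv : ∀ i, ∀ x ∈ K, a i x ∈ K := fun i x hx => by
    rw [hKmem] at hx ⊢
    rw [hS, hSadj, hx, map_smul]
  set R : V →L[ℂ] V := K.starProjection with hR
  have hRmem : ∀ x, R x ∈ K := Submodule.starProjection_apply_mem K
  have hRcomm : ∀ i x, R (a i x) = a i (R x) := fun i x =>
    Submodule.starProjection_comm_of_skew K (ha i) (map_sub (a i)) (hKinv i) x
  have hRsym : ∀ x y, inner ℂ (R x) y = inner ℂ x (R y) :=
    Submodule.inner_starProjection_left_eq_right K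
  have hRR : ∀ x ∈ K, R x = x := fun x hx => Submodule.starProjection_eq_self_iff.2 hx
  set c : ℂ := (((Real.sqrt μ)⁻¹ : ℝ) : ℂ) with hc
  have hcc : c * (c * μ) = 1 := by
    have : (Real.sqrt μ)⁻¹ * ((Real.sqrt μ)⁻¹ * μ) = 1 := by
      have := Real.mul_self_sqrt hμ.le
      have h2 := (Real.sqrt_pos.2 hμ).ne'
      field_simp
      nlinarith
    rw [hc]
    exact_mod_cast this
  set S' : V →L[ℂ] V' := c • (S ∘L R) with hS'
  have hS'a : ∀ x, S' x = c • S (R x) := fun x => rfl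
  have hS'adj : ∀ y, adjoint S' y = c • R (adjoint S y) := fun y =>
    ext_inner_right ℂ fun w => by
      rw [adjoint_inner_left, hS'a, inner_smul_right, inner_smul_left, hRsym, adjoint_inner_left]
      simp [hc]
  have hSK : ∀ x, adjoint S' (S' x) = R x := fun x => by
    rw [hS'adj, hS'a, map_smul, (hKmem _).1 (hRmem x), map_smul, map_smul, hRR _ (hRmem x),
      smul_smul, smul_smul, mul_assoc, hcc, one_smul]
  have hTS : ∀ x, adjoint T (S' x) = 0 := fun x => by
    rw [hS'a, map_smul, hSa, hTQ', smul_zero]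
  have hSadjQ : ∀ y, Q (adjoint S y) = adjoint S y := fun y =>
    ext_inner_right ℂ fun w => by
      rw [hQsym, adjoint_inner_left, adjoint_inner_left, hSa, hSa, hQQ]
  have hKQ : ∀ x ∈ K, T x = 0 := fun x hx => by
    have h1 := (hKmem x).1 hx
    have h2 : T ((μ : ℂ) • x) = 0 := by rw [← h1, ← hSadjQ, hTQ]
    rw [map_smul] at h2
    exact (smul_eq_zero.1 h2).resolve_left (by exact_mod_cast hμ.ne')
  have hST : ∀ x, adjoint S' (T x) = 0 := fun x =>
    ext_inner_right ℂ fun w => by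
      rw [adjoint_inner_left, ← adjoint_inner_right, hTS, inner_zero_right, inner_zero_left]
  refine ⟨T + S', fun i x => ?_, fun x => ?_, ?_⟩
  · simp only [add_apply, hS'a, hRcomm, hS, hT, map_add, map_smul]
  · have e1 : adjoint (T + S') ((T + S') x) = adjoint T (T x) + R x := by
      simp [map_add, hTS, hST, hSK]
    rw [e1]
    have e2 : R (adjoint T (T x)) = 0 := by
      rw [← hSK]
      have : S' (adjoint T (T x)) = 0 := ext_inner_right ℂ fun w => by
        rw [← adjoint_inner_right, adjoint_inner_left, hS'adj, map_smul,
          hKQ _ (hRmem _)]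
        simp
      rw [this, map_zero]
    simp only [add_apply, map_add, hTT, hKQ _ (hRmem x), hS'a, e2, hRR _ (hRmem x)]
    simp
  · refine Submodule.finrank_lt_finrank_of_lt (lt_of_le_of_ne ?_ ?_)
    · intro x hx
      have hx' : T x + S' x = 0 := hx
      have h1 := congrArg (adjoint T) hx'
      rw [map_add, hTS, add_zero, map_zero] at h1
      have : T x = 0 := by rw [← hTT, h1, map_zero]
      exact this
    · intro heq
      have hvK : v ∈ K := (hKmem v).2 hSv
      have hvT : v ∈ LinearMap.ker T.toLinearMap := hKQ v hvK
      rw [← heq] at hvT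
      have h1 : T v + S' v = 0 := hvT
      rw [hKQ v hvK, zero_add] at h1
      have h2 := hSK v
      rw [h1, map_zero, hRR v hvK] at h2
      exact hv h2.symm

/-- Skew-adjoint families of operators with equal traces of all words are unitarily equivalent. -/
theorem exists_unitary_of_trace_eq {ι : Type*} (a : ι → V →L[ℂ] V) (a' : ι → V' →L[ℂ] V')
    (ha : ∀ i x y, inner ℂ (a i x) y = -inner ℂ x (a i y))
    (ha' : ∀ i x y, inner ℂ (a' i x) y = -inner ℂ x (a' i y))
    (htr : ∀ l : List ι, LinearMap.trace ℂ V (((l.map a).prod : V →L[ℂ] V) : V →ₗ[ℂ] V) =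
      LinearMap.trace ℂ V' (((l.map a').prod : V' →L[ℂ] V') : V' →ₗ[ℂ] V')) :
    ∃ T : V ≃ₗᵢ[ℂ] V', ∀ i x, T (a i x) = a' i (T x) := by
  have key : ∀ d : ℕ, ∀ T : V →L[ℂ] V', (∀ i x, T (a i x) = a' i (T x)) →
      (∀ x, T (adjoint T (T x)) = T x) →
      Module.finrank ℂ (LinearMap.ker T.toLinearMap) ≤ d →
      ∃ T : V →L[ℂ] V', (∀ i x, T (a i x) = a' i (T x)) ∧
        (∀ x, T (adjoint T (T x)) = T x) ∧ LinearMap.ker T.toLinearMap = ⊥ := by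
    intro d
    induction d with
    | zero =>
      intro T h1 h2 h3
      exact ⟨T, h1, h2, Submodule.finrank_eq_zero.1 (Nat.le_zero.1 h3)⟩
    | succ d ih =>
      intro T h1 h2 h3
      by_cases hker : LinearMap.ker T.toLinearMap = ⊥
      · exact ⟨T, h1, h2, hker⟩
      · obtain ⟨T', h1', h2', h3'⟩ := exists_larger_partialIsometry a a' ha ha' htr T h1 h2 hker
        exact ih T' h1' h2' (by omega)
  obtain ⟨T, hT, hTT, hker⟩ := key _ 0 (by simp) (by simp) le_rfl
  have hinj : Function.Injective T := LinearMap.ker_eq_bot.1 hker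
  have hiso : ∀ x, adjoint T (T x) = x := fun x => hinj (hTT x)
  have hdim : Module.finrank ℂ V = Module.finrank ℂ V' := by
    have := htr []
    simpa using this
  let e : V ≃ₗ[ℂ] V' := LinearEquiv.ofInjectiveOfFinrankEq T.toLinearMap hinj hdim
  refine ⟨⟨e, fun x => ?_⟩, fun i x => hT i x⟩
  change ‖T x‖ = ‖x‖
  have h1 : (inner ℂ (T x) (T x) : ℂ) = inner ℂ x x := by
    rw [← adjoint_inner_right, hiso]
  rw [inner_self_eq_norm_sq_to_K, inner_self_eq_norm_sq_to_K] at h1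
  have h2 : ‖T x‖ ^ 2 = ‖x‖ ^ 2 := Complex.ofReal_injective (by simpa using h1)
  exact (sq_eq_sq₀ (norm_nonneg _) (norm_nonneg _)).1 h2

end UnitaryIntertwiner

/-! ### Skew-adjoint operators and their trace invariants -/

noncomputable section OperatorTrace

variable {V : Type*} [NormedAddCommGroup V] [InnerProductSpace ℂ V]

/-- The trace of a continuous operator, as a real linear functional. -/
def opTrace : (V →L[ℂ] V) →ₗ[ℝ] ℂ :=
  ((LinearMap.trace ℂ V) ∘ₗ (ContinuousLinearMap.coeLM ℂ)).restrictScalars ℝ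

theorem opTrace_mul_comm (f g : V →L[ℂ] V) : opTrace (f * g) = opTrace (g * f) :=
  LinearMap.trace_mul_comm ℂ (f : V →ₗ[ℂ] V) (g : V →ₗ[ℂ] V)

theorem opTrace_eq_sum_inner {κ : Type*} [Fintype κ] (b : OrthonormalBasis κ ℂ V)
    (f : V →L[ℂ] V) : opTrace f = ∑ i, inner ℂ (b i) (f (b i)) :=
  LinearMap.trace_eq_sum_inner _ b

/-- Skew-adjointness of an operator. -/
def IsSkew (x : V →L[ℂ] V) : Prop := ∀ v w, inner ℂ (x v) w = -inner ℂ v (x w)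

theorem IsSkew.commutator {x y : V →L[ℂ] V} (hx : IsSkew x) (hy : IsSkew y) :
    IsSkew (x * y - y * x) := fun v w => by
  simp only [sub_apply, mul_apply_eq_comp, inner_sub_left, inner_sub_right]
  rw [hx, hy, hy, hx]
  ring

variable [FiniteDimensional ℂ V]

theorem continuous_opTrace : Continuous (opTrace : (V →L[ℂ] V) →ₗ[ℝ] ℂ) :=
  ((LinearMap.trace ℂ V) ∘ₗ (ContinuousLinearMap.coeLM ℂ)).continuous_of_finiteDimensional

omit [FiniteDimensional ℂ V] in
theorem IsSkew.opTrace_sq {κ : Type*} [Fintype κ] (b : OrthonormalBasis κ ℂ V)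
    {x : V →L[ℂ] V} (hx : IsSkew x) :
    opTrace (x * x) = ((-∑ i, ‖x (b i)‖ ^ 2 : ℝ) : ℂ) := by
  rw [opTrace_eq_sum_inner b]
  push_cast
  rw [← Finset.sum_neg_distrib]
  refine Finset.sum_congr rfl fun i _ => ?_
  have h := hx (b i) (x (b i))
  rw [inner_self_eq_norm_sq_to_K] at h
  change inner ℂ (b i) (x (x (b i))) = _
  rw [← neg_inj, ← h]
  simp

theorem IsSkew.eq_zero_of_opTrace_sq {x : V →L[ℂ] V} (hx : IsSkew x)
    (h : (opTrace (x * x)).re = 0) : x = 0 := by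
  rw [hx.opTrace_sq (stdOrthonormalBasis ℂ V), Complex.ofReal_re, neg_eq_zero,
    Finset.sum_eq_zero_iff_of_nonneg (fun _ _ => by positivity)] at h
  have : (x : V →ₗ[ℂ] V) = 0 := (stdOrthonormalBasis ℂ V).toBasis.ext fun i => by
    simpa using h i (Finset.mem_univ i)
  ext v
  exact congrArg (fun f => f v) this

/-- The trace form controls the norm, so that its level sets are bounded. -/
theorem IsSkew.norm_le {x : V →L[ℂ] V} (hx : IsSkew x) :
    ‖x‖ ≤ Module.finrank ℂ V * Real.sqrt (-(opTrace (x * x)).re) := by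
  set b := stdOrthonormalBasis ℂ V
  rw [hx.opTrace_sq b, Complex.ofReal_re, neg_neg]
  refine x.opNorm_le_bound (by positivity) fun v => ?_
  have h1 : x v = ∑ i, inner ℂ (b i) v • x (b i) := by
    conv_lhs => rw [← b.sum_repr' v]
    simp
  rw [h1]
  calc ‖∑ i, inner ℂ (b i) v • x (b i)‖ ≤ ∑ i, ‖inner ℂ (b i) v • x (b i)‖ := norm_sum_le _ _
    _ ≤ ∑ _i : Fin (Module.finrank ℂ V), ‖v‖ * Real.sqrt (∑ i, ‖x (b i)‖ ^ 2) := by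
        refine Finset.sum_le_sum fun i _ => ?_
        rw [norm_smul]
        gcongr
        · calc ‖inner ℂ (b i) v‖ ≤ ‖b i‖ * ‖v‖ := norm_inner_le_norm _ _
            _ = ‖v‖ := by rw [b.orthonormal.1 i, one_mul]
        · refine Real.le_sqrt_of_sq_le ?_
          exact Finset.single_le_sum (f := fun i => ‖x (b i)‖ ^ 2) (fun _ _ => by positivity)
            (Finset.mem_univ i)
    _ = _ := by
        rw [Finset.sum_const, Finset.card_univ, Fintype.card_fin, nsmul_eq_mul]
        ring

/-- The commutator with a skew-adjoint operator is skew for the trace form, hence it is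
semisimple. -/
theorem IsSkew.commutator_eq_zero_of_iterate {h : V →L[ℂ] V} (hh : IsSkew h) (n : ℕ) :
    ∀ x : V →L[ℂ] V, IsSkew x → (fun y => h * y - y * h)^[n] x = 0 → n ≠ 0 →
      h * x - x * h = 0 := by
  induction n with
  | zero => intro x _ _ h0; exact absurd rfl h0
  | succ n ih =>
    intro x hx hn _
    rw [Function.iterate_succ_apply] at hn
    rcases Nat.eq_zero_or_pos n with rfl | hpos
    · simpa using hn
    · have h1 := ih _ (hh.commutator hx) hn hpos.ne'
      refine (hh.commutator hx).eq_zero_of_opTrace_sq ?_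
      set y := h * x - x * h with hy
      have e : opTrace (y * y) = 0 := by
        have e1 : y * y = (h * (x * y) - x * y * h) - x * (h * y - y * h) := by
          rw [hy]; noncomm_ring
        rw [e1, h1, mul_zero, sub_zero, map_sub, opTrace_mul_comm h, sub_self]
      rw [e, Complex.zero_re]

omit [FiniteDimensional ℂ V] in
theorem hasDerivAt_pow_of_commutator {γ : ℝ → V →L[ℂ] V} {y : V →L[ℂ] V} {s : ℝ}
    (hγ : HasDerivAt γ (y * γ s - γ s * y) s) (k : ℕ) :
    HasDerivAt (fun s => γ s ^ k) (y * γ s ^ k - γ s ^ k * y) s := by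
  induction k with
  | zero => simpa using hasDerivAt_const s (1 : V →L[ℂ] V)
  | succ k ih =>
    have := ih.mul hγ
    simp only [pow_succ]
    refine this.congr_deriv ?_
    noncomm_ring

/-- The trace invariants are constant along `γ' = [y, γ]`. -/
theorem opTrace_pow_const_of_commutator {γ : ℝ → V →L[ℂ] V} {y : V →L[ℂ] V}
    (hγ : ∀ s, HasDerivAt γ (y * γ s - γ s * y) s) (k : ℕ) (s : ℝ) :
    opTrace (γ s ^ k) = opTrace (γ 0 ^ k) := by
  let T : (V →L[ℂ] V) →L[ℝ] ℂ := ⟨opTrace, continuous_opTrace⟩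
  have h1 : ∀ s, HasDerivAt (fun s => T (γ s ^ k)) 0 s := fun s => by
    have := T.hasFDerivAt.comp_hasDerivAt s (hasDerivAt_pow_of_commutator (hγ s) k)
    refine this.congr_deriv ?_
    change opTrace (y * γ s ^ k - γ s ^ k * y) = 0
    rw [map_sub, opTrace_mul_comm, sub_self]
  exact is_const_of_deriv_eq_zero (fun s => (h1 s).differentiableAt) (fun s => (h1 s).deriv) s 0

theorem exists_linear_flow {W : Type*} [NormedAddCommGroup W] [NormedSpace ℝ W]
    [FiniteDimensional ℝ W] (D : W →ₗ[ℝ] W) (z : W) :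
    ∃ γ : ℝ → W, γ 0 = z ∧ ∀ s, HasDerivAt γ (D (γ s)) s := by
  have : CompleteSpace W := FiniteDimensional.complete ℝ W
  let D' : W →L[ℝ] W := LinearMap.toContinuousLinearMap D
  refine ⟨fun s => NormedSpace.exp (s • D') z, by simp, fun s => ?_⟩
  have h1 := hasDerivAt_exp_smul_const' (𝕂 := ℝ) D' s
  exact (h1.clm_apply (hasDerivAt_const s z)).congr_deriv (by simp [D'])

/-- Let `c` be a second representation of a Lie algebra `𝔤` of skew-adjoint operators and suppose
that `c = -id` on the centralizer of some `H ∈ 𝔤`. Then `c x` and `-x` have powers of equal trace,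
for every `x ∈ 𝔤`. This is the conjugacy of maximal tori: the point closest to `H` on the
invariant compact set of all `z` with the same trace invariants as `x` commutes with `H`. -/
theorem opTrace_pow_eq_of_centralizer (𝔤 : Submodule ℝ (V →L[ℂ] V))
    (h𝔤 : ∀ x ∈ 𝔤, ∀ y ∈ 𝔤, x * y - y * x ∈ 𝔤) (hskew : ∀ x ∈ 𝔤, IsSkew x)
    (c : 𝔤 →ₗ[ℝ] (V →L[ℂ] V))
    (hc : ∀ x y : 𝔤, c ⟨(x : V →L[ℂ] V) * y - (y : V →L[ℂ] V) * x, h𝔤 x x.2 y y.2⟩ =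
      c x * c y - c y * c x)
    (H : 𝔤)
    (hH : ∀ z : 𝔤, (z : V →L[ℂ] V) * H - (H : V →L[ℂ] V) * z = 0 → c z = -z) (k : ℕ) (x : 𝔤) :
    opTrace (c x ^ k) = opTrace ((-x : V →L[ℂ] V) ^ k) := by
  have hcc : Continuous c := c.continuous_of_finiteDimensional
  have htc := continuous_opTrace (V := V)
  let g : 𝔤 → ℂ := fun z => opTrace (c z ^ k) - opTrace ((-z : V →L[ℂ] V) ^ k)
  let q : 𝔤 → ℂ := fun z => opTrace ((z : V →L[ℂ] V) * (z : V →L[ℂ] V))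
  have hg : Continuous g := by fun_prop
  have hq : Continuous q := by fun_prop
  -- the compact set of elements with the same invariants as `x`
  let O : Set 𝔤 := {z | q z = q x ∧ g z = g x}
  have hO : IsCompact O := by
    refine Metric.isCompact_of_isClosed_isBounded
      ((isClosed_eq hq continuous_const).inter (isClosed_eq hg continuous_const)) ?_
    refine (Metric.isBounded_closedBall (x := (0 : 𝔤))
      (r := Module.finrank ℂ V * Real.sqrt (-(q x).re))).subset fun z hz => ?_
    rw [mem_closedBall_zero_iff, ← hz.1]
    exact (hskew z z.2).norm_le
  let φ : 𝔤 → ℝ := fun z => (opTrace ((z : V →L[ℂ] V) * (H : V →L[ℂ] V))).re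
  have hφ : Continuous φ := by fun_prop
  obtain ⟨z, hzO, hz⟩ := hO.exists_isMinOn ⟨x, rfl, rfl⟩ hφ.continuousOn
  -- the point of `O` minimizing the trace form with `H` commutes with `H`, as the derivative along
  -- the flow of the commutator with `y = [z, H]`, which preserves `O`, is the trace of `y ^ 2`
  have hcomm : (z : V →L[ℂ] V) * H - (H : V →L[ℂ] V) * z = 0 := by
    set y : 𝔤 := ⟨(z : V →L[ℂ] V) * H - (H : V →L[ℂ] V) * z, h𝔤 z z.2 H H.2⟩ with hy
    let ad : 𝔤 →ₗ[ℝ] 𝔤 :=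
      { toFun := fun w => ⟨(y : V →L[ℂ] V) * w - (w : V →L[ℂ] V) * y, h𝔤 y y.2 w w.2⟩
        map_add' := fun v w => by ext1; simp [mul_add, add_mul]; abel
        map_smul' := fun r w => by ext1; simp [smul_sub] }
    obtain ⟨γ, hγ0, hγ⟩ := exists_linear_flow ad z
    have hγ1 : ∀ s, HasDerivAt (fun s => (γ s : V →L[ℂ] V))
        ((y : V →L[ℂ] V) * γ s - (γ s : V →L[ℂ] V) * y) s :=
      fun s => by
        let inc : 𝔤 →L[ℝ] (V →L[ℂ] V) := ⟨𝔤.subtype, continuous_subtype_val⟩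
        have := inc.hasFDerivAt.comp_hasDerivAt s (hγ s)
        exact this
    have hγ2 : ∀ s, HasDerivAt (fun s => c (γ s)) (c y * c (γ s) - c (γ s) * c y) s := fun s => by
      let cL : 𝔤 →L[ℝ] (V →L[ℂ] V) := ⟨c, hcc⟩
      have := cL.hasFDerivAt.comp_hasDerivAt s (hγ s)
      rw [← hc]
      exact this
    have hγ3 : ∀ s, HasDerivAt (fun s => (-γ s : V →L[ℂ] V))
        ((y : V →L[ℂ] V) * (-γ s) - (-γ s : V →L[ℂ] V) * y) s :=
      fun s => by
        have := (hγ1 s).neg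
        refine this.congr_deriv ?_
        noncomm_ring
    have hmem : ∀ s, γ s ∈ O := fun s => by
      refine ⟨?_, ?_⟩
      · rw [← hzO.1]
        have := opTrace_pow_const_of_commutator hγ1 2 s
        simpa only [pow_two, hγ0] using this
      · rw [← hzO.2]
        have e1 := opTrace_pow_const_of_commutator hγ2 k s
        have e2 := opTrace_pow_const_of_commutator hγ3 k s
        simp only [hγ0] at e1 e2
        change _ - _ = _ - _
        rw [e1, e2]
    have hmin : IsLocalMin (fun s => φ (γ s)) 0 :=
      Filter.Eventually.of_forall fun s => by
        simp only [hγ0]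
        exact hz (hmem s)
    let T : (V →L[ℂ] V) →L[ℝ] ℝ := Complex.reCLM ∘L ⟨opTrace, continuous_opTrace⟩
    have hder : HasDerivAt (fun s => φ (γ s))
        (T (((y : V →L[ℂ] V) * γ 0 - (γ 0 : V →L[ℂ] V) * y) * H)) 0 :=
      T.hasFDerivAt.comp_hasDerivAt 0 ((hγ1 0).mul_const (H : V →L[ℂ] V))
    have h0 := hmin.hasDerivAt_eq_zero hder
    rw [hγ0] at h0
    refine (hskew y y.2).eq_zero_of_opTrace_sq ?_
    rw [← h0]
    change (opTrace _).re = (opTrace _).re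
    congr 1
    have e1 : ((y : V →L[ℂ] V) * z - (z : V →L[ℂ] V) * y) * H =
        (y : V →L[ℂ] V) * y - ((z : V →L[ℂ] V) * (y * H) - (y : V →L[ℂ] V) * H * z) := by
      simp only [hy]; noncomm_ring
    rw [e1, map_sub, map_sub, opTrace_mul_comm (z : V →L[ℂ] V), sub_self, sub_zero]
  have h1 : g z = 0 := by
    change opTrace (c z ^ k) - opTrace ((-z : V →L[ℂ] V) ^ k) = 0
    rw [hH z hcomm, sub_self]
  have h2 : g x = 0 := by rw [← hzO.2, h1]
  exact sub_eq_zero.1 h2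

end OperatorTrace

/-! ### Charge conjugations, ideals and regular elements -/

section ChevalleyInvolution

variable {L : Type*} [LieRing L] [LieAlgebra ℝ L]

theorem LieSubalgebra.mem_of_maximal_abelian {t : LieSubalgebra ℝ L}
    (ht : Maximal (fun s : LieSubalgebra ℝ L => IsLieAbelian s) t) {y : L}
    (hy : ∀ x ∈ t, ⁅x, y⁆ = 0) : y ∈ t := by
  have hab : ∀ x ∈ t, ∀ z ∈ t, ⁅x, z⁆ = 0 := fun x hx z hz => by
    have := ht.prop
    have h := trivial_lie_zero t t ⟨x, hx⟩ ⟨z, hz⟩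
    exact congrArg Subtype.val h
  have hy' : ∀ x ∈ t, ⁅y, x⁆ = 0 := fun x hx => by rw [← lie_skew, hy x hx, neg_zero]
  have hz : ∀ x z : L, x ∈ t.toSubmodule ⊔ Submodule.span ℝ {y} →
      z ∈ t.toSubmodule ⊔ Submodule.span ℝ {y} → ⁅x, z⁆ = 0 := by
    intro x z hx hz
    obtain ⟨a, ha, b, hb, rfl⟩ := Submodule.mem_sup.1 hx
    obtain ⟨a', ha', b', hb', rfl⟩ := Submodule.mem_sup.1 hz
    obtain ⟨r, rfl⟩ := Submodule.mem_span_singleton.1 hb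
    obtain ⟨r', rfl⟩ := Submodule.mem_span_singleton.1 hb'
    simp [hab a ha a' ha', hy a ha, hy' a' ha']
  let s : LieSubalgebra ℝ L :=
    { t.toSubmodule ⊔ Submodule.span ℝ {y} with
      lie_mem' := fun {x z} hx hz' => by
        rw [hz x z hx hz']
        exact Submodule.zero_mem _ }
  have hs : IsLieAbelian s := ⟨fun x z => Subtype.ext (hz x z x.2 z.2)⟩
  have hts : t ≤ s := fun x hx =>
    (le_sup_left : t.toSubmodule ≤ t.toSubmodule ⊔ Submodule.span ℝ {y}) hx
  exact ht.le_of_ge hs hts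
    ((le_sup_right : Submodule.span ℝ {y} ≤ t.toSubmodule ⊔ Submodule.span ℝ {y})
      (Submodule.mem_span_singleton_self y))

theorem LieIdeal.lie_eq_zero_of_isCompl {K K' : LieIdeal ℝ L} (h : IsCompl K K') {x y : L}
    (hx : x ∈ K) (hy : y ∈ K') : ⁅x, y⁆ = 0 := by
  have h1 : ⁅x, y⁆ ∈ K' := K'.lie_mem hy
  have h2 : ⁅x, y⁆ ∈ K := by rw [← lie_skew]; exact K.neg_mem (K.lie_mem hx)
  have : ⁅x, y⁆ ∈ K ⊓ K' := ⟨h2, h1⟩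
  rw [h.inf_eq_bot] at this
  simpa using this

theorem LieIdeal.exists_add_of_isCompl {K K' : LieIdeal ℝ L} (h : IsCompl K K') (x : L) :
    ∃ k ∈ K, ∃ k' ∈ K', x = k + k' := by
  have : x ∈ K ⊔ K' := by rw [h.sup_eq_top]; trivial
  obtain ⟨k, hk, k', hk', e⟩ := (LieSubmodule.mem_sup K K' x).1 this
  exact ⟨k, hk, k', hk', e.symm⟩

/-- A maximal abelian subalgebra is the direct sum of its intersections with two complementary
ideals. -/
theorem LieSubalgebra.mem_of_add_mem_of_isCompl {t : LieSubalgebra ℝ L}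
    (ht : Maximal (fun s : LieSubalgebra ℝ L => IsLieAbelian s) t)
    {K K' : LieIdeal ℝ L} (h : IsCompl K K') {k k' : L} (hk : k ∈ K) (hk' : k' ∈ K')
    (hkk' : k + k' ∈ t) : k ∈ t := by
  refine LieSubalgebra.mem_of_maximal_abelian ht fun x hx => ?_
  obtain ⟨a, ha, a', ha', rfl⟩ := LieIdeal.exists_add_of_isCompl h x
  have hab : ⁅a + a', k + k'⁆ = 0 := by
    have := ht.prop
    have h := trivial_lie_zero t t ⟨_, hx⟩ ⟨_, hkk'⟩
    exact congrArg Subtype.val h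
  have e1 : ⁅a, k'⁆ = 0 := LieIdeal.lie_eq_zero_of_isCompl h ha hk'
  have e2 : ⁅a', k⁆ = 0 := LieIdeal.lie_eq_zero_of_isCompl h.symm ha' hk
  simp only [add_lie, lie_add, e1, e2, zero_add, add_zero] at hab ⊢
  have h1 : ⁅a, k⁆ ∈ K ⊓ K' := by
    refine ⟨K.lie_mem hk, ?_⟩
    rw [eq_neg_of_add_eq_zero_left hab]
    exact K'.neg_mem (K'.lie_mem hk')
  rw [h.inf_eq_bot] at h1
  simpa using h1

/-- In a semisimple Lie algebra, an automorphism which is `-id` on a maximal abelian subalgebra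
preserves every ideal: a simple factor which is moved would meet the subalgebra trivially. -/
theorem LieIdeal.map_mem_of_neg_on_maximal_abelian [LieAlgebra.IsSemisimple ℝ L]
    {t : LieSubalgebra ℝ L} (ht : Maximal (fun s : LieSubalgebra ℝ L => IsLieAbelian s) t)
    (C : L ≃ₗ⁅ℝ⁆ L) (hC : ∀ H ∈ t, C H = -H) (I : LieIdeal ℝ L) {x : L} (hx : x ∈ I) :
    C x ∈ I := by
  let I' : LieIdeal ℝ L := I.comap C.toLieHom
  have hI' : ∀ y, y ∈ I' ↔ C y ∈ I := fun y => LieIdeal.mem_comap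
  obtain ⟨J, hJ⟩ := exists_isCompl I'
  obtain ⟨K', hK⟩ := exists_isCompl (I ⊓ J)
  have htK : ∀ H ∈ t, H ∈ I ⊓ J → H = 0 := fun H hH hHK => by
    have h1 : H ∈ I' := by
      rw [hI', hC H hH]
      exact I.neg_mem hHK.1
    have : H ∈ I' ⊓ J := ⟨h1, hHK.2⟩
    rw [hJ.inf_eq_bot] at this
    simpa using this
  have hbot : I ⊓ J = ⊥ := by
    rw [eq_bot_iff]
    intro s hs
    have hst : s ∈ t := by
      refine LieSubalgebra.mem_of_maximal_abelian ht fun H hH => ?_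
      obtain ⟨k, hk, k', hk', rfl⟩ := LieIdeal.exists_add_of_isCompl hK H
      have h0 := htK k (LieSubalgebra.mem_of_add_mem_of_isCompl ht hK hk hk' hH) hk
      rw [h0, zero_add]
      exact LieIdeal.lie_eq_zero_of_isCompl hK.symm hk' hs
    simpa using htK s hst hs
  have hle : I ≤ I' := by
    calc I = I ⊓ (I' ⊔ J) := by rw [hJ.sup_eq_top, inf_top_eq]
      _ = (I ⊓ I') ⊔ (I ⊓ J) := inf_sup_left _ _ _
      _ = I ⊓ I' := by rw [hbot, sup_bot_eq]
      _ ≤ I' := inf_le_right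
  exact (hI' x).1 (hle hx)

/-- Existence of regular elements in an abelian subalgebra: some `H` has its centralizer contained
in the generalized centralizer of every other element of the subalgebra. -/
theorem LieSubalgebra.exists_regular [FiniteDimensional ℝ L] (t : LieSubalgebra ℝ L)
    (ht : IsLieAbelian t) :
    ∃ H ∈ t, ∀ z : L, ⁅H, z⁆ = 0 → ∀ H' ∈ t, ∃ n : ℕ, ((LieAlgebra.ad ℝ L H') ^ n) z = 0 := by
  have hne : (range fun x : t => Module.finrank ℝ (LieSubalgebra.engel ℝ (x : L))).Nonempty :=
    ⟨_, ⟨0, rfl⟩⟩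
  obtain ⟨⟨H, hH⟩, hHmin⟩ := Nat.sInf_mem hne
  have hmin : ∀ x ∈ t, Module.finrank ℝ (LieSubalgebra.engel ℝ H)
      ≤ Module.finrank ℝ (LieSubalgebra.engel ℝ x) := fun x hx => by
    rw [show Module.finrank ℝ (LieSubalgebra.engel ℝ H) = _ from hHmin]
    exact Nat.sInf_le ⟨⟨x, hx⟩, rfl⟩
  have htE : t ≤ LieSubalgebra.engel ℝ H := fun x hx => by
    rw [LieSubalgebra.mem_engel_iff]
    refine ⟨1, ?_⟩
    have h := trivial_lie_zero t t ⟨H, hH⟩ ⟨x, hx⟩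
    simpa using congrArg Subtype.val h
  have hbot := LieAlgebra.engel_isBot_of_isMin (K := ℝ) (L := L)
    ((Cardinal.natCast_lt_aleph0).le.trans (Cardinal.aleph0_le_mk ℝ)) t
    ⟨LieSubalgebra.engel ℝ H, H, hH, rfl⟩ htE (by
      rintro ⟨_, x, hx, rfl⟩ hle
      have hle' : LieSubalgebra.engel ℝ x ≤ LieSubalgebra.engel ℝ H := hle
      have : (LieSubalgebra.engel ℝ x).toSubmodule = (LieSubalgebra.engel ℝ H).toSubmodule :=
        Submodule.eq_of_le_of_finrank_le hle' (hmin x hx)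
      exact this.symm.le)
  refine ⟨H, hH, fun z hz H' hH' => ?_⟩
  have h1 : z ∈ LieSubalgebra.engel ℝ H := by
    rw [LieSubalgebra.mem_engel_iff]
    exact ⟨1, by simpa using hz⟩
  have h2 : z ∈ LieSubalgebra.engel ℝ H' := hbot ⟨_, H', hH', rfl⟩ h1
  rwa [LieSubalgebra.mem_engel_iff] at h2

end ChevalleyInvolution

noncomputable section Antiunitary

variable {V : Type*} [NormedAddCommGroup V] [InnerProductSpace ℂ V] [FiniteDimensional ℂ V]

/-- The complex conjugation of the coordinates with respect to an orthonormal basis. -/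
def OrthonormalBasis.conj {κ : Type*} [Fintype κ] (b : OrthonormalBasis κ ℂ V) :
    V ≃ₗᵢ⋆[ℂ] V :=
  let f : V → V := fun v => b.repr.symm (WithLp.toLp 2 fun i => starRingEnd ℂ (b.repr v i))
  have hf : ∀ v, f (f v) = v := fun v => by
    apply b.repr.injective
    ext i
    simp [f]
  { toFun := f
    invFun := f
    left_inv := hf
    right_inv := hf
    map_add' := fun v w => by
      apply b.repr.injective
      ext i
      simp [f]
    map_smul' := fun c v => by
      apply b.repr.injective
      ext i
      simp [f]
    norm_map' := fun v => by
      change ‖b.repr.symm _‖ = ‖v‖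
      rw [LinearIsometryEquiv.norm_map, ← b.repr.norm_map v, EuclideanSpace.norm_eq,
        EuclideanSpace.norm_eq]
      simp }

end Antiunitary

/-! ### Antiunitary implementation of charge conjugations -/

noncomputable section Antiunitary

variable {V : Type*} [NormedAddCommGroup V] [InnerProductSpace ℂ V] [FiniteDimensional ℂ V]

section Conj

variable {κ : Type*} [Fintype κ] (b : OrthonormalBasis κ ℂ V)

omit [FiniteDimensional ℂ V] in
theorem OrthonormalBasis.conj_conj (v : V) : b.conj (b.conj v) = v := b.conj.left_inv v

omit [FiniteDimensional ℂ V] in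
theorem OrthonormalBasis.conj_self (i : κ) : b.conj (b i) = b i := by
  classical
  change b.repr.symm (WithLp.toLp 2 fun j => starRingEnd ℂ (b.repr (b i) j)) = b i
  apply b.repr.injective
  ext j
  simp [apply_ite]

omit [FiniteDimensional ℂ V] in
theorem OrthonormalBasis.inner_conj_right (v w : V) :
    inner ℂ v (b.conj w) = starRingEnd ℂ (inner ℂ (b.conj v) w) := by
  rw [← b.repr.inner_map_map v, ← b.repr.inner_map_map (b.conj v)]
  have h : ∀ v i, b.repr (b.conj v) i = starRingEnd ℂ (b.repr v i) := fun v i => by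
    change b.repr (b.repr.symm (WithLp.toLp 2 fun j => starRingEnd ℂ (b.repr v j))) i = _
    simp
  rw [PiLp.inner_apply, PiLp.inner_apply, map_sum]
  refine Finset.sum_congr rfl fun i _ => ?_
  rw [h, h]
  simp

/-- The complex conjugate of an operator with respect to an orthonormal basis. -/
def OrthonormalBasis.conjOp (f : V →L[ℂ] V) : V →L[ℂ] V :=
  LinearMap.toContinuousLinearMap
    { toFun := fun v => b.conj (f (b.conj v))
      map_add' := fun v w => by simp
      map_smul' := fun c v => by simp [map_smulₛₗ] }

theorem OrthonormalBasis.conjOp_apply (f : V →L[ℂ] V) (v : V) :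
    b.conjOp f v = b.conj (f (b.conj v)) := rfl

theorem OrthonormalBasis.conjOp_mul (f g : V →L[ℂ] V) :
    b.conjOp (f * g) = b.conjOp f * b.conjOp g := by
  ext v
  simp [conjOp_apply, conj_conj]

theorem OrthonormalBasis.opTrace_conjOp (f : V →L[ℂ] V) :
    opTrace (b.conjOp f) = starRingEnd ℂ (opTrace f) := by
  rw [opTrace_eq_sum_inner b, opTrace_eq_sum_inner b, map_sum]
  refine Finset.sum_congr rfl fun i _ => ?_
  rw [conjOp_apply, conj_self, inner_conj_right, conj_self]

theorem OrthonormalBasis.isSkew_conjOp {f : V →L[ℂ] V} (hf : IsSkew f) : IsSkew (b.conjOp f) := by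
  intro v w
  rw [conjOp_apply, conjOp_apply, inner_conj_right b v, ← map_neg, ← hf, inner_conj_right,
    Complex.conj_conj]

theorem OrthonormalBasis.conjOp_pow (f : V →L[ℂ] V) (k : ℕ) :
    b.conjOp (f ^ k) = b.conjOp f ^ k := by
  induction k with
  | zero => ext v; simp [conjOp_apply, conj_conj]
  | succ k ih => rw [pow_succ, pow_succ, conjOp_mul, ih]

theorem IsSkew.opTrace_neg_pow {f : V →L[ℂ] V} (hf : IsSkew f) (k : ℕ) :
    opTrace ((-f) ^ k) = starRingEnd ℂ (opTrace (f ^ k)) := by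
  have h : ∀ k : ℕ, ∀ v w, inner ℂ v (((-f) ^ k) w) = inner ℂ ((f ^ k) v) w := by
    intro k
    induction k with
    | zero => intro v w; simp
    | succ k ih =>
      intro v w
      rw [pow_succ, pow_succ', mul_apply_eq_comp, ih, mul_apply_eq_comp,
        hf]
      simp
  set b := stdOrthonormalBasis ℂ V
  rw [opTrace_eq_sum_inner b, opTrace_eq_sum_inner b, map_sum]
  refine Finset.sum_congr rfl fun i _ => ?_
  rw [h, inner_conj_symm]

end Conj

variable {L : Type*} [LieRing L] [LieAlgebra ℝ L]

/-- A charge conjugation is implemented antiunitarily in every unitary representation: the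
representation `σ ∘ C` is the complex conjugate of `σ`. -/
theorem exists_antiunitary_of_chevalley [FiniteDimensional ℝ L] [LieAlgebra.IsSemisimple ℝ L]
    (σ : L →ₗ[ℝ] (V →L[ℂ] V)) (hσ : ∀ x y, σ ⁅x, y⁆ = σ x * σ y - σ y * σ x)
    (hskew : ∀ x, IsSkew (σ x)) {t : LieSubalgebra ℝ L}
    (ht : Maximal (fun s : LieSubalgebra ℝ L => IsLieAbelian s) t)
    (C : L ≃ₗ⁅ℝ⁆ L) (hC : ∀ H ∈ t, C H = -H) :
    ∃ K : V ≃ₗᵢ⋆[ℂ] V, ∀ x v, K (σ x v) = σ (C x) (K v) := by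
  -- `σ ∘ C` factors through `σ`
  let I : LieIdeal ℝ L :=
    { LinearMap.ker σ with
      lie_mem := fun {x m} hm => by
        have hm' : σ m = 0 := hm
        change σ ⁅x, m⁆ = 0
        rw [hσ, hm', mul_zero, zero_mul, sub_zero] }
  have hCI : ∀ x, σ x = 0 → σ (C x) = 0 := fun x hx =>
    LieIdeal.map_mem_of_neg_on_maximal_abelian ht C hC I hx
  have hCI' : ∀ x y, σ x = σ y → σ (C x) = σ (C y) := fun x y hxy => by
    rw [← sub_eq_zero, ← map_sub, ← map_sub]
    exact hCI _ (by rw [map_sub, hxy, sub_self])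
  let 𝔤 : Submodule ℝ (V →L[ℂ] V) := LinearMap.range σ
  obtain ⟨g, hg⟩ := LinearMap.exists_rightInverse_of_surjective σ.rangeRestrict
    (LinearMap.range_rangeRestrict σ)
  have hg' : ∀ z : 𝔤, σ (g z) = z := fun z => congrArg Subtype.val (LinearMap.congr_fun hg z)
  have h𝔤 : ∀ x ∈ 𝔤, ∀ y ∈ 𝔤, x * y - y * x ∈ 𝔤 := by
    rintro _ ⟨x, rfl⟩ _ ⟨y, rfl⟩
    exact ⟨⁅x, y⁆, hσ x y⟩
  let c : 𝔤 →ₗ[ℝ] (V →L[ℂ] V) := σ ∘ₗ C.toLinearEquiv.toLinearMap ∘ₗ g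
  have hcσ : ∀ x, c ⟨σ x, x, rfl⟩ = σ (C x) := fun x => hCI' _ _ (hg' _)
  -- a regular element of `t` has the right centralizer on the complement of the kernel of `σ`
  obtain ⟨H, hHt, hH⟩ := LieSubalgebra.exists_regular t ht.prop
  obtain ⟨J, hJ⟩ := exists_isCompl I
  have hreg : ∀ z, σ z * σ H - σ H * σ z = 0 → σ (C z) = -σ z := by
    intro z hz
    obtain ⟨i, hi, j, hj, rfl⟩ := LieIdeal.exists_add_of_isCompl hJ z
    have hi0 : σ i = 0 := hi
    have hmeet : ∀ y ∈ J, σ y = 0 → y = 0 := fun y hy hy0 => by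
      have : y ∈ I ⊓ J := ⟨hy0, hy⟩
      rw [hJ.inf_eq_bot] at this
      simpa using this
    have hHj : ⁅H, j⁆ = 0 := by
      refine hmeet _ (J.lie_mem hj) ?_
      rw [map_add, hi0, zero_add] at hz
      rw [hσ, ← neg_sub, hz, neg_zero]
    have hjt : j ∈ t := by
      refine LieSubalgebra.mem_of_maximal_abelian ht fun H' hH' => hmeet _ (J.lie_mem hj) ?_
      obtain ⟨n, hn⟩ := hH j hHj H' hH'
      have hpow : ∀ n : ℕ, ∀ y, σ (((LieAlgebra.ad ℝ L H') ^ n) y) =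
          (fun x => σ H' * x - x * σ H')^[n] (σ y) := by
        intro n
        induction n with
        | zero => intro y; rfl
        | succ n ih =>
          intro y
          rw [pow_succ, Module.End.mul_apply, ih, Function.iterate_succ_apply, LieAlgebra.ad_apply,
            hσ]
      have h1 : (fun x => σ H' * x - x * σ H')^[n + 1] (σ j) = 0 := by
        rw [← hpow, pow_succ', Module.End.mul_apply, hn, map_zero, map_zero]
      rw [hσ]
      exact (hskew H').commutator_eq_zero_of_iterate (n + 1) _ (hskew j) h1 n.succ_ne_zero
    rw [map_add, map_add, map_add, hC j hjt, map_neg, hCI i hi0, hi0, zero_add, zero_add]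
  have htrace : ∀ (k : ℕ) (x : L), opTrace (σ (C x) ^ k) = opTrace ((-σ x) ^ k) := by
    intro k x
    rw [← hcσ]
    refine opTrace_pow_eq_of_centralizer 𝔤 h𝔤 ?_ c ?_ ⟨σ H, H, rfl⟩ ?_ k ⟨σ x, x, rfl⟩
    · rintro _ ⟨y, rfl⟩
      exact hskew y
    · rintro ⟨_, x, rfl⟩ ⟨_, y, rfl⟩
      have : (⟨σ x * σ y - σ y * σ x, h𝔤 _ ⟨x, rfl⟩ _ ⟨y, rfl⟩⟩ : 𝔤) = ⟨σ ⁅x, y⁆, _, rfl⟩ :=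
        Subtype.ext (hσ x y).symm
      rw [this, hcσ, hcσ, hcσ, C.map_lie, hσ]
    · rintro ⟨_, z, rfl⟩ hz
      rw [hcσ]
      exact hreg z hz
  -- equality of the traces of powers gives equality of the traces of words, by symmetrization in
  -- the Lie algebra of all pairs `(b.conjOp (σ x), σ (C x))`
  set b := stdOrthonormalBasis ℂ V
  have hword : ∀ l : List L, LinearMap.trace ℂ V
      (((l.map fun x => b.conjOp (σ x)).prod : V →L[ℂ] V) : V →ₗ[ℂ] V) =
      LinearMap.trace ℂ V (((l.map fun x => σ (C x)).prod : V →L[ℂ] V) : V →ₗ[ℂ] V) := by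
    intro l
    let s : L →ₗ[ℝ] (V →L[ℂ] V) × (V →L[ℂ] V) :=
      { toFun := fun x => (b.conjOp (σ x), σ (C x))
        map_add' := fun x y => by
          ext v <;> simp [OrthonormalBasis.conjOp_apply]
        map_smul' := fun r x => by
          ext v
          · have : (r • σ x) (b.conj v) = (r : ℂ) • (σ x) (b.conj v) := rfl
            simp only [OrthonormalBasis.conjOp_apply, map_smul, this, map_smulₛₗ,
              Complex.conj_ofReal, RingHom.id_apply, Prod.smul_mk]
            rfl
          · simp }
    let τ : ((V →L[ℂ] V) × (V →L[ℂ] V)) →ₗ[ℝ] ℂ :=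
      opTrace ∘ₗ LinearMap.fst ℝ _ _ - opTrace ∘ₗ LinearMap.snd ℝ _ _
    have hs : ∀ x ∈ LinearMap.range s, ∀ y ∈ LinearMap.range s,
        x * y - y * x ∈ LinearMap.range s := by
      rintro _ ⟨x, rfl⟩ _ ⟨y, rfl⟩
      refine ⟨⁅x, y⁆, ?_⟩
      refine Prod.ext ?_ ?_
      · change b.conjOp (σ ⁅x, y⁆) =
            b.conjOp (σ x) * b.conjOp (σ y) - b.conjOp (σ y) * b.conjOp (σ x)
        rw [hσ, ← OrthonormalBasis.conjOp_mul, ← OrthonormalBasis.conjOp_mul]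
        ext v
        simp [OrthonormalBasis.conjOp_apply]
      · change σ (C ⁅x, y⁆) = σ (C x) * σ (C y) - σ (C y) * σ (C x)
        rw [C.map_lie, hσ]
    have h1 : ∀ a ∈ powerSpan (LinearMap.range s), τ a = 0 := fun a ha => by
      induction ha using Submodule.span_induction with
      | mem a ha =>
        obtain ⟨_, ⟨x, rfl⟩, k, rfl⟩ := ha
        change opTrace (b.conjOp (σ x) ^ k) - opTrace (σ (C x) ^ k) = 0
        rw [htrace, ← OrthonormalBasis.conjOp_pow, OrthonormalBasis.opTrace_conjOp,
          (hskew x).opTrace_neg_pow, sub_self]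
      | zero => exact map_zero τ
      | add x y _ _ hx hy => rw [map_add, hx, hy, add_zero]
      | smul r x _ hx => rw [map_smul, hx, smul_zero]
    have h2 : τ ((l.map s).prod) = 0 :=
      h1 _ (list_prod_mem_powerSpan hs _ fun x hx => by
        obtain ⟨y, _, rfl⟩ := List.mem_map.1 hx
        exact ⟨y, rfl⟩)
    have h3 : ∀ l : List L, (l.map s).prod = ((l.map fun x => b.conjOp (σ x)).prod,
        (l.map fun x => σ (C x)).prod) := by
      intro l
      induction l with
      | nil => rfl
      | cons x l ih => simp only [List.map_cons, List.prod_cons, ih]; rfl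
    rw [h3] at h2
    exact sub_eq_zero.1 h2
  obtain ⟨T, hT⟩ := exists_unitary_of_trace_eq (fun x => b.conjOp (σ x)) (fun x => σ (C x))
    (fun x => b.isSkew_conjOp (hskew x)) (fun x => hskew (C x)) hword
  refine ⟨b.conj.trans T, fun x v => ?_⟩
  have := hT x (b.conj v)
  rw [OrthonormalBasis.conjOp_apply, OrthonormalBasis.conj_conj] at this
  exact this

end Antiunitary

/-! ### Derivatives of vector valued functions on manifolds -/

section ManifoldCalculus

open VectorField

variable {E : Type*} [NormedAddCommGroup E] [NormedSpace ℝ E]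
  {H : Type*} [TopologicalSpace H] {I : ModelWithCorners ℝ E H}
  {M : Type*} [TopologicalSpace M] [ChartedSpace H M]
  {F F₁ F₂ F₃ : Type*} [NormedAddCommGroup F] [NormedSpace ℝ F] [NormedAddCommGroup F₁]
  [NormedSpace ℝ F₁] [NormedAddCommGroup F₂] [NormedSpace ℝ F₂] [NormedAddCommGroup F₃]
  [NormedSpace ℝ F₃]

theorem mvfderiv_clm_comp (T : F₁ →L[ℝ] F₂) {f : M → F₁} {x : M}
    (hf : MDifferentiableAt I 𝓘(ℝ, F₁) f x) (v : TangentSpace I x) :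
    mvfderiv I (fun y => T (f y)) x v = T (mvfderiv I f x v) := by
  have h := hf.hasMFDerivAt
  have h2 : HasMFDerivAt I 𝓘(ℝ, F₂) (fun y => T (f y)) x
      ((T : TangentSpace 𝓘(ℝ, F₁) (f x) →L[ℝ] TangentSpace 𝓘(ℝ, F₂) (T (f x))).comp
        (mfderiv I 𝓘(ℝ, F₁) f x)) :=
    HasMFDerivAt.comp x (T.hasFDerivAt (x := f x)).hasMFDerivAt h
  change mfderiv I 𝓘(ℝ, F₂) (fun y => T (f y)) x v = _
  rw [h2.mfderiv]
  rfl

theorem mvfderiv_bilin (B : F₁ →L[ℝ] F₂ →L[ℝ] F₃) {f : M → F₁} {g : M → F₂} {x : M}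
    (hf : MDifferentiableAt I 𝓘(ℝ, F₁) f x) (hg : MDifferentiableAt I 𝓘(ℝ, F₂) g x)
    (v : TangentSpace I x) :
    mvfderiv I (fun y => B (f y) (g y)) x v =
      B (mvfderiv I f x v) (g x) + B (f x) (mvfderiv I g x v) := by
  have h : HasMFDerivAt I 𝓘(ℝ, F₁ × F₂) (fun y => (f y, g y)) x
      ((mvfderiv I f x).prod (mvfderiv I g x)) :=
    ⟨hf.continuousAt.prodMk hg.continuousAt, hf.hasMFDerivAt.2.prodMk hg.hasMFDerivAt.2⟩
  have h2 : HasMFDerivAt I 𝓘(ℝ, F₃) ((fun p : F₁ × F₂ => B p.1 p.2) ∘ fun y => (f y, g y)) x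
      ((B.isBoundedBilinearMap.deriv (f x, g x)).comp
        ((mvfderiv I f x).prod (mvfderiv I g x))) :=
    HasMFDerivAt.comp x (B.isBoundedBilinearMap.hasFDerivAt (f x, g x)).hasMFDerivAt h
  change mfderiv I 𝓘(ℝ, F₃) ((fun p : F₁ × F₂ => B p.1 p.2) ∘ fun y => (f y, g y)) x v = _
  rw [h2.mfderiv, add_comm]
  rfl

variable [IsManifold I 1 M]

/-- A smooth vector field acts on functions as a derivation, and the Lie bracket acts as the
commutator of derivations. This is the Jacobi identity for `V`, `W` and `f • Z`, at a point where
the auxiliary field `Z` does not vanish. -/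
theorem mvfderiv_mlieBracket_of_ne_zero [IsManifold I ∞ M] [CompleteSpace E]
    {V W Z : (x : M) → TangentSpace I x} {f : M → ℝ} {x : M}
    (hV : ContMDiff I I.tangent 2 (fun x => (⟨x, V x⟩ : TangentBundle I M)))
    (hW : ContMDiff I I.tangent 2 (fun x => (⟨x, W x⟩ : TangentBundle I M)))
    (hZ : ContMDiff I I.tangent 2 (fun x => (⟨x, Z x⟩ : TangentBundle I M)))
    (hf : ContMDiff I 𝓘(ℝ, ℝ) ∞ f)
    (hfV : ContMDiff I 𝓘(ℝ, ℝ) ∞ (fun y => mvfderiv I f y (V y)))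
    (hfW : ContMDiff I 𝓘(ℝ, ℝ) ∞ (fun y => mvfderiv I f y (W y)))
    (hZx : Z x ≠ 0) :
    mvfderiv I f x (mlieBracket I V W x) =
      mvfderiv I (fun y => mvfderiv I f y (W y)) x (V x) -
        mvfderiv I (fun y => mvfderiv I f y (V y)) x (W x) := by
  have hmin : minSmoothness ℝ 2 = 2 := minSmoothness_of_isRCLikeNormedField
  have hmin3 : minSmoothness ℝ 3 = 3 := minSmoothness_of_isRCLikeNormedField
  have : IsManifold I (minSmoothness ℝ 3) M := by rw [hmin3]; infer_instance
  have : IsManifold I (((2 : ℕ∞) : WithTop ℕ∞) + 1) M :=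
    IsManifold.of_le (n := ∞) (by exact_mod_cast le_top)
  have hd : ∀ {U : (x : M) → TangentSpace I x},
      ContMDiff I I.tangent 2 (fun x => (⟨x, U x⟩ : TangentBundle I M)) → ∀ y,
      MDifferentiableAt I I.tangent (fun x => (⟨x, U x⟩ : TangentBundle I M)) y :=
    fun h y => (h y).mdifferentiableAt two_ne_zero
  have hdf : ∀ y, MDifferentiableAt I 𝓘(ℝ, ℝ) f y := fun y => (hf y).mdifferentiableAt (by simp)
  have hdbr : ∀ {U U' : (x : M) → TangentSpace I x},
      ContMDiff I I.tangent 2 (fun x => (⟨x, U x⟩ : TangentBundle I M)) →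
      ContMDiff I I.tangent 2 (fun x => (⟨x, U' x⟩ : TangentBundle I M)) → ∀ y,
      MDifferentiableAt I I.tangent
        (fun x => (⟨x, mlieBracket I U U' x⟩ : TangentBundle I M)) y := fun hU hU' y => by
    have h := ContMDiffAt.mlieBracket_vectorField (m := 1) (n := 2) (hU y) (hU' y) (by
      rw [minSmoothness_of_isRCLikeNormedField]; norm_num)
    exact h.mdifferentiableAt one_ne_zero
  have hdg : ∀ {g : M → ℝ}, ContMDiff I 𝓘(ℝ, ℝ) ∞ g → ∀ y, MDifferentiableAt I 𝓘(ℝ, ℝ) g y :=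
    fun h y => (h y).mdifferentiableAt (by simp)
  have hfZ : ContMDiff I I.tangent 2 (fun x => (⟨x, (f • Z) x⟩ : TangentBundle I M)) :=
    (hf.of_le ENat.LEInfty.out).smul_section hZ
  -- second brackets with `f • Z`, in either order
  have key : ∀ {U U' : (x : M) → TangentSpace I x},
      ContMDiff I I.tangent 2 (fun x => (⟨x, U' x⟩ : TangentBundle I M)) →
      ContMDiff I 𝓘(ℝ, ℝ) ∞ (fun y => mvfderiv I f y (U' y)) →
      mlieBracket I U (mlieBracket I U' (f • Z)) x =
        (mvfderiv I (fun y => mvfderiv I f y (U' y)) x (U x) • Z x +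
          mvfderiv I f x (U' x) • mlieBracket I U Z x) +
        (mvfderiv I f x (U x) • mlieBracket I U' Z x +
          f x • mlieBracket I U (mlieBracket I U' Z) x) := by
    intro U U' hU' hg
    have e : mlieBracket I U' (f • Z) =
        (fun y => mvfderiv I f y (U' y)) • Z + f • mlieBracket I U' Z := by
      funext y
      exact mlieBracket_smul_right (hdf y) (hd hZ y)
    rw [e, mlieBracket_add_right, mlieBracket_smul_right (hdg hg x) (hd hZ x),
      mlieBracket_smul_right (hdf x) (hdbr hU' hZ x)]
    · exact (hdg hg x).smul_section (hd hZ x)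
    · exact (hdf x).smul_section (hdbr hU' hZ x)
  have j1 := leibniz_identity_mlieBracket_apply (I := I) (x := x) (hmin.symm ▸ hV x)
    (hmin.symm ▸ hW x) (hmin.symm ▸ hfZ x)
  have j2 := leibniz_identity_mlieBracket_apply (I := I) (x := x) (hmin.symm ▸ hV x)
    (hmin.symm ▸ hW x) (hmin.symm ▸ hZ x)
  rw [key hW hfW, key hV hfV, mlieBracket_smul_right (hdf x) (hd hZ x), j2] at j1
  have h3 : (mvfderiv I f x (mlieBracket I V W x) -
      (mvfderiv I (fun y => mvfderiv I f y (W y)) x (V x) -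
        mvfderiv I (fun y => mvfderiv I f y (V y)) x (W x))) • Z x = 0 := by
    rw [sub_smul, sub_smul]
    simp only [smul_add] at j1
    have j3 := sub_eq_zero.2 j1
    rw [← neg_zero, ← j3]
    abel
  exact sub_eq_zero.1 ((smul_eq_zero.1 h3).resolve_right hZx)

end ManifoldCalculus

/-! ### Derived representations -/

section Representation

open VectorField

variable {n : ℕ} {G : Type*} [Group G] {V : Type*} [NormedAddCommGroup V] [InnerProductSpace ℂ V]

/-- The operator `ρ g`, as an element of the normed algebra of continuous endomorphisms. -/
def repCLM (ρ : G →* (V ≃ₗᵢ[ℂ] V)) (g : G) : V →L[ℂ] V :=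
  ((ρ g).toContinuousLinearEquiv : V →L[ℂ] V)

@[simp] theorem repCLM_apply (ρ : G →* (V ≃ₗᵢ[ℂ] V)) (g : G) (v : V) : repCLM ρ g v = ρ g v := rfl

theorem repCLM_mul (ρ : G →* (V ≃ₗᵢ[ℂ] V)) (g g' : G) :
    repCLM ρ (g * g') = repCLM ρ g * repCLM ρ g' := by
  ext v; simp [repCLM_apply]

theorem repCLM_one (ρ : G →* (V ≃ₗᵢ[ℂ] V)) : repCLM ρ 1 = 1 := by
  ext v; simp [repCLM_apply]

variable [TopologicalSpace G] [ChartedSpace (EuclideanSpace ℝ (Fin n)) G]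

/-- The derived representation as a real linear map. -/
noncomputable def derivedRepHom (ρ : G →* (V ≃ₗᵢ[ℂ] V)) : LG (n := n) G →ₗ[ℝ] (V →L[ℂ] V) where
  toFun X := derivedRep ρ X
  map_add' X Y := map_add (mvfderiv (𝓡 n) (repCLM ρ) 1) X Y
  map_smul' c X := map_smul (mvfderiv (𝓡 n) (repCLM ρ) 1) c X

/-- The logarithmic derivative `W⁻¹ dW` of a map `W` into `G`, evaluated on a tangent vector. -/
noncomputable def leftLogDeriv {E : Type*} [NormedAddCommGroup E] [NormedSpace ℝ E]
    {H : Type*} [TopologicalSpace H] (I : ModelWithCorners ℝ E H)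
    {M : Type*} [TopologicalSpace M] [ChartedSpace H M] (W : M → G) (x : M)
    (v : TangentSpace I x) : LG (n := n) G :=
  mfderiv I (𝓡 n) (fun y => (W x)⁻¹ * W y) x v

theorem mvfderiv_repCLM_of_eq_one (ρ : G →* (V ≃ₗᵢ[ℂ] V)) {g : G} (hg : g = 1)
    (X : LG (n := n) G) :
    (mvfderiv (𝓡 n) (repCLM ρ) g : EuclideanSpace ℝ (Fin n) →L[ℝ] (V →L[ℂ] V)) X
      = derivedRep (n := n) ρ X := by
  subst hg; rfl

variable [LieGroup (𝓡 n) ∞ G]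

theorem mdifferentiableAt_leftMul (a b : G) :
    MDifferentiableAt (𝓡 n) (𝓡 n) (fun y => a * y) b :=
  (contMDiff_mul_left (I := 𝓡 n) (n := ∞)).mdifferentiableAt (by simp)

/-- The chain rule `d(ρ ∘ W) = (ρ ∘ W) · Lρ(W⁻¹ dW)`. -/
theorem mvfderiv_repCLM_comp {ρ : G →* (V ≃ₗᵢ[ℂ] V)} (hρ : SmoothRep (n := n) ρ)
    {E : Type*} [NormedAddCommGroup E] [NormedSpace ℝ E]
    {H : Type*} [TopologicalSpace H] {I : ModelWithCorners ℝ E H}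
    {M : Type*} [TopologicalSpace M] [ChartedSpace H M] {W : M → G} {x : M}
    (hW : MDifferentiableAt I (𝓡 n) W x) (v : TangentSpace I x) :
    mvfderiv I (fun y => repCLM ρ (W y)) x v =
      repCLM ρ (W x) * derivedRep (n := n) ρ (leftLogDeriv I W x v) := by
  have hΦ : ∀ g, MDifferentiableAt (𝓡 n) 𝓘(ℝ, V →L[ℂ] V) (repCLM ρ) g := fun g =>
    (hρ g).mdifferentiableAt (by simp)
  have hL : MDifferentiableAt I (𝓡 n) (fun y => (W x)⁻¹ * W y) x :=
    MDifferentiableAt.comp x (g := fun z => (W x)⁻¹ * z) (mdifferentiableAt_leftMul _ _) hW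
  have hcomp : MDifferentiableAt I 𝓘(ℝ, V →L[ℂ] V)
      (fun y => repCLM ρ ((W x)⁻¹ * W y)) x := (hΦ _).comp x hL
  have e : (fun y => repCLM ρ (W y)) = fun y =>
      ContinuousLinearMap.mul ℝ (V →L[ℂ] V) (repCLM ρ (W x)) (repCLM ρ ((W x)⁻¹ * W y)) := by
    funext y
    rw [ContinuousLinearMap.mul_apply', ← repCLM_mul, mul_inv_cancel_left]
  rw [e, mvfderiv_clm_comp _ hcomp, ContinuousLinearMap.mul_apply']
  congr 1
  refine Eq.trans ?_ (mvfderiv_repCLM_of_eq_one ρ (inv_mul_cancel (W x)) _)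
  exact mfderiv_comp_apply x (hΦ _) hL v

/-- Left invariant fields act on a representation by right multiplication. -/
theorem mvfderiv_repCLM_mulInvariant {ρ : G →* (V ≃ₗᵢ[ℂ] V)} (hρ : SmoothRep (n := n) ρ)
    (X : LG (n := n) G) (g : G) :
    mvfderiv (𝓡 n) (repCLM ρ) g (mulInvariantVectorField X g) =
      repCLM ρ g * derivedRep ρ X := by
  have hΦ : ∀ g, MDifferentiableAt (𝓡 n) 𝓘(ℝ, V →L[ℂ] V) (repCLM ρ) g := fun g =>
    (hρ g).mdifferentiableAt (by simp)
  have h1 := mfderiv_comp_apply_of_eq (I := 𝓡 n) (I' := 𝓡 n) (I'' := 𝓘(ℝ, V →L[ℂ] V))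
    (x := (1 : G)) (y := g)
    (f := fun y => g * y) (g := repCLM ρ) (hΦ _) (mdifferentiableAt_leftMul _ _) (mul_one g) X
  refine Eq.trans h1.symm ?_
  have e : repCLM ρ ∘ (fun y => g * y) = fun y =>
      ContinuousLinearMap.mul ℝ (V →L[ℂ] V) (repCLM ρ g) (repCLM ρ y) := by
    funext y
    rw [ContinuousLinearMap.mul_apply', ← repCLM_mul]; rfl
  rw [e]
  exact mvfderiv_clm_comp _ (hΦ 1) X

omit [LieGroup (𝓡 n) ∞ G] in
theorem isSkew_derivedRep {ρ : G →* (V ≃ₗᵢ[ℂ] V)} (hρ : SmoothRep (n := n) ρ)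
    (X : LG (n := n) G) : IsSkew (derivedRep ρ X) := by
  intro v w
  have hΦ : MDifferentiableAt (𝓡 n) 𝓘(ℝ, V →L[ℂ] V) (repCLM ρ) 1 :=
    (hρ 1).mdifferentiableAt (by simp)
  let ev (u : V) : (V →L[ℂ] V) →L[ℝ] V := (ContinuousLinearMap.apply ℂ V u).restrictScalars ℝ
  have hev : ∀ u, MDifferentiableAt (𝓡 n) 𝓘(ℝ, V) (fun g => ev u (repCLM ρ g)) 1 := fun u =>
    (ev u).differentiableAt.mdifferentiableAt.comp 1 hΦ
  have h := mvfderiv_bilin (isBoundedBilinearMap_inner (𝕜 := ℂ) (E := V)).toContinuousLinearMap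
    (hev v) (hev w) X
  rw [mvfderiv_clm_comp _ hΦ, mvfderiv_clm_comp _ hΦ] at h
  have e : (fun y => ((isBoundedBilinearMap_inner (𝕜 := ℂ) (E := V)).toContinuousLinearMap
      (ev v (repCLM ρ y))) (ev w (repCLM ρ y))) = fun _ => inner ℂ v w := by
    funext y
    exact (ρ y).inner_map_map v w
  rw [e] at h
  have h0 : mvfderiv (𝓡 n) (fun _ : G => inner ℂ v w) 1 X = 0 := by
    exact congrArg (fun T => T X) (mfderiv_const (I := 𝓡 n) (I' := 𝓘(ℝ, ℂ)) (x := (1 : G))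
      (c := inner ℂ v w))
  rw [h0] at h
  have h2 : (0 : ℂ) = inner ℂ (derivedRep ρ X v) (repCLM ρ 1 w) +
    inner ℂ (repCLM ρ 1 v) (derivedRep ρ X w) := h
  simp only [repCLM_one, one_apply_eq_self] at h2
  exact eq_neg_of_add_eq_zero_left h2.symm

/-- The derived representation maps the Lie bracket to the commutator. -/
theorem derivedRep_lie {ρ : G →* (V ≃ₗᵢ[ℂ] V)} (hρ : SmoothRep (n := n) ρ)
    (X Y : LG (n := n) G) :
    derivedRep ρ ⁅X, Y⁆ = derivedRep ρ X * derivedRep ρ Y - derivedRep ρ Y * derivedRep ρ X := by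
  by_cases hX : X = 0
  · subst hX
    have h0 : derivedRep (n := n) ρ (0 : LG (n := n) G) = 0 := map_zero (derivedRepHom ρ)
    rw [zero_lie, h0, zero_mul, mul_zero, sub_zero]
  have hΦ : ∀ g, MDifferentiableAt (𝓡 n) 𝓘(ℝ, V →L[ℂ] V) (repCLM ρ) g := fun g =>
    (hρ g).mdifferentiableAt (by simp)
  refine (SeparatingDual.eq_iff_forall_dual_eq (R := ℝ)).2 fun ℓ => ?_
  let mulR (S : V →L[ℂ] V) : (V →L[ℂ] V) →L[ℝ] (V →L[ℂ] V) :=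
    (ContinuousLinearMap.mul ℝ (V →L[ℂ] V)).flip S
  have hinv : ∀ (U : LG (n := n) G) (T : (V →L[ℂ] V) →L[ℝ] ℝ),
      (fun g => mvfderiv (𝓡 n) (fun y => T (repCLM ρ y)) g (mulInvariantVectorField U g)) =
        fun g => (T.comp (mulR (derivedRep ρ U))) (repCLM ρ g) := by
    intro U T
    funext g
    rw [mvfderiv_clm_comp T (hΦ g), mvfderiv_repCLM_mulInvariant hρ]
    rfl
  have hsm : ∀ T : (V →L[ℂ] V) →L[ℝ] ℝ, ContMDiff (𝓡 n) 𝓘(ℝ, ℝ) ∞ (fun g => T (repCLM ρ g)) :=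
    fun T => T.contDiff.contMDiff.comp hρ
  have hinvs : ∀ U : LG (n := n) G, ContMDiff (𝓡 n) (𝓡 n).tangent 2
      (fun g => (⟨g, mulInvariantVectorField U g⟩ : TangentBundle (𝓡 n) G)) := fun U => by
    have h := contMDiff_mulInvariantVectorField (I := 𝓡 n) (G := G) U
    exact h.of_le minSmoothness_of_isRCLikeNormedField.ge
  have hX1 : mulInvariantVectorField X (1 : G) ≠ 0 := by
    have hid : ∀ f : G → G, f = id →
        (mfderiv (𝓡 n) (𝓡 n) f 1 : EuclideanSpace ℝ (Fin n) →L[ℝ] EuclideanSpace ℝ (Fin n)) X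
          = X := by
      rintro _ rfl
      exact congrArg (fun T => T X) (mfderiv_id (I := 𝓡 n))
    exact fun h0 => hX ((hid _ (funext one_mul)).symm.trans h0)
  have h := mvfderiv_mlieBracket_of_ne_zero (hinvs X) (hinvs Y) (hinvs X) (hsm ℓ)
    (by rw [hinv]; exact hsm _) (by rw [hinv]; exact hsm _) hX1
  rw [hinv, hinv, mvfderiv_clm_comp _ (hΦ 1), mvfderiv_clm_comp _ (hΦ 1),
    mvfderiv_clm_comp _ (hΦ 1), mvfderiv_repCLM_mulInvariant hρ,
    mvfderiv_repCLM_mulInvariant hρ, repCLM_one, one_mul, one_mul] at h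
  rw [map_sub]
  exact h

end Representation

/-! ### The adjoint action and logarithmic derivatives -/

section Adjoint

open VectorField

variable {n : ℕ} {G : Type*} [Group G] [TopologicalSpace G]
  [ChartedSpace (EuclideanSpace ℝ (Fin n)) G] 
  {V : Type*} [NormedAddCommGroup V] [InnerProductSpace ℂ V]
  {E : Type*} [NormedAddCommGroup E] [NormedSpace ℝ E]
  {H : Type*} [TopologicalSpace H] {I : ModelWithCorners ℝ E H}
  {M : Type*} [TopologicalSpace M] [ChartedSpace H M]

/-- The adjoint action of a fixed group element, as a continuous linear map. -/
noncomputable def adjointCLM (g : G) : LG (n := n) G →L[ℝ] LG (n := n) G :=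
  mfderiv (M := G) (M' := G) (𝓡 n) (𝓡 n) (fun a => g * a * g⁻¹) 1

/-- The logarithmic derivative of `W`, as a continuous linear map. -/
noncomputable def leftLogDerivCLM (I : ModelWithCorners ℝ E H) (W : M → G) (x : M) :
    TangentSpace I x →L[ℝ] LG (n := n) G :=
  mfderiv I (𝓡 n) (fun y => (W x)⁻¹ * W y) x

/-- The differential of a map at a point which it sends to `1`. -/
noncomputable def derivToOne (I : ModelWithCorners ℝ E H) (f : M → G) (x : M) :
    TangentSpace I x →L[ℝ] LG (n := n) G :=
  mfderiv I (𝓡 n) f x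

theorem mfderiv_apply_of_eq_id {φ : G → G} (hφ : φ = id) (a : G) (w : LG (n := n) G) :
    (show LG (n := n) G from (mfderiv (𝓡 n) (𝓡 n) φ a :
      EuclideanSpace ℝ (Fin n) →L[ℝ] EuclideanSpace ℝ (Fin n)) w) = w := by
  subst hφ
  exact congrArg (fun T => T w) (mfderiv_id (I := 𝓡 n) (x := a))

variable [LieGroup (𝓡 n) ∞ G]

/-- The product rule at a point where both factors take the value `1`. -/
theorem derivToOne_mul {f g : M → G} {x : M} (hf : MDifferentiableAt I (𝓡 n) f x)
    (hg : MDifferentiableAt I (𝓡 n) g x) (hf1 : f x = 1) (hg1 : g x = 1) :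
    derivToOne (n := n) I (fun y => f y * g y) x = derivToOne I f x + derivToOne I g x := by
  ext1 v
  have hmul : MDifferentiableAt ((𝓡 n).prod (𝓡 n)) (𝓡 n) (fun p : G × G => p.1 * p.2)
      (f x, g x) := (contMDiff_mul (𝓡 n) ∞).mdifferentiableAt (by simp)
  have h1 := mfderiv_comp_apply x (g := fun p : G × G => p.1 * p.2) hmul (hf.prodMk hg) v
  refine Eq.trans h1 ((mfderiv_prod_eq_add_apply hmul).trans ?_)
  have h2 := mfderiv_prodMk hf hg
  refine congrArg₂ (fun a b : LG (n := n) G => a + b) ?_ ?_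
  · refine Eq.trans ?_ (mfderiv_apply_of_eq_id (φ := fun z => z * g x) (by funext z; simp [hg1])
      (f x) (derivToOne I f x v))
    exact congrArg (fun T : E →L[ℝ] EuclideanSpace ℝ (Fin n) × EuclideanSpace ℝ (Fin n) =>
      mfderiv (𝓡 n) (𝓡 n) (fun z => z * g x) (f x) (T v).1) h2
  · refine Eq.trans ?_ (mfderiv_apply_of_eq_id (φ := fun z => f x * z) (by funext z; simp [hf1])
      (g x) (derivToOne I g x v))
    exact congrArg (fun T : E →L[ℝ] EuclideanSpace ℝ (Fin n) × EuclideanSpace ℝ (Fin n) =>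
      mfderiv (𝓡 n) (𝓡 n) (fun z => f x * z) (g x) (T v).2) h2

theorem mdifferentiableAt_conj (g a : G) :
    MDifferentiableAt (𝓡 n) (𝓡 n) (fun a => g * a * g⁻¹) a :=
  ((contMDiff_mul_right (I := 𝓡 n) (n := ∞) (a := g⁻¹)).comp
    (contMDiff_mul_left (I := 𝓡 n) (n := ∞) (a := g))).mdifferentiableAt (by simp)

theorem derivToOne_conj {f : M → G} {x : M} (hf : MDifferentiableAt I (𝓡 n) f x)
    (hf1 : f x = 1) (g : G) (v : TangentSpace I x) :
    derivToOne (n := n) I (fun y => g * f y * g⁻¹) x v = adjointMap g (derivToOne I f x v) :=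
  mfderiv_comp_apply_of_eq x (g := fun a => g * a * g⁻¹) (mdifferentiableAt_conj g 1) hf hf1 v

theorem adjointMap_mul (g g' : G) (X : LG (n := n) G) :
    adjointMap (g * g') X = adjointMap g (adjointMap g' X) := by
  have h := derivToOne_conj (I := 𝓡 n) (mdifferentiableAt_conj g' 1) (by simp) g X
  refine Eq.trans ?_ h
  have e : (fun y => g * (g' * y * g'⁻¹) * g⁻¹) = fun y => g * g' * y * (g * g')⁻¹ := by
    funext y; group
  rw [e]; rfl

omit [LieGroup (𝓡 n) ∞ G] in
theorem adjointMap_one (X : LG (n := n) G) : adjointMap 1 X = X :=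
  mfderiv_apply_of_eq_id (by funext z; simp) 1 X

theorem mdifferentiableAt_leftLog {W : M → G} {x : M} (hW : MDifferentiableAt I (𝓡 n) W x)
    (a : G) : MDifferentiableAt I (𝓡 n) (fun y => a * W y) x :=
  MDifferentiableAt.comp x (g := fun z => a * z) (mdifferentiableAt_leftMul _ _) hW

theorem adjointMap_leftLogDeriv_add_inv {W : M → G} {x : M}
    (hW : MDifferentiableAt I (𝓡 n) W x) (v : TangentSpace I x) :
    adjointMap (W x) (leftLogDeriv (n := n) I W x v) +
      leftLogDeriv I (fun y => (W y)⁻¹) x v = 0 := by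
  have hu := mdifferentiableAt_leftLog hW (W x)⁻¹
  have hWi : MDifferentiableAt I (𝓡 n) (fun y => (W y)⁻¹) x :=
    MDifferentiableAt.comp x (g := fun z : G => z⁻¹)
      ((contMDiff_inv (𝓡 n) ∞).mdifferentiableAt (by simp)) hW
  have hf : MDifferentiableAt I (𝓡 n) (fun y => W x * ((W x)⁻¹ * W y) * (W x)⁻¹) x :=
    MDifferentiableAt.comp x (mdifferentiableAt_conj (W x) _) hu
  have hg := mdifferentiableAt_leftLog hWi (W x)
  have h := derivToOne_mul hf hg (by simp) (by simp)
  have e : (fun y => W x * ((W x)⁻¹ * W y) * (W x)⁻¹ * (W x * (W y)⁻¹)) = fun _ => 1 := by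
    funext y; group
  rw [e] at h
  have h0 : derivToOne (n := n) I (fun _ : M => (1 : G)) x = 0 := mfderiv_const
  have h1 := derivToOne_conj hu (by simp) (W x) v
  have h2 := congrArg (fun T => T v) (h0.symm.trans h)
  refine Eq.trans ?_ h2.symm
  refine congrArg₂ (fun a b : LG (n := n) G => a + b) h1.symm ?_
  change leftLogDeriv I (fun y => (W y)⁻¹) x v = derivToOne I (fun y => (W x) * (W y)⁻¹) x v
  have e2 : (fun y => (W x) * (W y)⁻¹) = (fun y => ((W x)⁻¹)⁻¹ * (W y)⁻¹) := by simp
  rw [e2]; rfl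

theorem derivedRep_adjointMap {ρ : G →* (V ≃ₗᵢ[ℂ] V)} (hρ : SmoothRep (n := n) ρ)
    (g : G) (X : LG (n := n) G) :
    derivedRep ρ (adjointMap g X) = repCLM ρ g * derivedRep ρ X * repCLM ρ g⁻¹ := by
  have hΦ : ∀ g, MDifferentiableAt (𝓡 n) 𝓘(ℝ, V →L[ℂ] V) (repCLM ρ) g := fun g =>
    (hρ g).mdifferentiableAt (by simp)
  have h1 := mfderiv_comp_apply_of_eq (I := 𝓡 n) (I' := 𝓡 n) (I'' := 𝓘(ℝ, V →L[ℂ] V))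
    (x := (1 : G)) (y := 1)
    (f := fun y => g * y * g⁻¹) (g := repCLM ρ) (hΦ _) (mdifferentiableAt_conj _ _) (by simp) X
  refine Eq.trans h1.symm ?_
  have e : repCLM ρ ∘ (fun y => g * y * g⁻¹) = fun y =>
      ((ContinuousLinearMap.mul ℝ (V →L[ℂ] V)).flip (repCLM ρ g⁻¹)).comp
        (ContinuousLinearMap.mul ℝ (V →L[ℂ] V) (repCLM ρ g)) (repCLM ρ y) := by
    funext y
    change repCLM ρ (g * y * g⁻¹) = _
    rw [repCLM_mul, repCLM_mul]; rfl
  rw [e]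
  exact mvfderiv_clm_comp _ (hΦ 1) X

/-- `W⁻¹ dW` is a smooth one-form. -/
theorem contMDiff_leftLogDeriv [IsManifold I ∞ M] {W : M → G} (hW : ContMDiff I (𝓡 n) ∞ W)
    {X : (x : M) → TangentSpace I x}
    (hX : ContMDiff I I.tangent ∞ (fun x => (⟨x, X x⟩ : TangentBundle I M))) :
    ContMDiff (M' := EuclideanSpace ℝ (Fin n)) I 𝓘(ℝ, EuclideanSpace ℝ (Fin n)) ∞
      (fun x => leftLogDeriv (n := n) I W x (X x)) := by
  have hWd : ∀ x, MDifferentiableAt I (𝓡 n) W x := fun x => (hW x).mdifferentiableAt (by simp)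
  let F₁ : M → TangentBundle (𝓡 n) G × TangentBundle (𝓡 n) G := fun x =>
    (⟨(W x)⁻¹, 0⟩, tangentMap I (𝓡 n) W ⟨x, X x⟩)
  have S₁ : ContMDiff I ((𝓡 n).tangent.prod (𝓡 n).tangent) ∞ F₁ := by
    refine ContMDiff.prodMk ?_ ((hW.contMDiff_tangentMap (m := ∞) le_rfl).comp hX)
    exact (Bundle.contMDiff_zeroSection ℝ (TangentSpace (𝓡 n) : G → Type _)).comp
      ((contMDiff_inv (𝓡 n) ∞).comp hW)
  have S₃ : ContMDiff ((𝓡 n).prod (𝓡 n)).tangent (𝓡 n).tangent ∞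
      (tangentMap ((𝓡 n).prod (𝓡 n)) (𝓡 n) (fun p : G × G => p.1 * p.2)) :=
    (contMDiff_mul (𝓡 n) ∞).contMDiff_tangentMap (m := ∞) le_rfl
  have S := (S₃.comp (contMDiff_equivTangentBundleProd_symm (I := 𝓡 n) (M := G) (I' := 𝓡 n)
    (M' := G) (n := ∞))).comp S₁
  have hS : ContMDiff I (𝓡 n).tangent ∞
      (fun x => (⟨1, leftLogDeriv (n := n) I W x (X x)⟩ : TangentBundle (𝓡 n) G)) := by
    have htot : ∀ (a b : G) (u : EuclideanSpace ℝ (Fin n)), a = b →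
        (⟨a, u⟩ : TangentBundle (𝓡 n) G) = ⟨b, u⟩ := by
      rintro a _ u rfl; rfl
    have e : (fun x => (⟨1, leftLogDeriv (n := n) I W x (X x)⟩ : TangentBundle (𝓡 n) G)) =
        ((tangentMap ((𝓡 n).prod (𝓡 n)) (𝓡 n) fun p : G × G => p.1 * p.2) ∘
          (equivTangentBundleProd (𝓡 n) G (𝓡 n) G).symm) ∘ F₁ := by
      funext x
      refine (htot _ _ _ (inv_mul_cancel (W x)).symm).trans ?_
      have hmul : MDifferentiableAt ((𝓡 n).prod (𝓡 n)) (𝓡 n) (fun p : G × G => p.1 * p.2)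
          ((W x)⁻¹, W x) := (contMDiff_mul (𝓡 n) ∞).mdifferentiableAt (by simp)
      refine congrArg (fun u : EuclideanSpace ℝ (Fin n) =>
        (⟨(W x)⁻¹ * W x, u⟩ : TangentBundle (𝓡 n) G)) ?_
      refine Eq.trans ?_ (mfderiv_prod_eq_add_apply
        (v := (((0 : EuclideanSpace ℝ (Fin n)), mfderiv I (𝓡 n) W x (X x)) :
          EuclideanSpace ℝ (Fin n) × EuclideanSpace ℝ (Fin n))) hmul).symm
      have h1 := mfderiv_comp_apply x (mdifferentiableAt_leftMul (n := n) (W x)⁻¹ (W x)) (hWd x)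
        (X x)
      refine Eq.trans h1 ?_
      refine ((zero_add _).symm.trans ?_)
      refine congrArg (fun a : EuclideanSpace ℝ (Fin n) => a +
        (show EuclideanSpace ℝ (Fin n) from
          mfderiv (𝓡 n) (𝓡 n) (fun z => (W x)⁻¹ * z) (W x) (mfderiv I (𝓡 n) W x (X x)))) ?_
      exact (map_zero (mfderiv (𝓡 n) (𝓡 n) (fun z => z * W x) (W x)⁻¹)).symm
    rw [e]
    exact S
  intro x
  have h2 := ((Bundle.contMDiffAt_totalSpace).1 (hS x)).2
  refine h2.congr_of_eventuallyEq (Filter.Eventually.of_forall fun y => ?_)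
  exact (tangentCoordChange_self (I := 𝓡 n) (x := (1 : G)) (z := 1) (by simp)).symm

end Adjoint

/-! ### Quaternions acting on spinors -/

section SpinorAlgebra

open scoped Quaternion

/-- The imaginary units of the quaternions. -/
def imUnit : Fin 3 → ℍ[ℝ] := ![⟨0, 1, 0, 0⟩, ⟨0, 0, 1, 0⟩, ⟨0, 0, 0, 1⟩]

@[simp] theorem imUnit_re (k : Fin 3) : (imUnit k).re = 0 := by fin_cases k <;> rfl

@[simp] theorem imUnit_imI (k : Fin 3) : (imUnit k).imI = if k = 0 then 1 else 0 := by
  fin_cases k <;> rfl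

@[simp] theorem imUnit_imJ (k : Fin 3) : (imUnit k).imJ = if k = 1 then 1 else 0 := by
  fin_cases k <;> rfl

@[simp] theorem imUnit_imK (k : Fin 3) : (imUnit k).imK = if k = 2 then 1 else 0 := by
  fin_cases k <;> rfl

theorem eq_re_add_imUnit (q : ℍ[ℝ]) :
    q = q.re • 1 + q.imI • imUnit 0 + q.imJ • imUnit 1 + q.imK • imUnit 2 := by
  ext <;> simp

theorem star_eq_re_sub_imUnit (q : ℍ[ℝ]) :
    star q = q.re • 1 - q.imI • imUnit 0 - q.imJ • imUnit 1 - q.imK • imUnit 2 := by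
  ext <;> simp

/-- The Clifford matrices satisfy the relations of the imaginary quaternion units. -/
def cliffordBasis : QuaternionAlgebra.Basis (Matrix (Fin 2) (Fin 2) ℂ) (-1 : ℝ) 0 (-1) where
  i := cliffordGamma 0
  j := cliffordGamma 1
  k := cliffordGamma 2
  i_mul_i := by
    ext a b; fin_cases a <;> fin_cases b <;> simp [cliffordGamma, Matrix.mul_apply]
  j_mul_j := by
    ext a b; fin_cases a <;> fin_cases b <;> simp [cliffordGamma, Matrix.mul_apply]
  i_mul_j := by
    ext a b; fin_cases a <;> fin_cases b <;> simp [cliffordGamma, Matrix.mul_apply]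
  j_mul_i := by
    ext a b; fin_cases a <;> fin_cases b <;> simp [cliffordGamma, Matrix.mul_apply]

/-- The Clifford action of quaternions on `ℂ²`. -/
noncomputable def quatMatrix : ℍ[ℝ] →ₐ[ℝ] Matrix (Fin 2) (Fin 2) ℂ := cliffordBasis.liftHom

theorem quatMatrix_imUnit (k : Fin 3) : quatMatrix (imUnit k) = cliffordGamma k := by
  change cliffordBasis.lift (imUnit k) = _
  fin_cases k <;> simp [imUnit, QuaternionAlgebra.Basis.lift, cliffordBasis]

variable {V : Type*} [NormedAddCommGroup V] [InnerProductSpace ℂ V]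

@[simp] theorem spinMul_apply (M : Matrix (Fin 2) (Fin 2) ℂ) (s : Spinor V) (a : Fin 2) :
    spinMul M s a = ∑ b, M a b • s b := rfl

theorem spinMul_mul (M N : Matrix (Fin 2) (Fin 2) ℂ) (s : Spinor V) :
    spinMul (M * N) s = spinMul M (spinMul N s) := by
  ext a
  simp only [spinMul_apply, Matrix.mul_apply, Finset.sum_smul, Finset.smul_sum, smul_smul]
  exact Finset.sum_comm

variable [FiniteDimensional ℂ V]

/-- The Clifford action of quaternions on spinors, as a continuous bilinear map. -/
noncomputable def quatAct : ℍ[ℝ] →L[ℝ] Spinor V →L[ℝ] Spinor V :=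
  LinearMap.toContinuousLinearMap
    ((LinearMap.toContinuousLinearMap : (Spinor V →ₗ[ℝ] Spinor V) ≃ₗ[ℝ] _).toLinearMap ∘ₗ
      LinearMap.mk₂ ℝ (fun (q : ℍ[ℝ]) (s : Spinor V) => spinMul (quatMatrix q) s)
        (fun q q' s => by ext a; simp [add_smul]; abel)
        (fun c q s => by ext a; simp [← smul_smul, smul_add])
        (fun q s t => by ext a; simp [smul_add]; abel)
        (fun c q s => by ext a; simp [smul_comm _ c]))

theorem quatAct_apply (q : ℍ[ℝ]) (s : Spinor V) : quatAct q s = spinMul (quatMatrix q) s := rfl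

theorem quatAct_mul (q q' : ℍ[ℝ]) (s : Spinor V) :
    quatAct (q * q') s = quatAct q (quatAct q' s) := by
  rw [quatAct_apply, map_mul, spinMul_mul]; rfl

theorem quatAct_one (s : Spinor V) : quatAct 1 s = s := by
  ext a; simp [quatAct_apply, Matrix.one_apply]

theorem quatAct_imUnit (k : Fin 3) (s : Spinor V) :
    quatAct (imUnit k) s = spinMul (cliffordGamma k) s := by
  rw [quatAct_apply, quatMatrix_imUnit]

/-- Operators on `V` acting on the second factor of `ℂ² ⊗ V`. -/
noncomputable def opAct : (V →L[ℂ] V) →L[ℝ] Spinor V →L[ℝ] Spinor V :=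
  LinearMap.toContinuousLinearMap
    ((LinearMap.toContinuousLinearMap : (Spinor V →ₗ[ℝ] Spinor V) ≃ₗ[ℝ] _).toLinearMap ∘ₗ
      LinearMap.mk₂ ℝ (fun (T : V →L[ℂ] V) (s : Spinor V) => WithLp.toLp 2 fun a => T (s a))
        (fun q q' s => by ext a; simp)
        (fun c q s => by ext a; simp)
        (fun q s t => by ext a; simp)
        (fun c q s => by ext a; simp))

@[simp] theorem opAct_apply (T : V →L[ℂ] V) (s : Spinor V) (a : Fin 2) :
    opAct T s a = T (s a) := rfl

theorem opAct_mul (S T : V →L[ℂ] V) (s : Spinor V) :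
    opAct (S * T) s = opAct S (opAct T s) := rfl

theorem opAct_one (s : Spinor V) : opAct 1 s = s := rfl

theorem opAct_quatAct (T : V →L[ℂ] V) (q : ℍ[ℝ]) (s : Spinor V) :
    opAct T (quatAct q s) = quatAct q (opAct T s) := by
  ext a; simp [quatAct_apply]

theorem quatAct_norm (q : ℍ[ℝ]) (s : Spinor V) : ‖quatAct q s‖ = ‖q‖ * ‖s‖ := by
  have hk : ∀ (k : Fin 3) (s t : Spinor V),
      inner ℂ (quatAct (imUnit k) s) t = -inner ℂ s (quatAct (imUnit k) t) := by
    intro k s t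
    simp only [quatAct_imUnit]
    fin_cases k <;> simp [PiLp.inner_apply, cliffordGamma, inner_smul_left, inner_smul_right]
    ring
  have hq : ∀ s t : Spinor V, inner ℂ (quatAct q s) t = inner ℂ s (quatAct (star q) t) := by
    intro s t
    rw [star_eq_re_sub_imUnit]
    nth_rw 1 [eq_re_add_imUnit q]
    simp only [map_add, map_sub, map_smul, _root_.add_apply,
      _root_.sub_apply, _root_.smul_apply, inner_add_left,
      inner_sub_right, quatAct_one, ← Complex.coe_smul, inner_smul_left, inner_smul_right, hk,
      Complex.conj_ofReal]
    ring
  have h2 : ‖quatAct q s‖ ^ 2 = (‖q‖ * ‖s‖) ^ 2 := by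
    have h := hq s (quatAct q s)
    have hc : ∀ r : ℝ, (r : ℍ[ℝ]) = r • 1 := fun r => by ext <;> simp
    rw [← quatAct_mul, Quaternion.star_mul_self, Quaternion.normSq_eq_norm_mul_self,
      inner_self_eq_norm_sq_to_K, hc,
      map_smul, _root_.smul_apply, quatAct_one, ← Complex.coe_smul, inner_smul_right,
      inner_self_eq_norm_sq_to_K] at h
    rw [mul_pow, sq ‖q‖]
    refine Complex.ofReal_injective ?_
    push_cast
    simpa using h
  exact (sq_eq_sq₀ (norm_nonneg _) (by positivity)).1 h2

/-- The antiunitary structure `(s₀, s₁) ↦ (-K s₁, K s₀)` on `ℂ² ⊗ V`. -/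
noncomputable def spinConj (K : V ≃ₗᵢ⋆[ℂ] V) : Spinor V ≃ₗᵢ⋆[ℂ] Spinor V where
  toFun s := WithLp.toLp 2 ![-K (s 1), K (s 0)]
  invFun s := WithLp.toLp 2 ![K.symm (s 1), -K.symm (s 0)]
  map_add' s t := by ext a; fin_cases a <;> simp [add_comm]
  map_smul' c s := by
    have hK : ∀ v, K (c • v) = (starRingEnd ℂ) c • K v := map_smulₛₗ K c
    ext a; fin_cases a <;> simp [hK]
  left_inv s := by ext a; fin_cases a <;> simp
  right_inv s := by ext a; fin_cases a <;> simp
  norm_map' s := by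
    simp [PiLp.norm_eq_of_L2, add_comm]

theorem spinConj_quatAct (K : V ≃ₗᵢ⋆[ℂ] V) (q : ℍ[ℝ]) (s : Spinor V) :
    spinConj K (quatAct q s) = quatAct q (spinConj K s) := by
  have hk : ∀ (k : Fin 3) (s : Spinor V),
      spinConj K (quatAct (imUnit k) s) = quatAct (imUnit k) (spinConj K s) := by
    intro k s
    have hK : ∀ v, K (Complex.I • v) = -(Complex.I • K v) := fun v => by
      rw [map_smulₛₗ, Complex.conj_I, neg_smul]
    simp only [quatAct_imUnit]
    ext a
    fin_cases k <;> fin_cases a <;> simp [spinConj, cliffordGamma, hK]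
  have hr : ∀ (c : ℝ) (s : Spinor V), spinConj K (c • s) = c • spinConj K s := by
    intro c s
    rw [← Complex.coe_smul, map_smulₛₗ, Complex.conj_ofReal, Complex.coe_smul]
  rw [eq_re_add_imUnit q]
  simp only [map_add, map_smul, _root_.add_apply,
    _root_.smul_apply, quatAct_one, hk, hr]

theorem spinConj_opAct (K : V ≃ₗᵢ⋆[ℂ] V) {S T : V →L[ℂ] V} (hST : ∀ v, K (S v) = T (K v))
    (s : Spinor V) : spinConj K (opAct S s) = opAct T (spinConj K s) := by
  ext a; fin_cases a <;> simp [spinConj, hST]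

/-- `spinConj K` as a continuous real linear map. -/
noncomputable def spinConjCLM (K : V ≃ₗᵢ⋆[ℂ] V) : Spinor V →L[ℝ] Spinor V :=
  LinearMap.toContinuousLinearMap
    { toFun := spinConj K
      map_add' := map_add _
      map_smul' := fun c s => by
        change spinConj K (c • s) = c • spinConj K s
        rw [← Complex.coe_smul, map_smulₛₗ, Complex.conj_ofReal, Complex.coe_smul] }

theorem spinConjCLM_apply (K : V ≃ₗᵢ⋆[ℂ] V) (s : Spinor V) : spinConjCLM K s = spinConj K s := rfl

end SpinorAlgebra

/-! ### Gauge and CP covariance of the Dirac operator -/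

section DiracOperator

open scoped Quaternion

variable {n : ℕ} {G : Type*} [TopologicalSpace G] [ChartedSpace (EuclideanSpace ℝ (Fin n)) G]
  [Group G] {V : Type*} [NormedAddCommGroup V] [InnerProductSpace ℂ V] [FiniteDimensional ℂ V]

/-- The spin connection `(1/4) ∑ i j, ω k i j γ i γ j`, as a quaternion valued function. -/
noncomputable def spinConnection (h : S3Metric) (E : Fin 3 → VField) (k : Fin 3) (x : S3) : ℍ[ℝ] :=
  (1 / 4 : ℝ) • ∑ i, ∑ j, leviCivitaCoeff h E k i j x • (imUnit i * imUnit j)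

theorem diracOp_apply (h : S3Metric) (E : Fin 3 → VField) (ρ : G →* (V ≃ₗᵢ[ℂ] V))
    (A : GaugePotential (n := n) G) (ψ : SpinorField V) (x : S3) :
    diracOp h E ρ A ψ x = ∑ k, quatAct (imUnit k) (mvfderiv (𝓡 3) ψ x (E k x) +
      quatAct (spinConnection h E k x) (ψ x) + opAct (derivedRep ρ (A x (E k x))) (ψ x)) := by
  refine Finset.sum_congr rfl fun k _ => ?_
  rw [quatAct_imUnit]
  congr 1
  refine congrArg₂ (fun a b : Spinor V => a + b) (congrArg₂ (fun a b : Spinor V => a + b) rfl ?_)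
    rfl
  simp only [spinConnection, map_smul, map_sum, _root_.smul_apply, _root_.sum_apply]
  refine congrArg _ (Finset.sum_congr rfl fun i _ => Finset.sum_congr rfl fun j _ => ?_)
  rw [quatAct_apply, map_mul, quatMatrix_imUnit, quatMatrix_imUnit]

omit [FiniteDimensional ℂ V] in
theorem derivedRepHom_apply (ρ : G →* (V ≃ₗᵢ[ℂ] V)) (X : LG (n := n) G) :
    derivedRepHom ρ X = derivedRep ρ X := rfl

variable [LieGroup (𝓡 n) ∞ G]

/-- Gauge covariance of the Dirac operator. -/
theorem diracOp_gauge (h : S3Metric) (E : Fin 3 → VField) {ρ : G →* (V ≃ₗᵢ[ℂ] V)}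
    (hρ : SmoothRep (n := n) ρ) {A B : GaugePotential (n := n) G} {W : S3 → G}
    (hW : ContMDiff (𝓡 3) (𝓡 n) ∞ W)
    (hAB : ∀ (x : S3) (v : TangentSpace (𝓡 3) x),
      B x v = adjointMap (W x)⁻¹ (A x v) + pureGauge W x v)
    {χ : SpinorField V} (hχ : χ.Smooth) :
    diracOp h E ρ A (fun x => opAct (repCLM ρ (W x)) (χ x)) =
      fun x => opAct (repCLM ρ (W x)) (diracOp h E ρ B χ x) := by
  funext x
  have hWx : MDifferentiableAt (𝓡 3) (𝓡 n) W x := (hW x).mdifferentiableAt (by simp)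
  have hΦW : MDifferentiableAt (𝓡 3) 𝓘(ℝ, V →L[ℂ] V) (fun y => repCLM ρ (W y)) x :=
    (ContMDiff.comp hρ hW x).mdifferentiableAt (by simp)
  have hχx : MDifferentiableAt (𝓡 3) 𝓘(ℝ, Spinor V) χ x := (hχ x).mdifferentiableAt (by simp)
  rw [diracOp_apply, diracOp_apply, map_sum]
  refine Finset.sum_congr rfl fun k _ => ?_
  rw [opAct_quatAct]
  congr 1
  have h1 := mvfderiv_bilin opAct hΦW hχx (E k x)
  have h2 : derivedRep ρ (B x (E k x)) = repCLM ρ (W x)⁻¹ * derivedRep ρ (A x (E k x)) *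
      repCLM ρ (W x) + derivedRep ρ (leftLogDeriv (n := n) (𝓡 3) W x (E k x)) := by
    rw [hAB]
    refine (map_add (derivedRepHom ρ) _ _).trans ?_
    refine congrArg₂ (fun a b : V →L[ℂ] V => a + b) ?_ rfl
    have := derivedRep_adjointMap hρ (W x)⁻¹ (A x (E k x))
    rwa [inv_inv] at this
  rw [h1, mvfderiv_repCLM_comp hρ hWx, h2, map_add, map_add, map_add, ← opAct_quatAct,
    _root_.add_apply, map_add, ← opAct_mul, ← opAct_mul, ← opAct_mul, ← mul_assoc, ← mul_assoc,
    ← repCLM_mul, mul_inv_cancel, repCLM_one, one_mul]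
  abel

theorem frame_expansion {h : S3Metric} {E : Fin 3 → VField} (hE : IsOrthonormalFrame h E)
    (x : S3) (v : TangentSpace (𝓡 3) x) : v = ∑ j, h.inner x (E j x) v • E j x := by
  have hin : ∀ (c : Fin 3 → ℝ) (j : Fin 3), h.inner x (E j x) (∑ i, c i • E i x) = c j := by
    intro c j
    rw [map_sum]
    simp [hE.orthonormal]
  have hli : LinearIndependent ℝ (fun j => E j x) := by
    rw [Fintype.linearIndependent_iff]
    intro c hc j
    rw [← hin c j, hc, map_zero]
  have hsp : Submodule.span ℝ (Set.range fun j => E j x) = ⊤ :=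
    hli.span_eq_top_of_card_eq_finrank (by
      change _ = Module.finrank ℝ (EuclideanSpace ℝ (Fin 3)); simp)
  obtain ⟨c, hc⟩ := (Submodule.mem_span_range_iff_exists_fun ℝ).1
    (hsp ▸ Submodule.mem_top : v ∈ Submodule.span ℝ (Set.range fun j => E j x))
  rw [← hc]
  simp only [hin]

theorem cpTransform_apply (C : LG (n := n) G ≃ₗ⁅ℝ⁆ LG (n := n) G) (p : S3 → S3)
    (A : GaugePotential (n := n) G) (x : S3) (v : TangentSpace (𝓡 3) x) :
    cpTransform C p A x v = C (A (p x) (mfderiv (𝓡 3) (𝓡 3) p x v)) := rfl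

omit [FiniteDimensional ℂ V] in
theorem cpTransform_sum (C : LG (n := n) G ≃ₗ⁅ℝ⁆ LG (n := n) G) (p : S3 → S3)
    (A : GaugePotential (n := n) G) (x : S3) (v : TangentSpace (𝓡 3) x) (r : Fin 3 → ℝ)
    (w : Fin 3 → TangentSpace (𝓡 3) (p x)) (hv : mfderiv (𝓡 3) (𝓡 3) p x v = ∑ c, r c • w c)
    {σ : LG (n := n) G →ₗ[ℝ] (V →L[ℂ] V)} :
    σ (cpTransform C p A x v) = ∑ c, r c • σ (C (A (p x) (w c))) := by
  have e := congrArg (fun z => (σ ∘ₗ C.toLinearEquiv.toLinearMap ∘ₗ A (p x)) z) hv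
  refine Eq.trans e ?_
  rw [map_sum]
  refine Finset.sum_congr rfl fun c _ => ?_
  rw [map_smul]; rfl

/-- An antiunitary transformation covering a parity transformation intertwines the Dirac operator
with minus the Dirac operator of the CP-transform, provided the quaternion field `q` intertwines
the Clifford multiplications and the spin connections. -/
theorem diracOp_cpTransform {h : S3Metric} {E : Fin 3 → VField} (hE : IsOrthonormalFrame h E)
    (ρ : G →* (V ≃ₗᵢ[ℂ] V)) {p : S3 → S3} (hp : ContMDiff (𝓡 3) (𝓡 3) ∞ p)
    {C : LG (n := n) G ≃ₗ⁅ℝ⁆ LG (n := n) G} {K : V ≃ₗᵢ⋆[ℂ] V}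
    (hK : ∀ X v, K (derivedRep ρ X v) = derivedRep ρ (C X) (K v))
    {q : S3 → ℍ[ℝ]} (hq : ContMDiff (𝓡 3) 𝓘(ℝ, ℍ[ℝ]) ∞ q)
    (hqγ : ∀ x j, ∑ k, frameMatrix h E p x j k • (imUnit k * q x) = -(q x * imUnit j))
    (hqω : ∀ x k, mvfderiv (𝓡 3) q x (E k x) + spinConnection h E k x * q x =
      ∑ c, frameMatrix h E p x c k • (q x * spinConnection h E c (p x)))
    (A : GaugePotential (n := n) G) {ψ : SpinorField V} (hψ : ψ.Smooth) :
    diracOp h E ρ (cpTransform C p A) (fun x => quatAct (q x) (spinConj K (ψ (p x)))) =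
      fun x => -quatAct (q x) (spinConj K (diracOp h E ρ A ψ (p x))) := by
  funext x
  have hqx : MDifferentiableAt (𝓡 3) 𝓘(ℝ, ℍ[ℝ]) q x := (hq x).mdifferentiableAt (by simp)
  have hpx : MDifferentiableAt (𝓡 3) (𝓡 3) p x := (hp x).mdifferentiableAt (by simp)
  have hψp : MDifferentiableAt (𝓡 3) 𝓘(ℝ, Spinor V) ψ (p x) := (hψ _).mdifferentiableAt (by simp)
  have hψx : MDifferentiableAt (𝓡 3) 𝓘(ℝ, Spinor V) (fun y => ψ (p y)) x := hψp.comp x hpx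
  have hJψ : MDifferentiableAt (𝓡 3) 𝓘(ℝ, Spinor V) (fun y => spinConjCLM K (ψ (p y))) x :=
    (spinConjCLM K).differentiableAt.mdifferentiableAt.comp x hψx
  set R := frameMatrix h E p x with hR
  have hdp : ∀ k, mfderiv (𝓡 3) (𝓡 3) p x (E k x) = ∑ c, R c k • E c (p x) := fun k =>
    frame_expansion hE (p x) _
  have hr : ∀ (c : ℝ) (s : Spinor V), spinConj K (c • s) = c • spinConj K s :=
    map_smul (spinConjCLM K)
  -- the covariant derivative of the transformed spinor field
  have hcov : ∀ k, mvfderiv (𝓡 3) (fun y => quatAct (q y) (spinConj K (ψ (p y)))) x (E k x) +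
      quatAct (spinConnection h E k x) (quatAct (q x) (spinConj K (ψ (p x)))) +
      opAct (derivedRep ρ (cpTransform C p A x (E k x))) (quatAct (q x) (spinConj K (ψ (p x)))) =
      ∑ c, R c k • quatAct (q x) (spinConj K (mvfderiv (𝓡 3) ψ (p x) (E c (p x)) +
        quatAct (spinConnection h E c (p x)) (ψ (p x)) +
        opAct (derivedRep ρ (A (p x) (E c (p x)))) (ψ (p x)))) := by
    intro k
    have h1 := mvfderiv_bilin quatAct hqx hJψ (E k x)
    have h2 : mvfderiv (𝓡 3) (fun y => spinConjCLM K (ψ (p y))) x (E k x) =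
        ∑ c, R c k • spinConj K (mvfderiv (𝓡 3) ψ (p x) (E c (p x))) := by
      rw [mvfderiv_clm_comp _ hψx]
      have h3 : mvfderiv (𝓡 3) (fun y => ψ (p y)) x (E k x) =
          mvfderiv (𝓡 3) ψ (p x) (mfderiv (𝓡 3) (𝓡 3) p x (E k x)) :=
        mfderiv_comp_apply x hψp hpx (E k x)
      rw [h3, hdp, map_sum, map_sum]
      refine Finset.sum_congr rfl fun c _ => ?_
      rw [map_smul, map_smul, spinConjCLM_apply]
    have h4 : derivedRep ρ (cpTransform C p A x (E k x)) =
        ∑ c, R c k • derivedRep ρ (C (A (p x) (E c (p x)))) := by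
      simp only [← derivedRepHom_apply]
      exact cpTransform_sum C p A x (E k x) _ _ (hdp k)
    have h6 : quatAct (mvfderiv (𝓡 3) q x (E k x)) (spinConj K (ψ (p x))) +
        quatAct (spinConnection h E k x) (quatAct (q x) (spinConj K (ψ (p x)))) =
        ∑ c, R c k • quatAct (q x)
          (quatAct (spinConnection h E c (p x)) (spinConj K (ψ (p x)))) := by
      rw [← quatAct_mul, ← _root_.add_apply, ← map_add, hqω, map_sum, _root_.sum_apply]
      refine Finset.sum_congr rfl fun c _ => ?_
      rw [map_smul, _root_.smul_apply, quatAct_mul]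
    simp only [spinConjCLM_apply] at h1 h2
    rw [h1, h2, h4, add_assoc, add_assoc]
    have h7 : ∀ a b c d : Spinor V, a + (b + (c + d)) = b + (a + c) + d := fun a b c d => by abel
    refine (h7 _ _ _ _).trans ?_
    rw [h6, map_sum, map_sum, _root_.sum_apply, ← Finset.sum_add_distrib,
      ← Finset.sum_add_distrib]
    refine Finset.sum_congr rfl fun c _ => ?_
    rw [map_smul, map_smul, _root_.smul_apply, opAct_quatAct]
    simp only [map_add, spinConj_quatAct, spinConj_opAct K (hK _), smul_add]
  rw [diracOp_apply, diracOp_apply]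
  simp only [hcov]
  have hγ : ∀ (c : Fin 3) (s : Spinor V),
      ∑ k, R c k • quatAct (imUnit k) (quatAct (q x) s) =
        -quatAct (q x) (quatAct (imUnit c) s) := by
    intro c s
    have := congrArg (fun u => quatAct u s) (hqγ x c)
    simpa only [map_sum, map_smul, map_neg, _root_.sum_apply, _root_.smul_apply, quatAct_mul,
      _root_.neg_apply] using this
  rw [map_sum, map_sum, ← Finset.sum_neg_distrib]
  simp only [map_sum, map_smul]
  rw [Finset.sum_comm]
  refine Finset.sum_congr rfl fun c _ => ?_
  rw [hγ, spinConj_quatAct]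

end DiracOperator

/-! ### Quaternions and rotations -/

section QuaternionFrames

open scoped Quaternion

/-- Three quaternions satisfying the multiplication rules of the imaginary units. -/
structure IsQuatTriple (a : Fin 3 → ℍ[ℝ]) : Prop where
  sq : ∀ i, a i * a i = -1
  mul_zero_one : a 0 * a 1 = a 2
  mul_one_zero : a 1 * a 0 = -a 2

theorem imUnit_isQuatTriple : IsQuatTriple imUnit where
  sq i := by ext <;> fin_cases i <;> simp
  mul_zero_one := by ext <;> simp
  mul_one_zero := by ext <;> simp

theorem IsQuatTriple.mul_zero_two {a : Fin 3 → ℍ[ℝ]} (ha : IsQuatTriple a) :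
    a 0 * a 2 = -a 1 := by
  rw [← ha.mul_zero_one, ← mul_assoc, ha.sq, neg_one_mul]

theorem IsQuatTriple.mul_two_one {a : Fin 3 → ℍ[ℝ]} (ha : IsQuatTriple a) :
    a 2 * a 1 = -a 0 := by
  rw [← ha.mul_zero_one, mul_assoc, ha.sq, mul_neg_one]

theorem IsQuatTriple.mul_one_two {a : Fin 3 → ℍ[ℝ]} (ha : IsQuatTriple a) :
    a 1 * a 2 = a 0 := by
  rw [← neg_neg (a 2), ← ha.mul_one_zero, mul_neg, ← mul_assoc, ha.sq, neg_one_mul, neg_neg]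

theorem IsQuatTriple.mul_two_zero {a : Fin 3 → ℍ[ℝ]} (ha : IsQuatTriple a) :
    a 2 * a 0 = a 1 := by
  rw [← neg_neg (a 2), ← ha.mul_one_zero, neg_mul, mul_assoc, ha.sq, mul_neg_one, neg_neg]

/-- Averaging `M` over the quaternion group makes it intertwine the imaginary units with `a`. -/
noncomputable def quatIntertwiner (a : Fin 3 → ℍ[ℝ]) (M : ℍ[ℝ]) : ℍ[ℝ] :=
  M - ∑ j, a j * M * imUnit j

theorem IsQuatTriple.mul_quatIntertwiner {a : Fin 3 → ℍ[ℝ]} (ha : IsQuatTriple a) (M : ℍ[ℝ])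
    (k : Fin 3) : a k * quatIntertwiner a M = quatIntertwiner a M * imUnit k := by
  have h := imUnit_isQuatTriple
  simp only [quatIntertwiner, Fin.sum_univ_three, mul_sub, sub_mul, mul_add, add_mul]
  fin_cases k <;>
    simp only [Fin.zero_eta, Fin.mk_one, Fin.reduceFinMk, ← mul_assoc, ha.sq, ha.mul_zero_one,
      ha.mul_zero_two, ha.mul_one_zero, ha.mul_one_two, ha.mul_two_one, ha.mul_two_zero] <;>
    simp only [mul_assoc, h.sq, h.mul_zero_one,
      h.mul_zero_two, h.mul_one_zero, h.mul_one_two, h.mul_two_one, h.mul_two_zero, neg_mul,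
      mul_neg, one_mul, mul_one] <;>
    abel

theorem exists_quatIntertwiner_ne_zero (a : Fin 3 → ℍ[ℝ]) : ∃ M, quatIntertwiner a M ≠ 0 := by
  by_contra! hall
  have h1 : ∀ e : ℍ[ℝ], e.re = 0 → e + ∑ k, imUnit k * e * star (imUnit k) = 0 := by
    intro e he
    rw [Fin.sum_univ_three]
    ext <;> simp [he]
  -- the operators `M ↦ quatIntertwiner a M` sum up to `4`
  have h2 : quatIntertwiner a 1 + ∑ k, quatIntertwiner a (imUnit k) * star (imUnit k) =
      (4 : ℝ) • 1 - ∑ j, a j * (imUnit j + ∑ k, imUnit k * imUnit j * star (imUnit k)) := by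
    have hs : ∀ k, imUnit k * star (imUnit k) = 1 := fun k => by
      ext <;> fin_cases k <;> simp
    simp only [quatIntertwiner, sub_mul, Finset.sum_sub_distrib, hs, Finset.sum_mul, mul_add,
      Finset.mul_sum, Finset.sum_add_distrib, mul_one, ← mul_assoc]
    rw [Finset.sum_comm (f := fun k j => a j * imUnit k * imUnit j * star (imUnit k))]
    simp only [Finset.sum_const, Finset.card_univ, Fintype.card_fin]
    have : (4 : ℝ) • (1 : ℍ[ℝ]) = 1 + (3 : ℕ) • (1 : ℍ[ℝ]) := by module
    rw [this]
    abel
  simp only [hall, zero_mul, Finset.sum_const_zero, add_zero, h1 _ (imUnit_re _), mul_zero,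
    sub_zero] at h2
  have h3 := congrArg (fun q : ℍ[ℝ] => q.re) h2
  simp at h3

theorem mem_real_of_commute_imUnit {u : ℍ[ℝ]} (hu : ∀ j, u * imUnit j = imUnit j * u) :
    u = u.re • 1 := by
  have h0 := hu 0
  have h1 := hu 1
  have a0 := congrArg (fun q : ℍ[ℝ] => q.imJ) h0
  have a1 := congrArg (fun q : ℍ[ℝ] => q.imK) h0
  have a2 := congrArg (fun q : ℍ[ℝ] => q.imK) h1
  simp at a0 a1 a2
  ext <;> simp <;> linarith

theorem star_mul_self_of_norm_one {q : ℍ[ℝ]} (hq : ‖q‖ = 1) : star q * q = 1 := by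
  rw [Quaternion.star_mul_self, Quaternion.normSq_eq_norm_mul_self, hq]; simp

theorem self_mul_star_of_norm_one {q : ℍ[ℝ]} (hq : ‖q‖ = 1) : q * star q = 1 := by
  rw [Quaternion.self_mul_star, Quaternion.normSq_eq_norm_mul_self, hq]; simp

/-- Two unit quaternions inducing the same rotation agree up to sign. -/
theorem eq_or_eq_neg_of_intertwine {a : Fin 3 → ℍ[ℝ]} {q q' : ℍ[ℝ]} (hq : ‖q‖ = 1)
    (hq' : ‖q'‖ = 1) (h : ∀ j, a j * q = q * imUnit j) (h' : ∀ j, a j * q' = q' * imUnit j) :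
    q' = q ∨ q' = -q := by
  have hs : ∀ j, star q * a j = imUnit j * star q := by
    intro j
    calc star q * a j = star q * (a j * q) * star q := by
          rw [mul_assoc, mul_assoc, self_mul_star_of_norm_one hq, mul_one]
      _ = imUnit j * star q := by
          rw [h, ← mul_assoc, star_mul_self_of_norm_one hq, one_mul]
  have hu := mem_real_of_commute_imUnit (u := star q * q') fun j => by
    rw [mul_assoc, ← h', ← mul_assoc, hs, mul_assoc]
  set r := (star q * q').re
  have hq'r : q' = r • q := by
    have : q' = q * (star q * q') := by
      rw [← mul_assoc, self_mul_star_of_norm_one hq, one_mul]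
    rw [this, hu, mul_smul_comm, mul_one]
  have hr : |r| = 1 := by
    have := congrArg norm hq'r
    rwa [norm_smul, hq, hq', mul_one, Real.norm_eq_abs, eq_comm] at this
  rcases eq_or_eq_neg_of_abs_eq hr with h1 | h1 <;> rw [h1] at hq'r
  · left; rw [hq'r, one_smul]
  · right; rw [hq'r, neg_smul, one_smul]

/-- The logarithmic derivative of a field of unit quaternions, in terms of the derivatives of the
rotated imaginary units. -/
theorem quat_deriv_eq {q dq : ℍ[ℝ]} {a da : Fin 3 → ℍ[ℝ]} (hq : ‖q‖ = 1)
    (ha : ∀ j, a j * q = q * imUnit j) (hre : (star q * dq).re = 0)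
    (hda : ∀ j, da j * q + a j * dq = dq * imUnit j) :
    dq = -((1 / 4 : ℝ) • ∑ j, da j * a j) * q := by
  set w := star q * dq with hw
  have hdq : dq = q * w := by rw [hw, ← mul_assoc, self_mul_star_of_norm_one hq, one_mul]
  have h1 : ∀ j, da j * a j * q = q * ((w * imUnit j - imUnit j * w) * imUnit j) := by
    intro j
    rw [mul_assoc, ha, ← mul_assoc, eq_sub_of_add_eq (hda j), hdq, ← mul_assoc (a j), ha]
    noncomm_ring
  have h2 : ∑ j, (w * imUnit j - imUnit j * w) * imUnit j = (-4 : ℝ) • w := by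
    rw [Fin.sum_univ_three]
    ext <;> simp [hre] <;> ring
  rw [neg_mul, smul_mul_assoc, Finset.sum_mul, Finset.sum_congr rfl fun j _ => h1 j,
    ← Finset.mul_sum, h2, mul_smul_comm, ← hdq, smul_smul]
  norm_num

/-- The rows of a rotation matrix form a quaternion triple. -/
theorem isQuatTriple_of_rotation {Q : Matrix (Fin 3) (Fin 3) ℝ} (hQ : Q * Q.transpose = 1)
    (hdet : Q.det = 1) : IsQuatTriple fun j => ∑ k, Q j k • imUnit k := by
  have hadj : Q.adjugate = Q.transpose := by
    calc Q.adjugate = Q.adjugate * (Q * Q.transpose) := by rw [hQ, mul_one]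
      _ = Q.transpose := by rw [← mul_assoc, Matrix.adjugate_mul, hdet, one_smul, one_mul]
  have hent := fun i j => congrFun (congrFun hQ i) j
  have hc := fun i => congrFun (congrFun hadj i) 2
  simp only [Matrix.mul_apply, Fin.sum_univ_three, Matrix.transpose_apply] at hent
  rw [Matrix.adjugate_fin_three] at hc
  have c0 := hc 0
  have c1 := hc 1
  have c2 := hc 2
  have e01 := hent 0 1
  simp at c0 c1 c2 e01
  refine ⟨fun i => ?_, ?_, ?_⟩
  · have := hent i i
    simp at this
    simp only [Fin.sum_univ_three]
    ext <;> simp <;> linarith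
  · simp only [Fin.sum_univ_three]
    ext <;> simp <;> linarith
  · simp only [Fin.sum_univ_three]
    ext <;> simp <;> linarith

end QuaternionFrames

/-! ### Continuous choice of signs on the three-sphere -/

section SignLifting

open scoped Topology

variable {Γ : Type*} [Group Γ] [HasDistribNeg Γ]

/-- The subgroup `{1, -1}` of a group with a distributive negation. -/
def signSubgroup (Γ : Type*) [Group Γ] [HasDistribNeg Γ] : Subgroup Γ where
  carrier := {1, -1}
  mul_mem' := by rintro _ _ (rfl | rfl) (rfl | rfl) <;> simp
  one_mem' := by simp
  inv_mem' := by rintro _ (rfl | rfl) <;> simp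

theorem mk_signSubgroup_eq_iff {a b : Γ} :
    (a : Γ ⧸ signSubgroup Γ) = b ↔ b = a ∨ b = -a := by
  rw [QuotientGroup.eq]
  change (a⁻¹ * b = 1 ∨ a⁻¹ * b = -1) ↔ _
  rw [inv_mul_eq_one, inv_mul_eq_iff_eq_mul, mul_neg, mul_one, eq_comm (a := a)]

variable [TopologicalSpace Γ] [IsTopologicalGroup Γ] [T1Space Γ]

/-- A map into a topological group from a simply connected space which is locally continuous up
to sign becomes continuous after a suitable choice of signs. -/
theorem exists_continuous_sign_lift {A : Type*} [TopologicalSpace A] [SimplyConnectedSpace A]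
    [LocallyPathConnectedSpace A] (s : A → Γ)
    (hs : ∀ x, ∃ g : A → Γ, ContinuousAt g x ∧
      ∀ᶠ y in 𝓝 x, s y = g y ∨ s y = -g y) :
    ∃ F : A → Γ, Continuous F ∧ ∀ y, F y = s y ∨ F y = -s y := by
  have hcov := ((signSubgroup Γ).isQuotientCoveringMap
    (Set.toFinite {1, -1}).isDiscrete).isCoveringMap
  let f : C(A, Γ ⧸ signSubgroup Γ) := ⟨fun x => s x, by
    rw [continuous_iff_continuousAt]
    intro x
    obtain ⟨g, hg, hgs⟩ := hs x
    have h1 : ContinuousAt (fun y => (g y : Γ ⧸ signSubgroup Γ)) x :=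
      continuous_quotient_mk'.continuousAt.comp hg
    exact h1.congr (hgs.mono fun y hy => mk_signSubgroup_eq_iff.2 hy)⟩
  obtain ⟨a₀⟩ : Nonempty A := inferInstance
  obtain ⟨F, ⟨-, hF⟩, -⟩ := hcov.existsUnique_continuousMap_lifts f a₀ (s a₀) rfl
  exact ⟨F, F.continuous, fun y => mk_signSubgroup_eq_iff.1 (congrFun hF y).symm⟩

/-- The complement of a point in the three-sphere is contractible. -/
theorem simplyConnectedSpace_compl_singleton (v : S3) :
    SimplyConnectedSpace ({v}ᶜ : Set S3) := by
  have : Fact (Module.finrank ℝ (EuclideanSpace ℝ (Fin (3 + 1))) = 3 + 1) := ⟨by simp⟩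
  have e := (stereographic' 3 v).toHomeomorphSourceTarget
  rw [stereographic'_source, stereographic'_target] at e
  have e2 : ({v}ᶜ : Set S3) ≃ₜ EuclideanSpace ℝ (Fin 3) := e.trans (Homeomorph.Set.univ _)
  have : ContractibleSpace ({v}ᶜ : Set S3) := e2.contractibleSpace
  infer_instance

theorem isPreconnected_compl_pair (v w : S3) : IsPreconnected ({v, w}ᶜ : Set S3) := by
  have : Fact (Module.finrank ℝ (EuclideanSpace ℝ (Fin (3 + 1))) = 3 + 1) := ⟨by simp⟩
  set e := stereographic' 3 v with he
  have hconn : IsPreconnected ({e w}ᶜ : Set (EuclideanSpace ℝ (Fin 3))) := by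
    refine (isConnected_compl_singleton_of_one_lt_rank ?_ _).isPreconnected
    rw [← Module.finrank_eq_rank, finrank_euclideanSpace_fin]
    norm_num
  have hes : e.source = {v}ᶜ := stereographic'_source v
  have het : e.target = univ := stereographic'_target v
  by_cases hwv : w = v
  · subst hwv
    have : ({w, w}ᶜ : Set S3) = e.symm '' univ := by
      rw [pair_eq_singleton, ← hes, ← het, e.symm_image_target_eq_source]
    rw [this]
    exact isPreconnected_univ.image _ (het ▸ e.continuousOn_symm)
  have hw : w ∈ e.source := by rw [hes]; exact hwv
  have : ({v, w}ᶜ : Set S3) = e.symm '' {e w}ᶜ := by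
    ext x
    simp only [mem_compl_iff, mem_insert_iff, mem_singleton_iff, not_or, mem_image]
    constructor
    · rintro ⟨hxv, hxw⟩
      have hx : x ∈ e.source := by rw [hes]; exact hxv
      exact ⟨e x, fun h => hxw (e.injOn hx hw h), e.left_inv hx⟩
    · rintro ⟨y, hy, rfl⟩
      have hyt : y ∈ e.target := by rw [het]; trivial
      have hys := e.map_target hyt
      refine ⟨fun h => ?_, fun h => hy ?_⟩
      · rw [h, hes] at hys; exact hys rfl
      · rw [← h, e.right_inv hyt]
  rw [this]
  exact hconn.image _ (e.continuousOn_symm.mono (by rw [het]; exact subset_univ _))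

/-- The three-sphere analogue of `exists_continuous_sign_lift`: lift on the complements of two
points, and match the signs on their connected intersection. -/
theorem exists_continuous_sign_lift_sphere (s : S3 → Γ)
    (hs : ∀ x, ∃ g : S3 → Γ, ContinuousAt g x ∧
      ∀ᶠ y in 𝓝 x, s y = g y ∨ s y = -g y) :
    ∃ F : S3 → Γ, Continuous F ∧ ∀ y, F y = s y ∨ F y = -s y := by
  classical
  have hpunct : ∀ v : S3, ∃ F : S3 → Γ,
      (∀ x, x ≠ v → ContinuousAt F x) ∧ ∀ y, F y = s y ∨ F y = -s y := by
    intro v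
    have hopen : IsOpen ({v}ᶜ : Set S3) := isOpen_compl_singleton
    have := simplyConnectedSpace_compl_singleton v
    have : LocallyPathConnectedSpace S3 :=
      ChartedSpace.locallyPathConnectedSpace (EuclideanSpace ℝ (Fin 3)) S3
    have := hopen.locallyPathConnectedSpace
    obtain ⟨F, hF, hFs⟩ := exists_continuous_sign_lift (A := ({v}ᶜ : Set S3)) (fun x => s x)
      fun x => by
        obtain ⟨g, hg, hgs⟩ := hs x
        exact ⟨fun y => g y, hg.comp continuous_subtype_val.continuousAt,
          continuous_subtype_val.continuousAt.eventually hgs⟩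
    refine ⟨fun x => if h : x ∈ ({v}ᶜ : Set S3) then F ⟨x, h⟩ else s x, fun x hx => ?_,
      fun y => ?_⟩
    · have hx' : x ∈ ({v}ᶜ : Set S3) := hx
      rw [← hopen.isOpenEmbedding_subtypeVal.continuousAt_iff (x := ⟨x, hx'⟩)]
      refine hF.continuousAt.congr (Filter.Eventually.of_forall fun y => ?_)
      simp only [Function.comp_apply, y.2, dif_pos]
    · by_cases h : y ∈ ({v}ᶜ : Set S3)
      · simp only [h, dif_pos]; exact hFs ⟨y, h⟩
      · simp only [h, dif_neg, not_false_eq_true, true_or]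
  obtain ⟨v, w, hvw⟩ : ∃ v w : S3, v ≠ w := by
    refine ⟨⟨EuclideanSpace.single 0 1, by simp⟩, ⟨EuclideanSpace.single 1 1, by simp⟩, fun h => ?_⟩
    have h2 := congrArg (fun x : S3 => (x : EuclideanSpace ℝ (Fin (3 + 1))) 0) h
    simp at h2
  obtain ⟨F₁, hF₁, hs₁⟩ := hpunct v
  obtain ⟨F₂, hF₂, hs₂⟩ := hpunct w
  have hmaps : MapsTo (fun x => F₁ x * (F₂ x)⁻¹) ({v, w}ᶜ : Set S3) {1, -1} := by
    intro x _
    rcases hs₁ x with h1 | h1 <;> rcases hs₂ x with h2 | h2 <;> simp [h1, h2]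
  have hcont : ContinuousOn (fun x => F₁ x * (F₂ x)⁻¹) ({v, w}ᶜ : Set S3) := by
    intro x hx
    simp only [mem_compl_iff, mem_insert_iff, mem_singleton_iff, not_or] at hx
    exact ((hF₁ x hx.1).mul (hF₂ x hx.2).inv).continuousWithinAt
  obtain ⟨ε, hε, heq⟩ := (isPreconnected_compl_pair v w).eqOn_const_of_mapsTo
    (Set.toFinite {1, -1}).isDiscrete hcont hmaps ⟨1, by simp⟩
  have heq' : ∀ x, x ≠ v → x ≠ w → F₁ x = ε * F₂ x := by
    intro x hv hw
    have : F₁ x * (F₂ x)⁻¹ = ε := heq (by simp [hv, hw])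
    rw [← this, inv_mul_cancel_right]
  refine ⟨fun x => if x = v then ε * F₂ x else F₁ x, ?_, fun y => ?_⟩
  · rw [continuous_iff_continuousAt]
    intro x
    by_cases hx : x = v
    · subst hx
      refine (continuousAt_const.mul (hF₂ x hvw)).congr (f := fun y => ε * F₂ y) ?_
      filter_upwards [isOpen_ne.mem_nhds hvw] with y hy
      split_ifs with h
      · rfl
      · exact (heq' y h hy).symm
    · refine (hF₁ x hx).congr ?_
      filter_upwards [isOpen_ne.mem_nhds hx] with y hy
      rw [if_neg hy]
  · dsimp only
    split_ifs
    · have hε' : ε = 1 ∨ ε = -1 := by simpa using hε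
      rcases hε' with h1 | h1 <;> rcases hs₂ y with h2 | h2 <;> simp [h1, h2]
    · exact hs₁ y

end SignLifting

/-! ### Smooth fields of unit quaternions -/

section BilinearSmoothness

variable {E : Type*} [NormedAddCommGroup E] [NormedSpace ℝ E]
  {H : Type*} [TopologicalSpace H] {I : ModelWithCorners ℝ E H}
  {M : Type*} [TopologicalSpace M] [ChartedSpace H M]
  {F₁ F₂ F₃ : Type*} [NormedAddCommGroup F₁]
  [NormedSpace ℝ F₁] [NormedAddCommGroup F₂] [NormedSpace ℝ F₂] [NormedAddCommGroup F₃]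
  [NormedSpace ℝ F₃]

theorem ContMDiffAt.bilin (B : F₁ →L[ℝ] F₂ →L[ℝ] F₃) {f : M → F₁} {g : M → F₂} {x : M}
    (hf : ContMDiffAt I 𝓘(ℝ, F₁) ∞ f x) (hg : ContMDiffAt I 𝓘(ℝ, F₂) ∞ g x) :
    ContMDiffAt I 𝓘(ℝ, F₃) ∞ (fun y => B (f y) (g y)) x :=
  (B.isBoundedBilinearMap.contDiff.contMDiff _).comp x (hf.prodMk_space hg)

end BilinearSmoothness

section QuaternionField

open scoped Quaternion Topology

variable {a : Fin 3 → S3 → ℍ[ℝ]}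

/-- Locally, averaging a suitable constant quaternion over the quaternion group and normalizing it
gives a lift of a field of rotations to unit quaternions. -/
theorem exists_local_quat_field (ha : ∀ j, ContMDiff (𝓡 3) 𝓘(ℝ, ℍ[ℝ]) ∞ (a j))
    (hq : ∀ x, IsQuatTriple fun j => a j x) (x : S3) :
    ∃ g : S3 → ℍ[ℝ], ContMDiffAt (𝓡 3) 𝓘(ℝ, ℍ[ℝ]) ∞ g x ∧
      ∀ᶠ y in 𝓝 x, ‖g y‖ = 1 ∧ ∀ j, a j y * g y = g y * imUnit j := by
  obtain ⟨M, hM⟩ := exists_quatIntertwiner_ne_zero fun j => a j x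
  let mul := ContinuousLinearMap.mul ℝ ℍ[ℝ]
  have hΛ : ContMDiffAt (𝓡 3) 𝓘(ℝ, ℍ[ℝ]) ∞ (fun y => quatIntertwiner (fun j => a j y) M) x := by
    refine contMDiffAt_const.sub ?_
    refine contMDiffAt_finsetSum fun j _ => ?_
    exact ContMDiffAt.bilin mul (ContMDiffAt.bilin mul (ha j x) contMDiffAt_const)
      contMDiffAt_const
  have hN : ContDiffAt ℝ ∞ (fun z : ℍ[ℝ] => ‖z‖⁻¹ • z) (quatIntertwiner (fun j => a j x) M) :=
    ((contDiffAt_norm ℝ hM).inv (norm_ne_zero_iff.2 hM)).smul contDiffAt_id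
  refine ⟨fun y => ‖quatIntertwiner (fun j => a j y) M‖⁻¹ • quatIntertwiner (fun j => a j y) M,
    hN.contMDiffAt.comp x hΛ, ?_⟩
  filter_upwards [hΛ.continuousAt.eventually_ne hM] with y hy
  refine ⟨?_, fun j => ?_⟩
  · rw [norm_smul, norm_inv, norm_norm, inv_mul_cancel₀ (norm_ne_zero_iff.2 hy)]
  · rw [mul_smul_comm, (hq y).mul_quatIntertwiner, smul_mul_assoc]

/-- A smooth field of rotations on the three-sphere lifts to a smooth field of unit quaternions. -/
theorem exists_quat_field (ha : ∀ j, ContMDiff (𝓡 3) 𝓘(ℝ, ℍ[ℝ]) ∞ (a j))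
    (hq : ∀ x, IsQuatTriple fun j => a j x) :
    ∃ q : S3 → ℍ[ℝ], ContMDiff (𝓡 3) 𝓘(ℝ, ℍ[ℝ]) ∞ q ∧ (∀ x, ‖q x‖ = 1) ∧
      ∀ x j, a j x * q x = q x * imUnit j := by
  classical
  choose g hg hgu using exists_local_quat_field ha hq
  have hs : ∀ x, ‖g x x‖ = 1 ∧ ∀ j, a j x * g x x = g x x * imUnit j := fun x =>
    (hgu x).self_of_nhds
  let s : S3 → Metric.sphere (0 : ℍ[ℝ]) 1 := fun x => ⟨g x x, by simp [(hs x).1]⟩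
  obtain ⟨F, hF, hFs⟩ := exists_continuous_sign_lift_sphere s fun x => by
    refine ⟨fun y => if h : ‖g x y‖ = 1 then ⟨g x y, by simp [h]⟩ else s y, ?_, ?_⟩
    · rw [Topology.IsInducing.subtypeVal.continuousAt_iff]
      refine (hg x).continuousAt.congr ?_
      filter_upwards [hgu x] with y hy
      simp [hy.1]
    · filter_upwards [hgu x] with y hy
      rw [dif_pos hy.1]
      rcases eq_or_eq_neg_of_intertwine hy.1 (hs y).1 hy.2 (hs y).2 with h | h
      · exact Or.inl (Subtype.ext h)
      · exact Or.inr (Subtype.ext h)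
  have hFu : ∀ x, ‖(F x : ℍ[ℝ])‖ = 1 := fun x => by simp
  have hFa : ∀ x j, a j x * (F x : ℍ[ℝ]) = F x * imUnit j := by
    intro x j
    rcases hFs x with h | h
    · rw [h]; exact (hs x).2 j
    · rw [h]
      change a j x * -(g x x) = -(g x x) * imUnit j
      rw [mul_neg, (hs x).2 j, neg_mul]
  refine ⟨fun x => F x, fun x => ?_, hFu, hFa⟩
  have hFc : ContinuousAt (fun y => (F y : ℍ[ℝ])) x :=
    (continuous_subtype_val.comp hF).continuousAt
  -- near `x` the continuous field is the smooth local field, up to a constant sign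
  have key : ∀ f : S3 → ℍ[ℝ], ContMDiffAt (𝓡 3) 𝓘(ℝ, ℍ[ℝ]) ∞ f x → (F x : ℍ[ℝ]) = f x →
      (∀ᶠ y in 𝓝 x, ‖f y‖ = 1 ∧ ∀ j, a j y * f y = f y * imUnit j) →
      ContMDiffAt (𝓡 3) 𝓘(ℝ, ℍ[ℝ]) ∞ (fun y => (F y : ℍ[ℝ])) x := by
    intro f hf hx hfu
    refine hf.congr_of_eventuallyEq ?_
    have hd : ContinuousAt (fun y => ‖(F y : ℍ[ℝ]) - f y‖) x := (hFc.sub hf.continuousAt).norm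
    have hlt : ∀ᶠ y in 𝓝 x, ‖(F y : ℍ[ℝ]) - f y‖ < 1 := by
      refine hd.eventually_lt continuousAt_const ?_
      rw [hx, sub_self, norm_zero]; exact one_pos
    filter_upwards [hlt, hfu] with y hy1 hy2
    rcases eq_or_eq_neg_of_intertwine hy2.1 (hFu y) hy2.2 (hFa y) with h | h
    · exact h
    · rw [h, ← neg_add', norm_neg, ← two_smul ℝ, norm_smul, hy2.1] at hy1
      norm_num at hy1
  rcases eq_or_eq_neg_of_intertwine (hs x).1 (hFu x) (hs x).2 (hFa x) with h | h
  · exact key (g x) (hg x) h (hgu x)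
  · refine key (fun y => -g x y) (hg x).neg h ?_
    filter_upwards [hgu x] with y hy
    exact ⟨by rw [norm_neg, hy.1], fun j => by rw [mul_neg, hy.2, neg_mul]⟩

end QuaternionField

/-! ### Frames and connection coefficients under a parity transformation -/

section SumDerivative

variable {E : Type*} [NormedAddCommGroup E] [NormedSpace ℝ E]
  {H : Type*} [TopologicalSpace H] {I : ModelWithCorners ℝ E H}
  {M : Type*} [TopologicalSpace M] [ChartedSpace H M]
  {F : Type*} [NormedAddCommGroup F] [NormedSpace ℝ F]

theorem mvfderiv_sum {ι : Type*} (s : Finset ι) {f : ι → M → F} {x : M}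
    (hf : ∀ i, MDifferentiableAt I 𝓘(ℝ, F) (f i) x) (v : TangentSpace I x) :
    mvfderiv I (fun y => ∑ i ∈ s, f i y) x v = ∑ i ∈ s, mvfderiv I (f i) x v := by
  classical
  suffices MDifferentiableAt I 𝓘(ℝ, F) (fun y => ∑ i ∈ s, f i y) x ∧
      mvfderiv I (fun y => ∑ i ∈ s, f i y) x v = ∑ i ∈ s, mvfderiv I (f i) x v from this.2
  induction s using Finset.induction_on with
  | empty =>
    simp only [Finset.sum_empty]
    exact ⟨mdifferentiableAt_const, by rw [mvfderiv_const]; rfl⟩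
  | insert i s his ih =>
    simp only [Finset.sum_insert his]
    refine ⟨(hf i).add ih.1, ?_⟩
    have := mvfderiv_add (hf i) ih.1
    exact (congrArg (fun T => T v) this).trans
      (congrArg (fun z => mvfderiv I (f i) x v + z) ih.2)

end SumDerivative

section LieBracketSum

open VectorField

variable {E : Type*} [NormedAddCommGroup E] [NormedSpace ℝ E] [CompleteSpace E]
  {H : Type*} [TopologicalSpace H] {I : ModelWithCorners ℝ E H}
  {M : Type*} [TopologicalSpace M] [ChartedSpace H M] [IsManifold I 2 M]

theorem mlieBracket_sum_smul_right {ι : Type*} (s : Finset ι) {f : ι → M → ℝ}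
    {X : (x : M) → TangentSpace I x} {F : ι → (x : M) → TangentSpace I x} {x : M}
    (hf : ∀ i, MDifferentiableAt I 𝓘(ℝ, ℝ) (f i) x)
    (hF : ∀ i, MDifferentiableAt I I.tangent (fun y => (⟨y, F i y⟩ : TangentBundle I M)) x) :
    mlieBracket I X (∑ i ∈ s, f i • F i) x =
      ∑ i ∈ s, (mvfderiv I (f i) x (X x) • F i x + f i x • mlieBracket I X (F i) x) := by
  classical
  have hd : ∀ t : Finset ι, MDifferentiableAt I I.tangent
      (fun y => (⟨y, (∑ i ∈ t, f i • F i) y⟩ : TangentBundle I M)) x := by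
    intro t
    have := MDifferentiableAt.sum_section (s := t) (fun i _ => (hf i).smul_section (hF i))
    simpa using this
  induction s using Finset.induction_on with
  | empty => simp
  | insert i s his ih =>
    rw [Finset.sum_insert his, Finset.sum_insert his,
      mlieBracket_add_right ((hf i).smul_section (hF i)) (hd s),
      mlieBracket_smul_right (hf i) (hF i), ih]

end LieBracketSum

section ParityGeometry

open VectorField

variable {h : S3Metric} {E : Fin 3 → VField} {p : S3 → S3}

theorem mfderiv_frame_eq (hE : IsOrthonormalFrame h E) (x : S3) (k : Fin 3) :
    mfderiv (𝓡 3) (𝓡 3) p x (E k x) = ∑ c, frameMatrix h E p x c k • E c (p x) :=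
  frame_expansion hE (p x) _

theorem inner_frame_sum (hE : IsOrthonormalFrame h E) (x : S3) (a b : Fin 3 → ℝ) :
    h.inner x (∑ i, a i • E i x) (∑ j, b j • E j x) = ∑ i, a i * b i := by
  simp [map_sum, hE.orthonormal, mul_comm]

theorem frameMatrix_transpose_mul (hE : IsOrthonormalFrame h E) (hp : IsParity h E p) (x : S3) :
    (frameMatrix h E p x).transpose * frameMatrix h E p x = 1 := by
  ext k l
  have h1 := hp.isometry x (E k x) (E l x)
  rw [mfderiv_frame_eq hE, mfderiv_frame_eq hE, inner_frame_sum hE, hE.orthonormal] at h1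
  rw [Matrix.mul_apply, Matrix.one_apply, ← h1]
  rfl

theorem frameMatrix_mul_transpose (hE : IsOrthonormalFrame h E) (hp : IsParity h E p) (x : S3) :
    frameMatrix h E p x * (frameMatrix h E p x).transpose = 1 :=
  mul_eq_one_comm.1 (frameMatrix_transpose_mul hE hp x)

theorem frameMatrix_det (hE : IsOrthonormalFrame h E) (hp : IsParity h E p) (x : S3) :
    (frameMatrix h E p x).det = -1 := by
  have h1 := congrArg Matrix.det (frameMatrix_transpose_mul hE hp x)
  rw [Matrix.det_mul, Matrix.det_transpose, Matrix.det_one] at h1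
  have h2 := hp.orientation_reversing x
  nlinarith

theorem contMDiff_frameMatrix (hE : IsOrthonormalFrame h E) (hp : ContMDiff (𝓡 3) (𝓡 3) ∞ p)
    (j k : Fin 3) : ContMDiff (𝓡 3) 𝓘(ℝ, ℝ) ∞ (fun x => frameMatrix h E p x j k) := by
  have hv : ContMDiff (𝓡 3) (𝓡 3).tangent ∞
      (fun x => (⟨p x, E j (p x)⟩ : TangentBundle (𝓡 3) S3)) := (hE.smooth j).comp hp
  have hw : ContMDiff (𝓡 3) (𝓡 3).tangent ∞
      (fun x => (⟨p x, mfderiv (𝓡 3) (𝓡 3) p x (E k x)⟩ : TangentBundle (𝓡 3) S3)) :=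
    (hp.contMDiff_tangentMap (m := ∞) le_rfl).comp (hE.smooth k)
  have h1 := ContMDiff.clm_bundle_apply₂ (F₃ := ℝ) (E₃ := Bundle.Trivial S3 ℝ)
    (h.contMDiff.comp hp) hv hw
  intro x
  have h2 := h1 x
  simp only [Bundle.contMDiffAt_totalSpace] at h2
  exact h2.2

theorem isInvertible_mfderiv_of_isometry
    (hp : ∀ (x : S3) (v w : TangentSpace (𝓡 3) x),
      h.inner (p x) (mfderiv (𝓡 3) (𝓡 3) p x v) (mfderiv (𝓡 3) (𝓡 3) p x w) = h.inner x v w)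
    (x : S3) : (mfderiv (𝓡 3) (𝓡 3) p x).IsInvertible := by
  have hinj : Function.Injective (mfderiv (𝓡 3) (𝓡 3) p x) := by
    rw [injective_iff_map_eq_zero]
    intro v hv
    by_contra hne
    have h1 := h.pos x v hne
    rw [← hp, hv, map_zero] at h1
    exact lt_irrefl _ h1
  let T : EuclideanSpace ℝ (Fin 3) →ₗ[ℝ] EuclideanSpace ℝ (Fin 3) :=
    (mfderiv (𝓡 3) (𝓡 3) p x).toLinearMap
  exact ⟨(LinearEquiv.ofInjectiveEndo T hinj).toContinuousLinearEquiv, rfl⟩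

/-- The pullback of the frame `E` along `p`. -/
noncomputable def pullbackFrame (E : Fin 3 → VField) (p : S3 → S3) (j : Fin 3) : VField :=
  mpullback (𝓡 3) (𝓡 3) p (E j)

theorem mfderiv_mpullback {x : S3} (hx : (mfderiv (𝓡 3) (𝓡 3) p x).IsInvertible) (X : VField) :
    mfderiv (𝓡 3) (𝓡 3) p x (mpullback (𝓡 3) (𝓡 3) p X x) = X (p x) :=
  hx.self_apply_inverse _

theorem frame_eq_sum_pullbackFrame (hE : IsOrthonormalFrame h E) (hp : IsParity h E p)
    (k : Fin 3) : E k = ∑ c, (fun x => frameMatrix h E p x c k) • pullbackFrame E p c := by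
  funext x
  have hinv := isInvertible_mfderiv_of_isometry hp.isometry x
  refine hinv.injective ?_
  rw [mfderiv_frame_eq hE, Finset.sum_apply, map_sum]
  refine Finset.sum_congr rfl fun c _ => ?_
  rw [Pi.smul_apply', map_smul, pullbackFrame, mfderiv_mpullback hinv]

theorem pullbackFrame_smooth (hE : IsOrthonormalFrame h E) (hp : IsParity h E p) (c : Fin 3) :
    (pullbackFrame E p c).Smooth :=
  ContMDiff.mpullback_vectorField (hE.smooth c) hp.smooth
    (isInvertible_mfderiv_of_isometry hp.isometry) le_rfl

/-- The structure functions `h([E k, E i], E j)` of a frame. -/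
noncomputable def frameBracket (h : S3Metric) (E : Fin 3 → VField) (k i j : Fin 3) (x : S3) : ℝ :=
  h.inner x (mlieBracket (𝓡 3) (E k) (E i) x) (E j x)

/-- The frame and its pullback `F` are related by `E k = ∑ c, R c k • F c`, and `p` sends the
brackets of `F` to those of `E`. -/
theorem mfderiv_mlieBracket_frame (hE : IsOrthonormalFrame h E) (hp : IsParity h E p)
    (k i : Fin 3) (x : S3) :
    mfderiv (𝓡 3) (𝓡 3) p x (mlieBracket (𝓡 3) (E k) (E i) x) =
      ∑ a, (mvfderiv (𝓡 3) (fun y => frameMatrix h E p y a i) x (E k x) -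
        mvfderiv (𝓡 3) (fun y => frameMatrix h E p y a k) x (E i x)) • E a (p x) +
      ∑ a, ∑ c, (frameMatrix h E p x a i * frameMatrix h E p x c k) •
        mlieBracket (𝓡 3) (E c) (E a) (p x) := by
  have hinv := isInvertible_mfderiv_of_isometry hp.isometry x
  have hR : ∀ a b, MDifferentiableAt (𝓡 3) 𝓘(ℝ, ℝ) (fun y => frameMatrix h E p y a b) x :=
    fun a b => (contMDiff_frameMatrix hE hp.smooth a b x).mdifferentiableAt (by simp)
  have hF : ∀ c, MDifferentiableAt (𝓡 3) (𝓡 3).tangent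
      (fun y => (⟨y, pullbackFrame E p c y⟩ : TangentBundle (𝓡 3) S3)) x := fun c =>
    (pullbackFrame_smooth hE hp c x).mdifferentiableAt (by simp)
  have hEd : ∀ c, MDifferentiableAt (𝓡 3) (𝓡 3).tangent
      (fun y => (⟨y, E c y⟩ : TangentBundle (𝓡 3) S3)) (p x) := fun c =>
    (hE.smooth c (p x)).mdifferentiableAt (by simp)
  have hbr : ∀ c a, mfderiv (𝓡 3) (𝓡 3) p x
      (mlieBracket (𝓡 3) (pullbackFrame E p c) (pullbackFrame E p a) x) =
        mlieBracket (𝓡 3) (E c) (E a) (p x) := by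
    intro c a
    have h1 := mpullback_mlieBracket (hEd c) (hEd a) (hp.smooth x) (n := ∞)
      (by rw [minSmoothness_of_isRCLikeNormedField]; exact ENat.LEInfty.out)
    refine (congrArg _ h1.symm).trans ?_
    exact mfderiv_mpullback hinv _
  have hFE : ∀ c, mfderiv (𝓡 3) (𝓡 3) p x (pullbackFrame E p c x) = E c (p x) := fun c =>
    mfderiv_mpullback hinv _
  have h1 : ∀ a, mlieBracket (𝓡 3) (E k) (pullbackFrame E p a) x =
      ∑ c, (-(mvfderiv (𝓡 3) (fun y => frameMatrix h E p y c k) x (pullbackFrame E p a x) •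
        pullbackFrame E p c x) + frameMatrix h E p x c k •
          mlieBracket (𝓡 3) (pullbackFrame E p c) (pullbackFrame E p a) x) := by
    intro a
    conv_lhs => rw [frame_eq_sum_pullbackFrame hE hp k]
    rw [mlieBracket_swap_apply, mlieBracket_sum_smul_right _ (fun c => hR c k) hF,
      ← Finset.sum_neg_distrib]
    refine Finset.sum_congr rfl fun c _ => ?_
    rw [mlieBracket_swap_apply (V := pullbackFrame E p c)]
    simp only [neg_add, smul_neg]
  have h2 : mlieBracket (𝓡 3) (E k) (E i) x =
      ∑ a, (mvfderiv (𝓡 3) (fun y => frameMatrix h E p y a i) x (E k x) • pullbackFrame E p a x +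
        frameMatrix h E p x a i • mlieBracket (𝓡 3) (E k) (pullbackFrame E p a) x) := by
    conv_lhs => rw [frame_eq_sum_pullbackFrame hE hp i]
    exact mlieBracket_sum_smul_right _ (fun c => hR c i) hF
  rw [h2]
  simp only [h1, map_sum, map_add, map_smul, map_neg, hFE, hbr]
  have h3 : ∀ c, mvfderiv (𝓡 3) (fun y => frameMatrix h E p y c k) x (E i x) =
      ∑ a, frameMatrix h E p x a i *
        mvfderiv (𝓡 3) (fun y => frameMatrix h E p y c k) x (pullbackFrame E p a x) := by
    intro c
    conv_lhs => rw [frame_eq_sum_pullbackFrame hE hp i]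
    rw [Finset.sum_apply, map_sum]
    refine Finset.sum_congr rfl fun a _ => ?_
    rw [Pi.smul_apply', map_smul, smul_eq_mul]
  simp only [h3, sub_smul, Finset.sum_sub_distrib, Finset.sum_add_distrib, smul_add, smul_neg,
    Finset.smul_sum, Finset.sum_neg_distrib, smul_smul, Finset.sum_smul]
  rw [Finset.sum_comm (f := fun c a => (frameMatrix h E p x a i *
    mvfderiv (𝓡 3) (fun y => frameMatrix h E p y c k) x (pullbackFrame E p a x)) • E c (p x))]
  abel

/-- Transformation of the structure functions of a frame under a parity transformation. -/
theorem frameBracket_eq (hE : IsOrthonormalFrame h E) (hp : IsParity h E p)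
    (k i j : Fin 3) (x : S3) :
    frameBracket h E k i j x =
      ∑ a, (mvfderiv (𝓡 3) (fun y => frameMatrix h E p y a i) x (E k x) -
        mvfderiv (𝓡 3) (fun y => frameMatrix h E p y a k) x (E i x)) * frameMatrix h E p x a j +
      ∑ c, ∑ a, ∑ b, frameMatrix h E p x c k * frameMatrix h E p x a i * frameMatrix h E p x b j *
        frameBracket h E c a b (p x) := by
  rw [frameBracket, ← hp.isometry, mfderiv_mlieBracket_frame hE hp, mfderiv_frame_eq hE, map_add,
    _root_.add_apply, inner_frame_sum hE]
  congr 1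
  simp only [map_sum, map_smul, _root_.sum_apply, _root_.smul_apply, smul_eq_mul, frameBracket]
  simp only [Fin.sum_univ_three]
  ring

/-- Since the frame matrix is orthogonal, its logarithmic derivative is skew. -/
theorem frameMatrix_deriv_skew (hE : IsOrthonormalFrame h E) (hp : IsParity h E p)
    (i j : Fin 3) (x : S3) (v : TangentSpace (𝓡 3) x) :
    ∑ b, mvfderiv (𝓡 3) (fun y => frameMatrix h E p y b i) x v * frameMatrix h E p x b j =
      -∑ b, mvfderiv (𝓡 3) (fun y => frameMatrix h E p y b j) x v * frameMatrix h E p x b i := by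
  have hR : ∀ a b, MDifferentiableAt (𝓡 3) 𝓘(ℝ, ℝ) (fun y => frameMatrix h E p y a b) x :=
    fun a b => (contMDiff_frameMatrix hE hp.smooth a b x).mdifferentiableAt (by simp)
  have h1 : (fun y => ∑ b, ContinuousLinearMap.mul ℝ ℝ (frameMatrix h E p y b i)
      (frameMatrix h E p y b j)) = fun _ => (1 : Matrix (Fin 3) (Fin 3) ℝ) i j := by
    funext y
    exact congrFun (congrFun (frameMatrix_transpose_mul hE hp y) i) j
  have h2 := mvfderiv_sum Finset.univ (fun b => ContMDiffAt.mdifferentiableAt (n := ∞)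
    (ContMDiffAt.bilin (ContinuousLinearMap.mul ℝ ℝ) (contMDiff_frameMatrix hE hp.smooth b i x)
      (contMDiff_frameMatrix hE hp.smooth b j x)) (by simp)) v
  rw [h1, mvfderiv_const] at h2
  rw [Finset.sum_congr rfl fun b _ => mvfderiv_bilin _ (hR b i) (hR b j) v] at h2
  simp only [ContinuousLinearMap.mul_apply', Finset.sum_add_distrib] at h2
  rw [eq_neg_iff_add_eq_zero]
  refine Eq.trans ?_ h2.symm
  exact congrArg _ (Finset.sum_congr rfl fun b _ => mul_comm _ _)

theorem leviCivitaCoeff_eq_frameBracket (k i j : Fin 3) (x : S3) :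
    leviCivitaCoeff h E k i j x = (1 / 2) * (frameBracket h E k i j x - frameBracket h E i j k x +
      frameBracket h E j k i x) := rfl

theorem sum_triple_rotate (u v w : Fin 3 → ℝ) (f : Fin 3 → Fin 3 → Fin 3 → ℝ) :
    ∑ c, ∑ a, ∑ b, u c * v a * w b * f c a b = ∑ c, ∑ a, ∑ b, w c * u a * v b * f a b c := by
  simp only [Fin.sum_univ_three]
  ring

/-- Transformation of the Levi-Civita connection under a parity transformation. -/
theorem leviCivitaCoeff_eq (hE : IsOrthonormalFrame h E) (hp : IsParity h E p)
    (k i j : Fin 3) (x : S3) :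
    leviCivitaCoeff h E k i j x =
      ∑ b, mvfderiv (𝓡 3) (fun y => frameMatrix h E p y b i) x (E k x) * frameMatrix h E p x b j +
      ∑ c, ∑ a, ∑ b, frameMatrix h E p x c k * frameMatrix h E p x a i * frameMatrix h E p x b j *
        leviCivitaCoeff h E c a b (p x) := by
  simp only [leviCivitaCoeff_eq_frameBracket, frameBracket_eq hE hp k, frameBracket_eq hE hp i,
    frameBracket_eq hE hp j]
  rw [sum_triple_rotate (fun c => frameMatrix h E p x c i) (fun c => frameMatrix h E p x c j)
      (fun c => frameMatrix h E p x c k),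
    sum_triple_rotate (fun c => frameMatrix h E p x c j) (fun c => frameMatrix h E p x c k)
      (fun c => frameMatrix h E p x c i),
    sum_triple_rotate (fun c => frameMatrix h E p x c i) (fun c => frameMatrix h E p x c j)
      (fun c => frameMatrix h E p x c k)]
  simp only [sub_mul, Finset.sum_sub_distrib, mul_add, mul_sub, Finset.sum_add_distrib]
  simp only [mul_left_comm _ (1 / 2 : ℝ), ← Finset.mul_sum]
  linear_combination -(1 / 2) * frameMatrix_deriv_skew hE hp i j x (E k x) -
    (1 / 2) * frameMatrix_deriv_skew hE hp k j x (E i x) +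
    (1 / 2) * frameMatrix_deriv_skew hE hp i k x (E j x)

end ParityGeometry

/-! ### The lift of a parity transformation to spinors -/

section SpinLift

open scoped Quaternion

theorem sum_triple_comm {M : Type*} [AddCommMonoid M] (f : Fin 3 → Fin 3 → Fin 3 → Fin 3 → M) :
    ∑ c, ∑ a, ∑ b, ∑ i, f c a b i = ∑ i, ∑ c, ∑ a, ∑ b, f c a b i := by
  rw [Finset.sum_comm (f := fun i c => ∑ a, ∑ b, f c a b i)]
  refine Finset.sum_congr rfl fun c _ => ?_
  rw [Finset.sum_comm (f := fun i a => ∑ b, f c a b i)]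
  refine Finset.sum_congr rfl fun a _ => ?_
  exact Finset.sum_comm

theorem sum_rotate_coeff {M : Type*} [AddCommGroup M] [Module ℝ M] (N : Fin 3 → Fin 3 → M)
    (D R : Fin 3 → Fin 3 → ℝ) (r : Fin 3 → ℝ) (w : Fin 3 → Fin 3 → Fin 3 → ℝ) :
    (1 / 4 : ℝ) • ∑ i, ∑ j, (∑ b, D b i * R b j +
        ∑ c, ∑ a, ∑ b, r c * R a i * R b j * w c a b) • N i j =
      (1 / 4 : ℝ) • ∑ b, ∑ i, ∑ j, (D b i * R b j) • N i j +
        ∑ c, r c • (1 / 4 : ℝ) • ∑ a, ∑ b, w c a b • ∑ i, ∑ j, (R a i * R b j) • N i j := by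
  simp only [add_smul, Finset.sum_smul, Finset.smul_sum, smul_smul, Finset.sum_add_distrib,
    smul_add]
  congr 1
  · rw [Finset.sum_comm (f := fun b i => ∑ j, (1 / 4 * (D b i * R b j)) • N i j)]
    refine Finset.sum_congr rfl fun i _ => Finset.sum_comm
  · refine Eq.trans ?_ (sum_triple_comm _).symm
    refine Finset.sum_congr rfl fun i _ => ?_
    refine Eq.trans ?_ (sum_triple_comm _).symm
    refine Finset.sum_congr rfl fun j _ => Finset.sum_congr rfl fun c _ =>
      Finset.sum_congr rfl fun a _ => Finset.sum_congr rfl fun b _ => ?_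
    congr 1
    ring

variable {h : S3Metric} {E : Fin 3 → VField} {p : S3 → S3}

/-- A parity transformation lifts to the spinor bundle: there is a smooth field of unit
quaternions which intertwines the Clifford multiplications up to sign, and the spin connections. -/
theorem exists_spin_lift (hE : IsOrthonormalFrame h E) (hp : IsParity h E p) :
    ∃ q : S3 → ℍ[ℝ], ContMDiff (𝓡 3) 𝓘(ℝ, ℍ[ℝ]) ∞ q ∧ (∀ x, ‖q x‖ = 1) ∧
      (∀ x j, ∑ k, frameMatrix h E p x j k • (imUnit k * q x) = -(q x * imUnit j)) ∧
      ∀ x k, mvfderiv (𝓡 3) q x (E k x) + spinConnection h E k x * q x =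
        ∑ c, frameMatrix h E p x c k • (q x * spinConnection h E c (p x)) := by
  -- the reflected frame, in terms of quaternions; the sign makes it positively oriented
  let a : Fin 3 → S3 → ℍ[ℝ] := fun j x => ∑ k, (-frameMatrix h E p x) j k • imUnit k
  have hR := contMDiff_frameMatrix hE hp.smooth
  have hRd : ∀ j k x, MDifferentiableAt (𝓡 3) 𝓘(ℝ, ℝ) (fun y => frameMatrix h E p y j k) x :=
    fun j k x => (hR j k x).mdifferentiableAt (by simp)
  let sm (k : Fin 3) : ℝ →L[ℝ] ℍ[ℝ] := -(ContinuousLinearMap.toSpanSingleton ℝ (imUnit k))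
  have ha' : ∀ j x, a j x = ∑ k, sm k (frameMatrix h E p x j k) := by
    intro j x
    refine Finset.sum_congr rfl fun k _ => ?_
    simp [sm]
  have hsm : ∀ j k, ContMDiff (𝓡 3) 𝓘(ℝ, ℍ[ℝ]) ∞ (fun x => sm k (frameMatrix h E p x j k)) :=
    fun j k => (sm k).contDiff.contMDiff.comp (hR j k)
  have ha : ∀ j, ContMDiff (𝓡 3) 𝓘(ℝ, ℍ[ℝ]) ∞ (a j) := by
    intro j
    rw [funext (ha' j)]
    exact fun x => contMDiffAt_finsetSum fun k _ => hsm j k x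
  have hda : ∀ j x (v : TangentSpace (𝓡 3) x), mvfderiv (𝓡 3) (a j) x v =
      -∑ k, mvfderiv (𝓡 3) (fun y => frameMatrix h E p y j k) x v • imUnit k := by
    intro j x v
    rw [funext (ha' j), mvfderiv_sum _ fun k => (hsm j k x).mdifferentiableAt (by simp),
      ← Finset.sum_neg_distrib]
    refine Finset.sum_congr rfl fun k _ => ?_
    rw [mvfderiv_clm_comp _ (hRd j k x)]
    simp [sm]
  have htriple : ∀ x, IsQuatTriple fun j => a j x := fun x => by
    refine isQuatTriple_of_rotation ?_ ?_
    · rw [Matrix.transpose_neg, neg_mul_neg, frameMatrix_mul_transpose hE hp]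
    · rw [Matrix.det_neg, frameMatrix_det hE hp]; norm_num
  obtain ⟨q, hq, hqu, hqa⟩ := exists_quat_field ha htriple
  have hqγ : ∀ x j, ∑ k, frameMatrix h E p x j k • (imUnit k * q x) = -(q x * imUnit j) := by
    intro x j
    rw [← hqa, ← neg_mul, Finset.sum_congr rfl fun k _ => (smul_mul_assoc _ _ _).symm,
      ← Finset.sum_mul]
    simp [a]
  refine ⟨q, hq, hqu, hqγ, fun x k => ?_⟩
  have hqd : MDifferentiableAt (𝓡 3) 𝓘(ℝ, ℍ[ℝ]) q x := (hq x).mdifferentiableAt (by simp)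
  set dq : ℍ[ℝ] := mvfderiv (𝓡 3) q x (E k x) with hdq
  have hre : (star (q x) * dq).re = 0 := by
    have h1 := mvfderiv_bilin (innerSL ℝ) hqd hqd (E k x)
    have h2 : (fun y => innerSL ℝ (q y) (q y)) = fun _ => (1 : ℝ) := by
      funext y
      rw [innerSL_apply_apply, real_inner_self_eq_norm_sq, hqu, one_pow]
    rw [h2, mvfderiv_const, innerSL_apply_apply, innerSL_apply_apply, real_inner_comm] at h1
    have h3 : (0 : ℝ) = inner ℝ (q x) dq + inner ℝ (q x) dq := h1
    rw [Quaternion.inner_def] at h3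
    simp at h3 ⊢
    linarith
  have hder : ∀ j, mvfderiv (𝓡 3) (a j) x (E k x) * q x + a j x * dq = dq * imUnit j := by
    intro j
    have had : MDifferentiableAt (𝓡 3) 𝓘(ℝ, ℍ[ℝ]) (a j) x := (ha j x).mdifferentiableAt (by simp)
    have h1 := mvfderiv_bilin (ContinuousLinearMap.mul ℝ ℍ[ℝ]) had hqd (E k x)
    have h2 := mvfderiv_clm_comp ((ContinuousLinearMap.mul ℝ ℍ[ℝ]).flip (imUnit j)) hqd (E k x)
    have h3 : (fun y => ContinuousLinearMap.mul ℝ ℍ[ℝ] (a j y) (q y)) =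
        fun y => (ContinuousLinearMap.mul ℝ ℍ[ℝ]).flip (imUnit j) (q y) := by
      funext y
      exact hqa y j
    rw [h3, h2] at h1
    exact h1.symm
  have hdq2 := quat_deriv_eq (hqu x) (hqa x) hre hder
  have hrot : ∀ i j, q x * (imUnit i * imUnit j) = a i x * a j x * q x := by
    intro i j
    rw [mul_assoc, hqa, ← mul_assoc, ← mul_assoc, hqa]
  -- the spin connection of the reflected frame
  have hΓ : spinConnection h E k x * q x =
      ((1 / 4 : ℝ) • ∑ b, mvfderiv (𝓡 3) (a b) x (E k x) * a b x) * q x +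
        ∑ c, frameMatrix h E p x c k • (q x * spinConnection h E c (p x)) := by
    have hprod : ∀ (s t : Fin 3 → ℝ), (∑ i, s i • imUnit i) * (∑ j, t j • imUnit j) * q x =
        ∑ i, ∑ j, (s i * t j) • (imUnit i * imUnit j * q x) := by
      intro s t
      rw [Finset.sum_mul_sum, Finset.sum_mul]
      refine Finset.sum_congr rfl fun i _ => ?_
      rw [Finset.sum_mul]
      refine Finset.sum_congr rfl fun j _ => ?_
      rw [smul_mul_smul_comm, smul_mul_assoc]
    have h1 : ∀ b c, a b x * a c x * q x = ∑ i, ∑ j,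
        (frameMatrix h E p x b i * frameMatrix h E p x c j) • (imUnit i * imUnit j * q x) := by
      intro b c
      rw [← hprod]
      simp [a]
    have h2 : ∀ b, mvfderiv (𝓡 3) (a b) x (E k x) * a b x * q x = ∑ i, ∑ j,
        (mvfderiv (𝓡 3) (fun y => frameMatrix h E p y b i) x (E k x) *
          frameMatrix h E p x b j) • (imUnit i * imUnit j * q x) := by
      intro b
      rw [← hprod, hda]
      simp [a]
    have h3 : ∀ c, q x * spinConnection h E c (p x) = (1 / 4 : ℝ) • ∑ b, ∑ d,
        leviCivitaCoeff h E c b d (p x) • ∑ i, ∑ j,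
          (frameMatrix h E p x b i * frameMatrix h E p x d j) • (imUnit i * imUnit j * q x) := by
      intro c
      simp only [spinConnection, mul_smul_comm, Finset.mul_sum]
      simp only [hrot]
      simp only [h1]
    rw [smul_mul_assoc, Finset.sum_mul, Finset.sum_congr rfl fun b _ => h2 b,
      Finset.sum_congr rfl fun c _ => congrArg _ (h3 c)]
    have h4 : spinConnection h E k x * q x = (1 / 4 : ℝ) • ∑ i, ∑ j,
        leviCivitaCoeff h E k i j x • (imUnit i * imUnit j * q x) := by
      simp only [spinConnection, smul_mul_assoc, Finset.sum_mul]
    rw [h4, Finset.sum_congr rfl fun i _ => Finset.sum_congr rfl fun j _ =>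
      congrArg (· • (imUnit i * imUnit j * q x)) (leviCivitaCoeff_eq hE hp k i j x)]
    exact sum_rotate_coeff _ _ _ _ _
  rw [hΓ, ← add_assoc]
  nth_rw 1 [hdq2]
  rw [neg_mul, neg_add_cancel, zero_add]

end SpinLift

/-! ### Antiunitary conjugation of Dirac operators -/

section AntiunitaryConjugation

open scoped Quaternion

/-- The inverse of an antiunitary transformation covering an involution covers it as well. -/
theorem AntiunitarilyConjugate.neg_symm {V : Type*} [NormedAddCommGroup V]
    [InnerProductSpace ℂ V] {p : S3 → S3} (hp : Function.Involutive p)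
    {D D' : SpinorField V → SpinorField V}
    (hD : AntiunitarilyConjugate p D (fun ψ => -D' ψ)) :
    AntiunitarilyConjugate p D' (fun ψ => -D ψ) := by
  obtain ⟨U, hsm, hn, hU⟩ := hD
  refine ⟨U.symm, fun ψ => ?_, fun ψ x => ?_, fun ψ hψ => ?_⟩
  · rw [← hsm (U.symm ψ), LinearEquiv.apply_symm_apply]
  · have := hn (U.symm ψ) (p x)
    rw [LinearEquiv.apply_symm_apply, hp x] at this
    exact this.symm
  · have h1 : (U.symm ψ).Smooth := by
      rwa [← hsm (U.symm ψ), LinearEquiv.apply_symm_apply]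
    have h2 := hU _ h1
    rw [LinearEquiv.apply_symm_apply] at h2
    rw [LinearEquiv.symm_apply_eq, map_neg, h2, neg_neg]

variable {n : ℕ} {G : Type*} [Group G] {V : Type*} [NormedAddCommGroup V]
  [InnerProductSpace ℂ V] [FiniteDimensional ℂ V]

theorem quatAct_smul (q : ℍ[ℝ]) (c : ℂ) (s : Spinor V) :
    quatAct q (c • s) = c • quatAct q s := by
  ext a; simp [quatAct_apply, smul_smul, mul_comm]

theorem opAct_smul (T : V →L[ℂ] V) (c : ℂ) (s : Spinor V) : opAct T (c • s) = c • opAct T s := by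
  ext a; simp

theorem norm_opAct_repCLM (ρ : G →* (V ≃ₗᵢ[ℂ] V)) (g : G) (s : Spinor V) :
    ‖opAct (repCLM ρ g) s‖ = ‖s‖ := by
  simp [PiLp.norm_eq_of_L2]

omit [FiniteDimensional ℂ V] in
theorem spinConj_symm_apply (K : V ≃ₗᵢ⋆[ℂ] V) (s : Spinor V) :
    (spinConj K).symm s = -spinConj K.symm s := by
  rw [LinearIsometryEquiv.symm_apply_eq, map_neg]
  ext a
  fin_cases a <;> simp [spinConj]

/-- The antiunitary operator `(U ψ)(x) = ρ(W(x))⁻¹ q(x) J ψ(p x)` on spinor fields, where `J` is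
`spinConj K`. -/
noncomputable def coveringConj {p : S3 → S3} (hp : Function.Involutive p) {q : S3 → ℍ[ℝ]}
    (hq : ∀ x, ‖q x‖ = 1) (K : V ≃ₗᵢ⋆[ℂ] V) (ρ : G →* (V ≃ₗᵢ[ℂ] V)) (W : S3 → G) :
    SpinorField V ≃ₛₗ[starRingEnd ℂ] SpinorField V where
  toFun ψ x := opAct (repCLM ρ (W x)⁻¹) (quatAct (q x) (spinConj K (ψ (p x))))
  invFun ψ x := (spinConj K).symm (quatAct (star (q (p x))) (opAct (repCLM ρ (W (p x))) (ψ (p x))))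
  map_add' ψ φ := by
    funext x
    simp only [Pi.add_apply, map_add]
  map_smul' c ψ := by
    funext x
    simp only [Pi.smul_apply, map_smulₛₗ (spinConj K), quatAct_smul, opAct_smul]
  left_inv ψ := by
    funext x
    beta_reduce
    rw [← opAct_mul, ← repCLM_mul, mul_inv_cancel, repCLM_one, opAct_one, ← quatAct_mul,
      star_mul_self_of_norm_one (hq _), quatAct_one, LinearIsometryEquiv.symm_apply_apply, hp x]
  right_inv ψ := by
    funext x
    beta_reduce
    rw [LinearIsometryEquiv.apply_symm_apply, hp x, ← quatAct_mul,
      self_mul_star_of_norm_one (hq _), quatAct_one, ← opAct_mul, ← repCLM_mul, inv_mul_cancel,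
      repCLM_one, opAct_one]

theorem norm_coveringConj {p : S3 → S3} (hp : Function.Involutive p) {q : S3 → ℍ[ℝ]}
    (hq : ∀ x, ‖q x‖ = 1) (K : V ≃ₗᵢ⋆[ℂ] V) {ρ : G →* (V ≃ₗᵢ[ℂ] V)} {W : S3 → G}
    (ψ : SpinorField V) (x : S3) :
    ‖coveringConj hp hq K ρ W ψ x‖ = ‖ψ (p x)‖ := by
  change ‖opAct (repCLM ρ (W x)⁻¹) (quatAct (q x) (spinConj K (ψ (p x))))‖ = _
  rw [norm_opAct_repCLM, quatAct_norm, hq, one_mul, LinearIsometryEquiv.norm_map]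

variable [TopologicalSpace G] [ChartedSpace (EuclideanSpace ℝ (Fin n)) G] [LieGroup (𝓡 n) ∞ G]

theorem smooth_quatAct {q : S3 → ℍ[ℝ]} {ψ : SpinorField V}
    (hq : ContMDiff (𝓡 3) 𝓘(ℝ, ℍ[ℝ]) ∞ q) (hψ : ψ.Smooth) :
    SpinorField.Smooth (fun x => quatAct (q x) (ψ x)) := fun x =>
  ContMDiffAt.bilin (quatAct (V := V)) (hq x) (hψ x)

theorem smooth_opAct {T : S3 → V →L[ℂ] V} {ψ : SpinorField V}
    (hT : ContMDiff (𝓡 3) 𝓘(ℝ, V →L[ℂ] V) ∞ T) (hψ : ψ.Smooth) :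
    SpinorField.Smooth (fun x => opAct (T x) (ψ x)) := fun x =>
  ContMDiffAt.bilin (opAct (V := V)) (hT x) (hψ x)

theorem smooth_coveringConj_iff {p : S3 → S3} (hp : Function.Involutive p) {q : S3 → ℍ[ℝ]}
    (hq : ∀ x, ‖q x‖ = 1) (K : V ≃ₗᵢ⋆[ℂ] V) {ρ : G →* (V ≃ₗᵢ[ℂ] V)} {W : S3 → G}
    (hps : ContMDiff (𝓡 3) (𝓡 3) ∞ p)
    (hqs : ContMDiff (𝓡 3) 𝓘(ℝ, ℍ[ℝ]) ∞ q) (hρ : SmoothRep (n := n) ρ)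
    (hW : ContMDiff (𝓡 3) (𝓡 n) ∞ W) (ψ : SpinorField V) :
    (coveringConj hp hq K ρ W ψ).Smooth ↔ ψ.Smooth := by
  have hρ' : ContMDiff (𝓡 n) 𝓘(ℝ, V →L[ℂ] V) ∞ (repCLM ρ) := hρ
  constructor
  · intro h
    have h1 : ψ = fun x => -spinConjCLM K.symm (quatAct (star (q (p x)))
        (opAct (repCLM ρ (W (p x))) (coveringConj hp hq K ρ W ψ (p x)))) := by
      funext x
      rw [spinConjCLM_apply, ← spinConj_symm_apply]
      exact (congrFun ((coveringConj hp hq K ρ W).symm_apply_apply ψ) x).symm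
    have hq' : ContMDiff (𝓡 3) 𝓘(ℝ, ℍ[ℝ]) ∞ (fun x => star (q (p x))) :=
      (LinearMap.toContinuousLinearMap (𝕜 := ℝ) (E := ℍ[ℝ]) (F' := ℍ[ℝ])
        ⟨⟨star, star_add⟩, Quaternion.star_smul⟩).contDiff.contMDiff.comp (hqs.comp hps)
    have hr : ContMDiff (𝓡 3) 𝓘(ℝ, V →L[ℂ] V) ∞ (fun x => repCLM ρ (W (p x))) :=
      hρ'.comp (hW.comp hps)
    have hφ : ContMDiff (𝓡 3) 𝓘(ℝ, Spinor V) ∞ (fun x => coveringConj hp hq K ρ W ψ (p x)) :=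
      ContMDiff.comp h hps
    generalize coveringConj hp hq K ρ W ψ = φ at h1 hφ
    have h2 := smooth_quatAct hq' (smooth_opAct hr hφ)
    rw [h1]
    exact (-spinConjCLM K.symm).contDiff.contMDiff.comp h2
  · intro h
    have hr : ContMDiff (𝓡 3) 𝓘(ℝ, V →L[ℂ] V) ∞ (fun x => repCLM ρ (W x)⁻¹) :=
      hρ'.comp (hW.inv)
    have hJ : ContMDiff (𝓡 3) 𝓘(ℝ, Spinor V) ∞ (fun x => spinConjCLM K (ψ (p x))) :=
      (spinConjCLM K).contDiff.contMDiff.comp (ContMDiff.comp h hps)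
    exact smooth_opAct hr (smooth_quatAct hqs hJ)

variable [LieAlgebra.IsSemisimple ℝ (LG (n := n) G)]

/-- If `B` is gauge equivalent to the CP-transform of `A`, then the Dirac operators of `A` and of
`B` are conjugate up to sign. -/
theorem antiunitarilyConjugate_of_gauge_cpTransform {ρ : G →* (V ≃ₗᵢ[ℂ] V)}
    (hρ : SmoothRep (n := n) ρ) {h : S3Metric} {E : Fin 3 → VField}
    (hE : IsOrthonormalFrame h E) {p : S3 → S3} (hp : IsParity h E p)
    {C : LG (n := n) G ≃ₗ⁅ℝ⁆ LG (n := n) G} (hC : IsChargeConjugation C)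
    {A B : GaugePotential (n := n) G} (hAB : GaugeEquivalent (cpTransform C p A) B) :
    AntiunitarilyConjugate p (diracOp h E ρ A) (fun ψ => -diracOp h E ρ B ψ) := by
  obtain ⟨t, ht, hCt⟩ := hC
  have : FiniteDimensional ℝ (LG (n := n) G) :=
    inferInstanceAs (FiniteDimensional ℝ (EuclideanSpace ℝ (Fin n)))
  obtain ⟨K, hK⟩ := exists_antiunitary_of_chevalley (derivedRepHom ρ) (derivedRep_lie hρ)
    (isSkew_derivedRep hρ) ht C hCt
  obtain ⟨q, hqs, hq, hqγ, hqω⟩ := exists_spin_lift hE hp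
  obtain ⟨W, hW, hBW⟩ := hAB
  refine ⟨coveringConj hp.involutive hq K ρ W,
    smooth_coveringConj_iff hp.involutive hq K hp.smooth hqs hρ hW,
    norm_coveringConj hp.involutive hq K, fun ψ hψ => ?_⟩
  have h1 := diracOp_cpTransform hE ρ hp.smooth hK hqs hqγ hqω A hψ
  have h2 := diracOp_gauge h E hρ hW hBW
    ((smooth_coveringConj_iff hp.involutive hq K hp.smooth hqs hρ hW ψ).2 hψ)
  have h3 : (fun x => opAct (repCLM ρ (W x)) (coveringConj hp.involutive hq K ρ W ψ x)) =
      fun x => quatAct (q x) (spinConj K (ψ (p x))) := by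
    funext x
    change opAct (repCLM ρ (W x)) (opAct (repCLM ρ (W x)⁻¹) _) = _
    rw [← opAct_mul, ← repCLM_mul, mul_inv_cancel, repCLM_one, opAct_one]
  rw [h3, h1] at h2
  funext x
  have h4 := congrFun h2 x
  change opAct (repCLM ρ (W x)⁻¹) (quatAct (q x) (spinConj K (diracOp h E ρ A ψ (p x)))) =
    -diracOp h E ρ B (coveringConj hp.involutive hq K ρ W ψ) x
  rw [← neg_eq_iff_eq_neg, ← map_neg, h4, ← opAct_mul, ← repCLM_mul, inv_mul_cancel, repCLM_one,
    opAct_one]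

end AntiunitaryConjugation

/-! ### The family of gauge potentials -/

section Family

/-- An even cutoff function, equal to `1` near `0` and vanishing at `±1`. -/
noncomputable def evenCutoff (τ : ℝ) : ℝ := Real.smoothTransition (2 - 4 * τ ^ 2)

/-- The function which is `1 - evenCutoff` on the negative half-line and `0` on the positive one.
It is smooth because `evenCutoff` is constant near `0`. -/
noncomputable def leftRamp (τ : ℝ) : ℝ := (1 - evenCutoff τ) * Real.smoothTransition (-2 * τ)

theorem contDiff_evenCutoff : ContDiff ℝ ∞ evenCutoff :=
  Real.smoothTransition.contDiff.comp (by fun_prop)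

theorem contDiff_leftRamp : ContDiff ℝ ∞ leftRamp :=
  (contDiff_const.sub contDiff_evenCutoff).mul (Real.smoothTransition.contDiff.comp (by fun_prop))

theorem evenCutoff_neg (τ : ℝ) : evenCutoff (-τ) = evenCutoff τ := by simp [evenCutoff]

theorem evenCutoff_zero : evenCutoff 0 = 1 :=
  Real.smoothTransition.one_of_one_le (by norm_num)

theorem evenCutoff_one : evenCutoff 1 = 0 :=
  Real.smoothTransition.zero_of_nonpos (by norm_num)

theorem leftRamp_of_nonneg {τ : ℝ} (hτ : 0 ≤ τ) : leftRamp τ = 0 := by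
  rw [leftRamp, Real.smoothTransition.zero_of_nonpos (by linarith), mul_zero]

theorem leftRamp_neg {τ : ℝ} (hτ : 0 ≤ τ) : leftRamp (-τ) = 1 - evenCutoff τ := by
  rw [leftRamp, evenCutoff_neg]
  rcases le_or_gt τ (1 / 2) with h | h
  · rw [evenCutoff, Real.smoothTransition.one_of_one_le (x := 2 - 4 * τ ^ 2) (by nlinarith),
      sub_self, zero_mul]
  · rw [Real.smoothTransition.one_of_one_le (by linarith), mul_one]

variable {n : ℕ} {G : Type*} [TopologicalSpace G] [ChartedSpace (EuclideanSpace ℝ (Fin n)) G]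
  [Group G]

/-- The family which joins `0`, at `τ = 1`, to `A`, at `τ = 0`, and then to the pure gauge
`W⁻¹ dW`, at `τ = -1`. -/
noncomputable def pureGaugeFamily (A : GaugePotential (n := n) G) (W : S3 → G) (τ : ℝ) :
    GaugePotential (n := n) G := fun x =>
  evenCutoff τ • A x + leftRamp τ • (leftLogDerivCLM (n := n) (𝓡 3) W x).toLinearMap

theorem pureGaugeFamily_apply (A : GaugePotential (n := n) G) (W : S3 → G) (τ : ℝ) (x : S3)
    (v : TangentSpace (𝓡 3) x) : pureGaugeFamily A W τ x v =
      evenCutoff τ • A x v + leftRamp τ • pureGauge (n := n) W x v := rfl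

variable [LieGroup (𝓡 n) ∞ G]

theorem smoothFamily_pureGaugeFamily {A : GaugePotential (n := n) G} (hA : A.Smooth) {W : S3 → G}
    (hW : ContMDiff (𝓡 3) (𝓡 n) ∞ W) : SmoothFamily (pureGaugeFamily A W) := by
  intro X hX
  have h1 : ContMDiff (M' := EuclideanSpace ℝ (Fin n)) (𝓘(ℝ, ℝ).prod (𝓡 3))
      𝓘(ℝ, EuclideanSpace ℝ (Fin n)) ∞ (fun q : ℝ × S3 => A q.2 (X q.2)) :=
    (hA X hX).comp contMDiff_snd
  have h2 : ContMDiff (M' := EuclideanSpace ℝ (Fin n)) (𝓘(ℝ, ℝ).prod (𝓡 3))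
      𝓘(ℝ, EuclideanSpace ℝ (Fin n)) ∞ (fun q : ℝ × S3 => pureGauge W q.2 (X q.2)) :=
    (contMDiff_leftLogDeriv hW hX).comp contMDiff_snd
  have h3 : ContMDiff (𝓘(ℝ, ℝ).prod (𝓡 3)) 𝓘(ℝ, ℝ) ∞ (fun q : ℝ × S3 => evenCutoff q.1) :=
    contDiff_evenCutoff.contMDiff.comp contMDiff_fst
  have h4 : ContMDiff (𝓘(ℝ, ℝ).prod (𝓡 3)) 𝓘(ℝ, ℝ) ∞ (fun q : ℝ × S3 => leftRamp q.1) :=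
    contDiff_leftRamp.contMDiff.comp contMDiff_fst
  exact ((h3.smul h1).add (h4.smul h2)).contMDiffOn

omit [LieGroup (𝓡 n) ∞ G] in
theorem adjointMap_add (g : G) (X Y : LG (n := n) G) :
    adjointMap g (X + Y) = adjointMap g X + adjointMap g Y := map_add (adjointCLM g) X Y

omit [LieGroup (𝓡 n) ∞ G] in
theorem adjointMap_smul (g : G) (c : ℝ) (X : LG (n := n) G) :
    adjointMap g (c • X) = c • adjointMap g X := map_smul (adjointCLM g) c X

theorem cpTransform_pureGaugeFamily (C : LG (n := n) G ≃ₗ⁅ℝ⁆ LG (n := n) G) (p : S3 → S3)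
    (A : GaugePotential (n := n) G) (W : S3 → G) {τ : ℝ} (hτ : 0 ≤ τ) (x : S3)
    (v : TangentSpace (𝓡 3) x) :
    cpTransform C p (pureGaugeFamily A W τ) x v = evenCutoff τ • cpTransform C p A x v := by
  rw [cpTransform_apply, cpTransform_apply, pureGaugeFamily_apply, leftRamp_of_nonneg hτ, zero_smul,
    add_zero, map_smul]

/-- If `A^CP = Ad(W⁻¹) A + W⁻¹ dW`, the CP-transform of the potential at `τ ≥ 0` is turned by the
gauge transformation `W⁻¹` into the potential at `-τ`. -/
theorem gaugeEquivalent_pureGaugeFamily {C : LG (n := n) G ≃ₗ⁅ℝ⁆ LG (n := n) G} {p : S3 → S3}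
    {A : GaugePotential (n := n) G} {W : S3 → G} (hW : ContMDiff (𝓡 3) (𝓡 n) ∞ W)
    (hA : ∀ (x : S3) (v : TangentSpace (𝓡 3) x),
      cpTransform C p A x v = adjointMap (W x)⁻¹ (A x v) + pureGauge W x v)
    {τ : ℝ} (hτ : 0 ≤ τ) :
    GaugeEquivalent (cpTransform C p (pureGaugeFamily A (fun x => (W x)⁻¹) τ))
      (pureGaugeFamily A (fun x => (W x)⁻¹) (-τ)) := by
  refine ⟨fun x => (W x)⁻¹, hW.inv, fun x v => ?_⟩
  have h1 : adjointMap (W x) (pureGauge (n := n) W x v) =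
      -pureGauge (n := n) (fun y => (W y)⁻¹) x v := eq_neg_of_add_eq_zero_left
    (adjointMap_leftLogDeriv_add_inv ((hW x).mdifferentiableAt (by simp)) v)
  rw [pureGaugeFamily_apply, cpTransform_pureGaugeFamily C p A _ hτ, evenCutoff_neg,
    leftRamp_neg hτ, inv_inv, adjointMap_smul, hA, adjointMap_add, ← adjointMap_mul,
    mul_inv_cancel, adjointMap_one, h1]
  module

omit [LieGroup (𝓡 n) ∞ G] in
theorem isPureGauge_pureGaugeFamily_one (A : GaugePotential (n := n) G) (W : S3 → G) :
    IsPureGauge (pureGaugeFamily A W 1) := by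
  refine ⟨fun _ => 1, contMDiff_const, fun x v => ?_⟩
  rw [pureGaugeFamily_apply, evenCutoff_one, leftRamp_of_nonneg zero_le_one, zero_smul, zero_smul,
    add_zero]
  exact (congrArg (fun T => T v) (mfderiv_const (I := 𝓡 3) (I' := 𝓡 n) (x := x)
    (c := (1 : G)⁻¹ * 1))).symm

omit [LieGroup (𝓡 n) ∞ G] in
theorem isPureGauge_pureGaugeFamily_neg_one (A : GaugePotential (n := n) G) {W : S3 → G}
    (hW : ContMDiff (𝓡 3) (𝓡 n) ∞ W) : IsPureGauge (pureGaugeFamily A W (-1)) := by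
  refine ⟨W, hW, fun x v => ?_⟩
  rw [pureGaugeFamily_apply, leftRamp_neg zero_le_one, evenCutoff_neg, evenCutoff_one, zero_smul,
    zero_add, sub_zero, one_smul]

omit [LieGroup (𝓡 n) ∞ G] in
theorem pureGaugeFamily_zero (A : GaugePotential (n := n) G) (W : S3 → G) :
    pureGaugeFamily A W 0 = A := by
  funext x
  ext1 v
  rw [pureGaugeFamily_apply, leftRamp_of_nonneg le_rfl, evenCutoff_zero, zero_smul, one_smul,
    add_zero]

end Family

theorem mainTheorem5 {n : ℕ} {G : Type*} [TopologicalSpace G] [T2Space G]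
    [ChartedSpace (EuclideanSpace ℝ (Fin n)) G] [Group G] [LieGroup (𝓡 n) ∞ G]
    [CompactSpace G] [SimplyConnectedSpace G] [LieAlgebra.IsSemisimple ℝ (LG (n := n) G)]
    {V : Type*} [NormedAddCommGroup V] [InnerProductSpace ℂ V] [FiniteDimensional ℂ V]
    (ρ : G →* (V ≃ₗᵢ[ℂ] V)) (hρ : SmoothRep (n := n) ρ)
    (h : S3Metric) (E : Fin 3 → VField) (hE : IsOrthonormalFrame h E)
    (p : S3 → S3) (hp : IsParity h E p)
    (C : LG (n := n) G ≃ₗ⁅ℝ⁆ LG (n := n) G) (hC : IsChargeConjugation C)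
    (A : GaugePotential (n := n) G) (hA : A.Smooth) (hCP : IsCPSymmetric C p A) :
    ∃ 𝒜 : ℝ → GaugePotential (n := n) G,
      IsReflectionAntisymmetricFamily h E ρ p A 𝒜 ∧
      ∀ τ ∈ Icc (0 : ℝ) 1, GaugeEquivalent (cpTransform C p (𝒜 τ)) (𝒜 (-τ)) := by
  obtain ⟨W, hW, hAW⟩ := hCP
  have hg : ∀ {τ : ℝ}, 0 ≤ τ →
      GaugeEquivalent (cpTransform C p (pureGaugeFamily A (fun x => (W x)⁻¹) τ))
        (pureGaugeFamily A (fun x => (W x)⁻¹) (-τ)) := fun hτ =>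
    gaugeEquivalent_pureGaugeFamily hW hAW hτ
  refine ⟨pureGaugeFamily A (fun x => (W x)⁻¹), ⟨smoothFamily_pureGaugeFamily hA hW.inv,
    pureGaugeFamily_zero A _, isPureGauge_pureGaugeFamily_neg_one A hW.inv,
    isPureGauge_pureGaugeFamily_one A _, fun τ _ => ?_⟩, fun τ hτ => hg hτ.1⟩
  rcases le_total 0 τ with hτ | hτ
  · exact antiunitarilyConjugate_of_gauge_cpTransform hρ hE hp hC (hg hτ)
  · have h1 := antiunitarilyConjugate_of_gauge_cpTransform hρ hE hp hC (hg (neg_nonneg.2 hτ))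
    rw [neg_neg] at h1
    exact h1.neg_symm hp.involutive
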